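/- **Setting.** Let $N\in\mathbb N$, let $t^a$ be a basis of $\mathfrak{su}(N)$ with Killing form $\kappa(t^a,t^b)=-2\delta^{ab}$ and structure constants $[t^a,t^b]=f^{abc}t^c$ (repeated indices are summed). Let $B_\mu^d$ ($\mu=1,2$) be real constants such that the matrices $B_\mu$ with entries $(B_\mu)^{ab}=f^{adb}B^d_\mu$ commute, $[B_\mu,B_\nu]=0$. For $s>0$ let $D_\mu=\partial_\mu+sB_\mu$ on $\mathbb R^2$, and put $$M=-D_\mu\partial_\mu,\qquad \Phi_0(z)=\exp(-s z^\mu B_\mu/2),\qquad m=-\tfrac14B_\mu B_\mu .$$ Let $\mu>0$ be a mass scale, $\Lambda>0$, $L=\ln(\Lambda/\mu)$, $A=-\partial_\mu\partial_\mu$, $\rho(r)=J_0(|r|)$, and $$R_0(x)=-\frac{\ln(|x|^2\mu^2)}{4\pi},\qquad R_1(x)=\frac{|x|^2(\ln(|x|^2\mu^2)-2)}{16\pi}.$$ For a translation invariant operator $P$ with (matrix) symbol $\sigma$, $\rho(\sqrt P/\Lambda)$ is the operator on tempered distributions that multiplies the Fourier transform by $\sum_{n\ge0}\frac{(-\sigma/4\Lambda^2)^n}{(n!)^2}=J_0(\sqrt\sigma/\Lambda)$.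 All $o(s^2)$ are for $s\to+0$ and uniform for bounded arguments. **Theorem (2-D Sigma-model).** For all $y\in\mathbb R^2$, $$\hat M:=\Phi_0(y-x)\,M(x)\,\Phi_0(x-y)=-\partial_\mu\partial_\mu-s^2m .$$ There are Green's functions $\hat G=\hat G_s$ ($s>0$) of $\hat M$, that is, tempered solutions of $\hat M(x)\hat G(x-y)=\delta(x-y)$, with $\hat G(z)$ continuous for $z\neq0$ and $\hat G-R_0$ bounded near $z=0$, such that $$\hat G=R_0+s^2mR_1+o(s^2).$$ For every such family and all $x,y\in\mathbb R^2$, $\rho(\sqrt{\hat M(x)}/\Lambda)\hat G(x-y)$ is a continuous function of $x-y$ and $$\rho\big(\sqrt{\hat M(x)}/\Lambda\big)\hat G(x-y)=\tilde R_0(x-y)+s^2m\big(\tilde R_1(x-y)+\hat R_0(x-y)\big)+o(s^2).$$ Moreover, $G(x-y)=\Phi_0(x-y)\hat G(x-y)$ is a Green's function of $M$, and for all $s>0$ $$\rho\big(\sqrt{M(x)}/\Lambda\big)G(x-y)=\Phi_0(x-y)\,\rho\big(\sqrt{\hat M(x)}/\Lambda\big)\hat G(x-y).$$ Here $$\tilde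 R_0(x)=\rho\big(\sqrt A/\Lambda\big)R_0(x)=\frac1{4\pi}\begin{cases}-\ln(|x|^2\mu^2),&|x|>1/\Lambda,\\ 2L,&|x|\le1/\Lambda,\end{cases}$$ $$\tilde R_1(x)=\rho\big(\sqrt A/\Lambda\big)R_1(x)=\frac1{4\pi}\begin{cases}\frac14|x|^2(\ln(|x|^2\mu^2)-2)+\frac14\Lambda^{-2}\ln(|x|^2\mu^2),&|x|>1/\Lambda,\\ -\frac12(L+1)\Lambda^{-2}-\frac12L|x|^2,&|x|\le1/\Lambda,\end{cases}$$ and $m\hat R_0(x)=\frac{\partial}{\partial s^2}\big|_{s=0}\,\rho\big(\sqrt{\hat M}/\Lambda\big)R_0(x)$ with $$\hat R_0(x)=\frac1{4\pi}\begin{cases}-\frac14\Lambda^{-2}\ln(|x|^2\mu^2),&|x|>1/\Lambda,\\ \frac12L\Lambda^{-2}+\frac14(\Lambda^{-2}-|x|^2),&|x|\le1/\Lambda.\end{cases}$$ -/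

import Mathlib

open Real Filter Topology MeasureTheory
open scoped SchwartzMap LineDeriv

noncomputable section

namespace Sigma2D

/-- The Euclidean plane. -/
abbrev Plane : Type := EuclideanSpace ℝ (Fin 2)

/-! ### The Lie algebra, its structure constants, and the constant connection -/

attribute [local instance] LieRing.ofAssociativeRing

/-- The real Lie algebra `su(N)`: traceless skew-Hermitian complex `N × N` matrices. -/
def su (N : ℕ) : LieSubalgebra ℝ (Matrix (Fin N) (Fin N) ℂ) where
  carrier := {X | X.conjTranspose = -X ∧ X.trace = 0}
  zero_mem' := by simp
  add_mem' := by
    rintro X Y ⟨hX, hX'⟩ ⟨hY, hY'⟩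
    refine ⟨?_, ?_⟩
    · rw [Matrix.conjTranspose_add, hX, hY, neg_add]
    · rw [Matrix.trace_add, hX', hY', add_zero]
  smul_mem' := by
    rintro c X ⟨hX, hX'⟩
    refine ⟨?_, ?_⟩
    · rw [Matrix.conjTranspose_smul, hX, smul_neg, star_trivial]
    · rw [Matrix.trace_smul, hX', smul_zero]
  lie_mem' := by
    rintro X Y ⟨hX, hX'⟩ ⟨hY, hY'⟩
    refine ⟨?_, ?_⟩
    · rw [Ring.lie_def, Matrix.conjTranspose_sub, Matrix.conjTranspose_mul,
        Matrix.conjTranspose_mul, hX, hY, neg_mul_neg, neg_mul_neg, neg_sub]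
    · rw [Ring.lie_def, Matrix.trace_sub, Matrix.trace_mul_comm, sub_self]

variable {ι : Type*} [Fintype ι] [DecidableEq ι]

/-- Structure constants: `[t^a, t^b] = f^{abc} t^c`. -/
def structConst {N : ℕ} (t : Module.Basis ι ℝ (su N)) (a b c : ι) : ℝ :=
  t.repr ⁅t a, t b⁆ c

/-- The matrices `B_μ` with entries `(B_μ)^{ab} = f^{adb} B_μ^d`, for constant components
`β μ d = B_μ^d`. -/
def connection {N : ℕ} (t : Module.Basis ι ℝ (su N)) (β : Fin 2 → ι → ℝ) (μ : Fin 2) :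
    Matrix ι ι ℂ :=
  fun a b => ((∑ d, structConst t a d b * β μ d : ℝ) : ℂ)

/-- `m = -B_μ B_μ / 4`. -/
def massMatrix (B : Fin 2 → Matrix ι ι ℂ) : Matrix ι ι ℂ :=
  (-(1 / 4 : ℂ)) • ∑ μ, B μ * B μ

/-- `Φ₀(z) = exp(-s z^μ B_μ / 2)`. -/
def gaugeFactor (B : Fin 2 → Matrix ι ι ℂ) (s : ℝ) (z : Plane) : Matrix ι ι ℂ :=
  NormedSpace.exp (∑ μ, (-(s * z μ / 2 : ℝ) : ℂ) • B μ)

/-! ### Matrices of tempered distributions -/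

/-- A tempered distribution given by integration against the function `u`. -/
def Represents (T : 𝓢'(Plane, ℂ)) (u : Plane → ℂ) : Prop :=
  ∀ φ : 𝓢(Plane, ℂ), Integrable (fun x => φ x * u x) ∧ T φ = ∫ x, φ x * u x

/-- The entrywise version of `Represents`. -/
def MatRepresents (T : Matrix ι ι 𝓢'(Plane, ℂ)) (u : Plane → Matrix ι ι ℂ) : Prop :=
  ∀ a b, Represents (T a b) (fun x => u x a b)

/-- `P u = v` in the sense of tempered distributions, for functions `u`, `v`.
(The distribution given by `u` is unique.) -/
def MapsTo (P : Matrix ι ι 𝓢'(Plane, ℂ) → Matrix ι ι 𝓢'(Plane, ℂ))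
    (u v : Plane → Matrix ι ι ℂ) : Prop :=
  ∃ T, MatRepresents T u ∧ MatRepresents (P T) v

/-- Left multiplication of a matrix of distributions by a constant matrix. -/
def constMul (C : Matrix ι ι ℂ) (T : Matrix ι ι 𝓢'(Plane, ℂ)) : Matrix ι ι 𝓢'(Plane, ℂ) :=
  fun a b => ∑ c, C a c • T c b

/-- Left multiplication of a matrix of distributions by a matrix-valued function. -/
def funMul (Φ : Plane → Matrix ι ι ℂ) (T : Matrix ι ι 𝓢'(Plane, ℂ)) :
    Matrix ι ι 𝓢'(Plane, ℂ) :=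
  fun a b => ∑ c, TemperedDistribution.smulLeftCLM ℂ (fun x => Φ x a c) (T c b)

/-- Entrywise partial derivative `∂_μ`. -/
def partialD (μ : Fin 2) (T : Matrix ι ι 𝓢'(Plane, ℂ)) : Matrix ι ι 𝓢'(Plane, ℂ) :=
  fun a b => ∂_{(EuclideanSpace.single μ (1 : ℝ) : Plane)} (T a b)

/-- The covariant derivative `D_μ = ∂_μ + s B_μ`. -/
def covD (B : Fin 2 → Matrix ι ι ℂ) (s : ℝ) (μ : Fin 2) (T : Matrix ι ι 𝓢'(Plane, ℂ)) :
    Matrix ι ι 𝓢'(Plane, ℂ) :=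
  partialD μ T + constMul ((s : ℂ) • B μ) T

/-- `M = -D_μ ∂_μ`. -/
def opM (B : Fin 2 → Matrix ι ι ℂ) (s : ℝ) (T : Matrix ι ι 𝓢'(Plane, ℂ)) :
    Matrix ι ι 𝓢'(Plane, ℂ) :=
  -∑ μ, covD B s μ (partialD μ T)

/-- `M̂ = -∂_μ ∂_μ - s² m`. -/
def opMhat (B : Fin 2 → Matrix ι ι ℂ) (s : ℝ) (T : Matrix ι ι 𝓢'(Plane, ℂ)) :
    Matrix ι ι 𝓢'(Plane, ℂ) :=
  -(∑ μ, partialD μ (partialD μ T)) - constMul (((s ^ 2 : ℝ) : ℂ) • massMatrix B) T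

/-- The matrix `1 · δ(x - y)`. -/
def deltaMat (y : Plane) : Matrix ι ι 𝓢'(Plane, ℂ) :=
  fun a b => if a = b then TemperedDistribution.delta y else 0

/-! ### The operators `ρ(√P / Λ)`, `ρ = J₀` -/

/-- The entire function `z ↦ J₀(√z) = ∑ₙ (-z/4)ⁿ / (n!)²`, for complex numbers and for complex
square matrices. -/
def besselSqrt {R : Type*} [Ring R] [Algebra ℂ R] [TopologicalSpace R] (z : R) : R :=
  ∑' n : ℕ, ((-1 / 4 : ℂ) ^ n / ((Nat.factorial n : ℂ) ^ 2)) • z ^ n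

/-- `ρ(√P / Λ)` for an operator `P` with constant matrix coefficients. Here `P` is given by its
symbol `σ`, that is `P (e^{2πi⟨ξ, x⟩} v) = e^{2πi⟨ξ, x⟩} σ(ξ) v`, and `ρ(√P / Λ)` multiplies the
Fourier transform by `J₀(√σ(ξ) / Λ)`. -/
def rhoOp (Λ : ℝ) (σ : Plane → Matrix ι ι ℂ) (T : Matrix ι ι 𝓢'(Plane, ℂ)) :
    Matrix ι ι 𝓢'(Plane, ℂ) :=
  fun a b => ∑ c, TemperedDistribution.fourierMultiplierCLM ℂ
    (fun ξ => besselSqrt (((1 / Λ ^ 2 : ℝ) : ℂ) • σ ξ) a c) (T c b)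

/-- `ρ(√A / Λ)` for the scalar operator `A = -∂_μ ∂_μ`, whose symbol is `|2πξ|²`. -/
def rhoLaplace (Λ : ℝ) (T : 𝓢'(Plane, ℂ)) : 𝓢'(Plane, ℂ) :=
  TemperedDistribution.fourierMultiplierCLM ℂ
    (fun ξ => besselSqrt (((2 * π * ‖ξ‖ / Λ) ^ 2 : ℝ) : ℂ)) T

/-- The symbol of `∂_μ`, namely `2πi ξ_μ`. -/
def symbolD (μ : Fin 2) (ξ : Plane) : Matrix ι ι ℂ :=
  (2 * π * Complex.I * (ξ μ : ℂ)) • 1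

/-- The symbol of `M = -(∂_μ + s B_μ) ∂_μ`. -/
def symbolM (B : Fin 2 → Matrix ι ι ℂ) (s : ℝ) (ξ : Plane) : Matrix ι ι ℂ :=
  -∑ μ, (symbolD μ ξ + (s : ℂ) • B μ) * symbolD μ ξ

/-- The symbol of `-∂_μ ∂_μ - τ m`. The operator `M̂` has `τ = s²`. -/
def symbolMhat (B : Fin 2 → Matrix ι ι ℂ) (τ : ℝ) (ξ : Plane) : Matrix ι ι ℂ :=
  -(∑ μ, symbolD μ ξ * symbolD μ ξ) - (τ : ℂ) • massMatrix B

/-! ### The explicit functions; `M₀ > 0` is the mass scale and `L = ln(Λ / M₀)` -/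

/-- `R₀(x) = -ln(|x|² M₀²) / 4π`. -/
def R0 (M₀ : ℝ) (x : Plane) : ℝ := -(1 / (4 * π)) * log (‖x‖ ^ 2 * M₀ ^ 2)

/-- `R₁(x) = |x|² (ln(|x|² M₀²) - 2) / 16π`. -/
def R1 (M₀ : ℝ) (x : Plane) : ℝ := ‖x‖ ^ 2 * (log (‖x‖ ^ 2 * M₀ ^ 2) - 2) / (16 * π)

/-- The function `R̃₀`. -/
def R0tilde (M₀ Λ : ℝ) (x : Plane) : ℝ :=
  1 / (4 * π) * if 1 / Λ < ‖x‖ then -log (‖x‖ ^ 2 * M₀ ^ 2) else 2 * log (Λ / M₀)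

/-- The function `R̃₁`. -/
def R1tilde (M₀ Λ : ℝ) (x : Plane) : ℝ :=
  1 / (4 * π) * if 1 / Λ < ‖x‖ then
      1 / 4 * ‖x‖ ^ 2 * (log (‖x‖ ^ 2 * M₀ ^ 2) - 2)
        + 1 / 4 * (1 / Λ ^ 2) * log (‖x‖ ^ 2 * M₀ ^ 2)
    else
      -(1 / 2) * (log (Λ / M₀) + 1) * (1 / Λ ^ 2) - 1 / 2 * log (Λ / M₀) * ‖x‖ ^ 2

/-- The function `R̂₀`. -/
def R0hat (M₀ Λ : ℝ) (x : Plane) : ℝ :=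
  1 / (4 * π) * if 1 / Λ < ‖x‖ then
      -(1 / 4) * (1 / Λ ^ 2) * log (‖x‖ ^ 2 * M₀ ^ 2)
    else
      1 / 2 * log (Λ / M₀) * (1 / Λ ^ 2) + 1 / 4 * (1 / Λ ^ 2 - ‖x‖ ^ 2)

/-! ### Green's functions -/

/-- `F s x = o(s²)` as `s → +0`, uniformly for `x` in bounded subsets of `S`. -/
def IsLittleOSq (S : Set Plane) (F : ℝ → Plane → Matrix ι ι ℂ) : Prop :=
  ∀ r > 0, ∀ ε > 0, ∀ᶠ s in 𝓝[>] (0 : ℝ), ∀ x ∈ S, ‖x‖ ≤ r → ∀ a b, ‖F s x a b‖ ≤ ε * s ^ 2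

/-- `(x, y) ↦ g (x - y)` is a Green's function of the translation invariant operator `P`: it is
continuous off the diagonal and its singularity there is `R₀` up to a bounded term, it defines a
tempered distribution, and `P g(· - y) = δ(· - y)`. -/
structure IsGreenFunction (M₀ : ℝ)
    (P : Matrix ι ι 𝓢'(Plane, ℂ) → Matrix ι ι 𝓢'(Plane, ℂ))
    (g : Plane → Matrix ι ι ℂ) : Prop where
  continuous_off : ∀ a b, ContinuousOn (fun z => g z a b) {0}ᶜ
  singularity : ∃ C : ℝ, ∀ z : Plane, 0 < ‖z‖ → ‖z‖ ≤ 1 → ∀ a b,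
    ‖(g z - (R0 M₀ z : ℂ) • (1 : Matrix ι ι ℂ)) a b‖ ≤ C
  eqn : ∀ y : Plane, ∃ T, MatRepresents T (fun x => g (x - y)) ∧ P T = deltaMat y

/-- A family, indexed by `s > 0`, of Green's functions of `M̂`, normalised by
`Ĝ = R₀ + s² m R₁ + o(s²)` as `s → +0`, for bounded arguments. -/
structure IsNormalisedGreen (M₀ : ℝ) (B : Fin 2 → Matrix ι ι ℂ)
    (Ghat : ℝ → Plane → Matrix ι ι ℂ) : Prop where
  green : ∀ s > 0, IsGreenFunction M₀ (opMhat B s) (Ghat s)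
  expansion : IsLittleOSq {0}ᶜ fun s z => Ghat s z -
    ((R0 M₀ z : ℂ) • (1 : Matrix ι ι ℂ) + ((s ^ 2 * R1 M₀ z : ℝ) : ℂ) • massMatrix B)

end Sigma2D

end

/-! Invariance of the Killing form makes the structure constants antisymmetric in their outer
indices, so the matrices `B μ` are real and skew. Since they commute, they have a common eigenbasis
with imaginary eigenvalues `i b_μ` (`exists_isDiagonalised`). In that basis every operator acts
componentwise. With `l = s² (b₀² + b₁²)/4 ≥ 0`, each component of `M̂` is the scalar operator `-Δ -
l`. Completing the square shows that the component of `M` has the same symbol with the frequency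
shifted by `c = -s b/(4π)` (`symbolM_eq`). The gauge factor acts on that component as the plane wave
of frequency `c`. Conjugation with a plane wave shifts symbols (`multiplier_planeWave`), which gives
all the statements relating `M` to `M̂`.

The scalar problem rests on the fact that, with `w = |2πξ|²` and `a = 1/Λ`, the quotient `(J₀(a√(w -
l)) - 1)/(w - l)` is the Fourier transform of an explicit radial kernel supported in the disk of
radius `a`. For `l = 0` the kernel is `-(log a - log r)/(2π)`, by a logarithmic moment of the Bessel
function (`integral_log_mul_besselJ`). Sonine's integral (`sonine`) carries this to `l ≠ 0`. Hence
applying `ρ(√(-Δ - l)/Λ)` to any Green's function adds this kernel to it, and the logarithm is cut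
off inside the disk.

For the expansion, the fundamental solution of `-Δ - l` is `R₀ + l R₁ + l²·(continuous)`. Its
smoothed version is `R̃₀ + l·S(l, x)` with `S` jointly continuous and `S(0, x) = R̃₁ + R̂₀`
(`fundSol_add_greenKernel`, `smoothedSlope_zero`). Joint continuity on compact sets gives the
uniform `o(s²)`. An arbitrary normalised Green's function inherits the expansion off the origin,
because the added kernel does not depend on which Green's function is used.

Continuity at the origin is a removable singularity argument. Two Green's functions of the same
operator differ by a locally bounded solution of the homogeneous equation. The multiplier with `a =
1` acts on such a solution as the scalar `-1/4`, so the solution is a multiple of its own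
convolution with an integrable, compactly supported kernel and is therefore continuous
(`exists_continuous_of_solution`). This uses that `(J₀(√v) - 1 + v/4)/v²` is a temperate symbol,
which follows from energy estimates for Bessel's equation.

For `R̂₀` and `R̃₁` the Bessel symbol is divided by `w` and by `w²` instead, giving two more
compactly supported kernels. Point sources come from `integral_laplacian_radial`, the distributional
Laplacian of a radial function with a logarithmic singularity. -/

noncomputable section

namespace Sigma2D

/-! ### Entire power series with factorially decaying coefficients -/

/-- Coefficients bounded by a multiple of `1 / n!`. -/
def FactorialDecay (c : ℕ → ℝ) : Prop := ∃ C : ℝ, ∀ n, |c n| ≤ C / (n.factorial : ℝ)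

/-- The sum of a power series. -/
def powerSum (c : ℕ → ℝ) (t : ℝ) : ℝ := ∑' n, c n * t ^ n

/-- Coefficients of the derivative of a power series. -/
def derivCoeff (c : ℕ → ℝ) (n : ℕ) : ℝ := (n + 1) * c (n + 1)

/-- The factor `n + 1` is absorbed by `(n + 1)!` with the same constant, so the class is closed
under differentiation and all its sums are smooth. -/
lemma FactorialDecay.deriv {c : ℕ → ℝ} (hc : FactorialDecay c) :
    FactorialDecay (derivCoeff c) := by
  obtain ⟨C, hC⟩ := hc
  refine ⟨C, fun n => ?_⟩
  have h := hC (n + 1)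
  have h1 : (0 : ℝ) < n + 1 := by positivity
  have h2 : (0 : ℝ) < n.factorial := by positivity
  rw [derivCoeff, abs_mul, abs_of_pos h1]
  calc (n + 1 : ℝ) * |c (n + 1)| ≤ (n + 1) * (C / ((n + 1).factorial : ℝ)) := by gcongr
    _ = C / n.factorial := by
      rw [Nat.factorial_succ]; push_cast; field_simp

lemma FactorialDecay.summable_norm {c : ℕ → ℝ} (hc : FactorialDecay c) (t : ℝ) :
    Summable fun n => ‖c n * t ^ n‖ := by
  obtain ⟨C, hC⟩ := hc
  refine Summable.of_nonneg_of_le (fun n => norm_nonneg _) (fun n => ?_)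
    ((Real.summable_pow_div_factorial |t|).mul_left C)
  rw [norm_mul, norm_pow, Real.norm_eq_abs, Real.norm_eq_abs]
  calc |c n| * |t| ^ n ≤ C / n.factorial * |t| ^ n := by gcongr; exact hC n
    _ = _ := by ring

lemma FactorialDecay.hasSum {c : ℕ → ℝ} (hc : FactorialDecay c) (t : ℝ) :
    HasSum (fun n => c n * t ^ n) (powerSum c t) :=
  (hc.summable_norm t).of_norm.hasSum

/-- Termwise differentiation is justified on the ball of radius `|t| + 1`, where the differentiated
series is dominated by its absolute values at the radius. -/
lemma FactorialDecay.hasDerivAt {c : ℕ → ℝ} (hc : FactorialDecay c) (t : ℝ) :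
    HasDerivAt (powerSum c) (powerSum (derivCoeff c) t) t := by
  have hd := hc.deriv
  set R := |t| + 1 with hR
  have hR0 : 0 ≤ R := by positivity
  have hsum : Summable fun n => ‖c n * (n * R ^ (n - 1))‖ := by
    rw [← summable_nat_add_iff 1]
    refine (hd.summable_norm R).congr fun n => ?_
    simp only [derivCoeff, Nat.add_sub_cancel]
    congr 1; push_cast; ring
  have key := hasDerivAt_tsum_of_isPreconnected (g := fun n t => c n * t ^ n)
    (g' := fun n t => c n * (n * t ^ (n - 1))) (t := Metric.ball 0 R) (y₀ := 0) (y := t)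
    hsum Metric.isOpen_ball (convex_ball 0 R).isPreconnected
    (fun n y _ => (hasDerivAt_pow n y).const_mul (c n))
    (fun n y hy => by
      rw [norm_mul, norm_mul, norm_mul, norm_mul, norm_pow, norm_pow]
      have : ‖y‖ ≤ ‖R‖ := by
        rw [Real.norm_of_nonneg hR0]; exact (mem_ball_zero_iff.1 hy).le
      gcongr)
    (Metric.mem_ball_self (by positivity)) (hc.hasSum 0).summable
    (by simp [hR])
  refine key.congr_deriv ?_
  have hs : Summable fun n => c n * (n * t ^ (n - 1)) := by
    rw [← summable_nat_add_iff 1]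
    refine (hd.hasSum t).summable.congr fun n => ?_
    simp only [derivCoeff, Nat.add_sub_cancel]; push_cast; ring
  rw [hs.tsum_eq_zero_add]
  simp only [powerSum, derivCoeff, Nat.add_sub_cancel]
  simp only [Nat.cast_zero, zero_mul, mul_zero, zero_add]
  refine tsum_congr fun n => ?_
  push_cast; ring

lemma FactorialDecay.continuous {c : ℕ → ℝ} (hc : FactorialDecay c) : Continuous (powerSum c) :=
  continuous_iff_continuousAt.2 fun t => (hc.hasDerivAt t).continuousAt

lemma powerSum_zero (c : ℕ → ℝ) : powerSum c 0 = c 0 := by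
  rw [powerSum, tsum_eq_single 0 (fun n hn => by simp [hn])]; simp

/-- The operator `f ↦ t f'' + f'` sends `t ^ (n + 1)` to `(n + 1)² t ^ n`. In the variable `t =
|x|²` it is a quarter of the planar Laplacian, so the differential equations below reduce to
recursions for coefficients. -/
lemma FactorialDecay.powerSum_sq_coeff {c : ℕ → ℝ} (hc : FactorialDecay c) (t : ℝ) :
    powerSum (fun n => ((n : ℝ) + 1) ^ 2 * c (n + 1)) t =
      t * powerSum (derivCoeff (derivCoeff c)) t + powerSum (derivCoeff c) t := by
  have h1 := (hc.deriv.hasSum t)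
  have h2 := (hc.deriv.deriv.hasSum t).mul_left t
  have h3 : HasSum (fun n : ℕ => (n : ℝ) * (n + 1) * c (n + 1) * t ^ n)
      (t * powerSum (derivCoeff (derivCoeff c)) t) := by
    rw [← hasSum_nat_add_iff' 1]
    simp only [Finset.range_one, Finset.sum_singleton, Nat.cast_zero, zero_mul, sub_zero]
    refine h2.congr_fun fun n => ?_
    simp only [derivCoeff]; push_cast; ring
  rw [powerSum, ← (h3.add h1).tsum_eq]
  refine tsum_congr fun n => ?_
  simp only [derivCoeff]; ring

/-! ### Bessel functions of order zero as entire series in the squared radius. -/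

/-- `J₀(√t)` as a power series. -/
def besselCoeff (n : ℕ) : ℝ := (-1 / 4) ^ n / (n.factorial : ℝ) ^ 2

/-- The regular part of the second solution of Bessel's equation. -/
def neumannCoeff (n : ℕ) : ℝ := besselCoeff n * (harmonic n : ℝ)

/-- The series of `2 I₁(√v) / √v`. -/
def sonineCoeff (n : ℕ) : ℝ := (1 / 4) ^ n / (n.factorial * (n + 1).factorial : ℝ)

/-- `besselJ t = J₀(√t)`. -/
def besselJ : ℝ → ℝ := powerSum besselCoeff

lemma besselCoeff_decay : FactorialDecay besselCoeff := by
  refine ⟨1, fun n => ?_⟩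
  have h1 : (1 : ℝ) ≤ n.factorial := by exact_mod_cast n.factorial_pos
  rw [besselCoeff, abs_div, abs_pow, abs_pow, Nat.abs_cast, sq]
  have h2 : |(-1 / 4 : ℝ)| ^ n ≤ 1 := pow_le_one₀ (abs_nonneg _) (by norm_num [abs_div])
  gcongr
  nlinarith

lemma harmonic_le_factorial (n : ℕ) : (harmonic n : ℝ) ≤ n.factorial := by
  induction n with
  | zero => simp
  | succ n ih =>
    rw [harmonic_succ, Nat.factorial_succ]
    push_cast
    have h1 : (1 : ℝ) ≤ n.factorial := by exact_mod_cast n.factorial_pos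
    have h2 : ((n : ℝ) + 1)⁻¹ ≤ 1 := inv_le_one_of_one_le₀ (by linarith [n.cast_nonneg (α := ℝ)])
    rcases Nat.eq_zero_or_pos n with rfl | hn
    · simp
    · have h3 : (1 : ℝ) ≤ n := by exact_mod_cast hn
      nlinarith

/-- One of the two factorials in `besselCoeff` absorbs the harmonic number. -/
lemma neumannCoeff_decay : FactorialDecay neumannCoeff := by
  refine ⟨1, fun n => ?_⟩
  have h1 : (0 : ℝ) < n.factorial := by exact_mod_cast n.factorial_pos
  have h0 : (0 : ℝ) ≤ (harmonic n : ℝ) := by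
    rw [harmonic]; push_cast; positivity
  have h2 : |(-1 / 4 : ℝ)| ^ n ≤ 1 := pow_le_one₀ (abs_nonneg _) (by norm_num [abs_div])
  rw [neumannCoeff, besselCoeff, abs_mul, abs_div, abs_pow, abs_pow, Nat.abs_cast,
    abs_of_nonneg h0, div_mul_eq_mul_div, div_le_div_iff₀ (by positivity) h1]
  have := harmonic_le_factorial n
  calc |(-1 / 4 : ℝ)| ^ n * (harmonic n : ℝ) * n.factorial ≤ 1 * n.factorial * n.factorial := by
        gcongr
    _ = _ := by ring

lemma sonineCoeff_decay : FactorialDecay sonineCoeff := by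
  refine ⟨1, fun n => ?_⟩
  have h1 : (1 : ℝ) ≤ (n + 1).factorial := by exact_mod_cast (n + 1).factorial_pos
  have h2 : (0 : ℝ) < n.factorial := by exact_mod_cast n.factorial_pos
  rw [sonineCoeff, abs_of_nonneg (by positivity)]
  have h3 : (1 / 4 : ℝ) ^ n ≤ 1 := pow_le_one₀ (by norm_num) (by norm_num)
  gcongr
  nlinarith

lemma besselCoeff_succ (n : ℕ) : 4 * ((n : ℝ) + 1) ^ 2 * besselCoeff (n + 1) = -besselCoeff n := by
  have h2 : (n.factorial : ℝ) ≠ 0 := by positivity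
  have h3 : (n + 1 : ℝ) ≠ 0 := by positivity
  rw [besselCoeff, besselCoeff, Nat.factorial_succ]; push_cast; field_simp; ring

lemma besselCoeff_zero : besselCoeff 0 = 1 := by simp [besselCoeff]

lemma besselJ_zero : besselJ 0 = 1 := by rw [besselJ, powerSum_zero, besselCoeff_zero]

lemma continuous_besselJ : Continuous besselJ := besselCoeff_decay.continuous

/-- `d/dt J₀(√t)`. -/
def besselJ' : ℝ → ℝ := powerSum (derivCoeff besselCoeff)

/-- `d²/dt² J₀(√t)`. -/
def besselJ'' : ℝ → ℝ := powerSum (derivCoeff (derivCoeff besselCoeff))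

lemma hasDerivAt_besselJ (t : ℝ) : HasDerivAt besselJ (besselJ' t) t :=
  besselCoeff_decay.hasDerivAt t

lemma hasDerivAt_besselJ' (t : ℝ) : HasDerivAt besselJ' (besselJ'' t) t :=
  besselCoeff_decay.deriv.hasDerivAt t

lemma continuous_besselJ' : Continuous besselJ' := besselCoeff_decay.deriv.continuous

lemma continuous_besselJ'' : Continuous besselJ'' := besselCoeff_decay.deriv.deriv.continuous

/-- Bessel's equation in the variable `t = r²`; the left-hand side is the Laplacian of `J(|x|²)`. -/
lemma besselJ_ode (t : ℝ) : 4 * (t * besselJ'' t + besselJ' t) = -besselJ t := by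
  have h := besselCoeff_decay.powerSum_sq_coeff t
  rw [besselJ'', besselJ', ← h, besselJ, powerSum, powerSum, ← tsum_mul_left, ← tsum_neg]
  refine tsum_congr fun n => ?_
  linear_combination t ^ n * besselCoeff_succ n

/-- `Σ (-1)ⁿ Hₙ (t/4)ⁿ / (n!)²`. -/
def neumannY : ℝ → ℝ := powerSum neumannCoeff

/-- The derivative of `neumannY`. -/
def neumannY' : ℝ → ℝ := powerSum (derivCoeff neumannCoeff)

/-- The second derivative of `neumannY`. -/
def neumannY'' : ℝ → ℝ := powerSum (derivCoeff (derivCoeff neumannCoeff))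

lemma hasDerivAt_neumannY (t : ℝ) : HasDerivAt neumannY (neumannY' t) t :=
  neumannCoeff_decay.hasDerivAt t

lemma hasDerivAt_neumannY' (t : ℝ) : HasDerivAt neumannY' (neumannY'' t) t :=
  neumannCoeff_decay.deriv.hasDerivAt t

lemma continuous_neumannY : Continuous neumannY := neumannCoeff_decay.continuous

lemma continuous_neumannY' : Continuous neumannY' := neumannCoeff_decay.deriv.continuous

lemma neumannY_zero : neumannY 0 = 0 := by
  rw [neumannY, powerSum_zero, neumannCoeff]; simp

/-- The extra term comes from `H_{n+1} = H_n + 1/(n + 1)`. Twice this source cancels the cross term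
`8 J'` of the Laplacian of `log t · J(t)`, so that `log t · J - 2 Y` solves the homogeneous
equation. -/
lemma neumannY_ode (t : ℝ) :
    4 * (t * neumannY'' t + neumannY' t) = -neumannY t + 4 * besselJ' t := by
  have h := neumannCoeff_decay.powerSum_sq_coeff t
  have h1 := neumannCoeff_decay.hasSum t
  have h2 := besselCoeff_decay.deriv.hasSum t
  rw [neumannY'', neumannY', ← h, neumannY, powerSum, ← tsum_mul_left, besselJ',
    ← (h1.neg.add (h2.mul_left 4)).tsum_eq]
  refine tsum_congr fun n => ?_
  have h3 : (n + 1 : ℝ) ≠ 0 := by positivity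
  have e := besselCoeff_succ n
  have e2 : neumannCoeff (n + 1) = besselCoeff (n + 1) * ((harmonic n : ℝ) + (n + 1 : ℝ)⁻¹) := by
    rw [neumannCoeff, harmonic_succ]; push_cast; rfl
  simp only [derivCoeff]
  rw [e2, neumannCoeff]
  field_simp
  linear_combination (harmonic n : ℝ) * t ^ n * e

/-- `Σ (v/4)ⁿ / (n! (n+1)!)`, the kernel of Sonine's integral. -/
def sonineN : ℝ → ℝ := powerSum sonineCoeff

lemma continuous_sonineN : Continuous sonineN := sonineCoeff_decay.continuous

lemma sonineN_zero : sonineN 0 = 1 := by rw [sonineN, powerSum_zero]; simp [sonineCoeff]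

end Sigma2D

end

noncomputable section

namespace Sigma2D

/-! ### Sonine's integral -/

/-- A Beta integral. The function `ρ^(2p+2) (r² - ρ²)^(q+1)` vanishes at both ends, so integrating
its derivative reduces the exponents `(p, q + 1)` to `(p + 1, q)`. -/
lemma integral_pow_mul_sub_sq_pow (r : ℝ) (p q : ℕ) :
    ∫ ρ in (0 : ℝ)..r, ρ ^ (2 * p + 1) * (r ^ 2 - ρ ^ 2) ^ q =
      1 / 2 * r ^ (2 * (p + q + 1)) * (p.factorial * q.factorial) / ((p + q + 1).factorial) := by
  induction q generalizing p with
  | zero =>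
    have h3 : (p.factorial : ℝ) ≠ 0 := by positivity
    simp only [pow_zero, mul_one, integral_pow, Nat.factorial_zero, Nat.cast_one, add_zero,
      Nat.factorial_succ]
    push_cast
    rw [show 2 * p + 1 + 1 = 2 * (p + 1) by ring, zero_pow (by positivity)]
    field_simp; ring
  | succ q ih =>
    have h1 : ∀ ρ ∈ Set.uIcc 0 r, HasDerivAt (fun ρ : ℝ => ρ ^ (2 * p + 2) * (r ^ 2 - ρ ^ 2) ^ (q + 1))
        ((2 * p + 2) * (ρ ^ (2 * p + 1) * (r ^ 2 - ρ ^ 2) ^ (q + 1)) -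
          2 * (q + 1) * (ρ ^ (2 * (p + 1) + 1) * (r ^ 2 - ρ ^ 2) ^ q)) ρ := by
      intro ρ _
      have := (hasDerivAt_pow (2 * p + 2) ρ).mul
        ((((hasDerivAt_pow 2 ρ).const_sub (r ^ 2))).pow (q + 1))
      refine this.congr_deriv ?_
      rw [Pi.pow_apply]
      push_cast
      ring
    have h2 := intervalIntegral.integral_eq_sub_of_hasDerivAt h1
      (Continuous.intervalIntegrable (by fun_prop) _ _)
    rw [intervalIntegral.integral_sub (Continuous.intervalIntegrable (by fun_prop) _ _)
      (Continuous.intervalIntegrable (by fun_prop) _ _), intervalIntegral.integral_const_mul,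
      intervalIntegral.integral_const_mul, ih (p + 1)] at h2
    rw [sub_self, zero_pow (by positivity), zero_pow (by positivity), mul_zero, zero_mul,
      sub_self] at h2
    have h4 : (2 * p + 2 : ℝ) ≠ 0 := by positivity
    rw [sub_eq_zero] at h2
    rw [eq_div_of_mul_eq h4 ((mul_comm _ _).trans h2)]
    rw [show p + 1 + q + 1 = p + (q + 1) + 1 by ring, Nat.factorial_succ p, Nat.factorial_succ q]
    push_cast
    field_simp

lemma tsum_prod_eq_tsum_antidiagonal {f : ℕ × ℕ → ℝ} (hf : Summable f) :
    ∑' z, f z = ∑' n, ∑ z ∈ Finset.HasAntidiagonal.antidiagonal n, f z := by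
  rw [← Finset.HasAntidiagonal.sigmaAntidiagonalEquivProd.tsum_eq]
  have h := Finset.HasAntidiagonal.sigmaAntidiagonalEquivProd.summable_iff.2 hf
  simp only [Function.comp_def] at h
  rw [Summable.tsum_sigma' (fun n => (hasSum_fintype _).summable) h]
  refine tsum_congr fun n => ?_
  rw [tsum_fintype, ← Finset.sum_coe_sort (Finset.HasAntidiagonal.antidiagonal n)]
  rfl

/-- The terms of the double series of `J₀(√((w - l) u))`. -/
def shiftTerm (w l u : ℝ) (z : ℕ × ℕ) : ℝ :=
  (-w / 4) ^ z.1 * (l / 4) ^ z.2 * u ^ (z.1 + z.2) /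
    (z.1.factorial * z.2.factorial * (z.1 + z.2).factorial)

/-- Dropping the third factorial leaves a product of two exponential series. -/
lemma summable_shiftTerm (w l u : ℝ) : Summable (shiftTerm w l u) := by
  have h := (Real.summable_pow_div_factorial (|w / 4 * u|)).mul_of_nonneg
    (Real.summable_pow_div_factorial (|l / 4 * u|)) (fun n => by positivity)
    (fun n => by positivity)
  refine Summable.of_norm_bounded h fun z => ?_
  have h1 : (1 : ℝ) ≤ (z.1 + z.2).factorial := by exact_mod_cast (z.1 + z.2).factorial_pos
  rw [shiftTerm, Real.norm_eq_abs, abs_div, abs_of_nonneg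
    (show (0 : ℝ) ≤ z.1.factorial * z.2.factorial * (z.1 + z.2).factorial by positivity),
    div_mul_div_comm, ← abs_pow, ← abs_pow, ← abs_mul]
  have e : |(-w / 4) ^ z.1 * (l / 4) ^ z.2 * u ^ (z.1 + z.2)| =
      |(w / 4 * u) ^ z.1 * (l / 4 * u) ^ z.2| := by
    simp only [abs_mul, abs_pow, abs_div, abs_neg]; ring
  rw [e]
  refine div_le_div_of_nonneg_left (abs_nonneg _) (by positivity) ?_
  nlinarith [show (0 : ℝ) < z.1.factorial * z.2.factorial by positivity]

/-- Summation along antidiagonals is the binomial expansion of `(-w/4 + l/4)^n`. -/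
lemma tsum_shiftTerm (w l u : ℝ) : ∑' z, shiftTerm w l u z = besselJ ((w - l) * u) := by
  rw [tsum_prod_eq_tsum_antidiagonal (summable_shiftTerm w l u), besselJ, powerSum]
  refine tsum_congr fun n => ?_
  have h0 : (n.factorial : ℝ) ≠ 0 := by positivity
  have e : besselCoeff n * ((w - l) * u) ^ n =
      (-w / 4 + l / 4) ^ n * (u ^ n / (n.factorial : ℝ) ^ 2) := by
    rw [besselCoeff, show -w / 4 + l / 4 = (-1 / 4) * (w - l) by ring, mul_pow, mul_pow]; ring
  rw [e, Commute.add_pow' (Commute.all _ _), Finset.sum_mul]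
  refine Finset.sum_congr rfl fun z hz => ?_
  rw [Finset.HasAntidiagonal.mem_antidiagonal] at hz
  have hc : (n.choose z.1 : ℝ) = n.factorial / (z.1.factorial * z.2.factorial) := by
    rw [← hz, Nat.cast_add_choose]
  rw [shiftTerm, hz, nsmul_eq_mul, hc]
  field_simp

/-- The terms of the double series of the integrand in Sonine's integral. -/
def sonineTerm (w l r : ℝ) (z : ℕ × ℕ) (ρ : ℝ) : ℝ :=
  ρ * ((besselCoeff z.1 * (w * ρ ^ 2) ^ z.1) * (sonineCoeff z.2 * (l * (r ^ 2 - ρ ^ 2)) ^ z.2))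

lemma hasSum_sonineTerm (w l r ρ : ℝ) :
    HasSum (fun z => sonineTerm w l r z ρ)
      (ρ * (besselJ (w * ρ ^ 2) * sonineN (l * (r ^ 2 - ρ ^ 2)))) := by
  have h1 := besselCoeff_decay.hasSum (w * ρ ^ 2)
  have h2 := sonineCoeff_decay.hasSum (l * (r ^ 2 - ρ ^ 2))
  have h3 := summable_mul_of_summable_norm (besselCoeff_decay.summable_norm (w * ρ ^ 2))
    (sonineCoeff_decay.summable_norm (l * (r ^ 2 - ρ ^ 2)))
  exact (h1.mul h2 h3).mul_left ρ

lemma norm_sonineTerm_le (w l : ℝ) {r ρ : ℝ} (h0 : 0 ≤ ρ) (hρ : ρ ≤ r) (z : ℕ × ℕ) :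
    ‖sonineTerm w l r z ρ‖ ≤ r * (‖besselCoeff z.1 * (w * r ^ 2) ^ z.1‖ *
        ‖sonineCoeff z.2 * (l * r ^ 2) ^ z.2‖) := by
  have hr : 0 ≤ r := h0.trans hρ
  have h1 : |r ^ 2 - ρ ^ 2| ≤ |r| ^ 2 := by
    rw [sq_abs, abs_of_nonneg (by nlinarith)]
    nlinarith
  have h2 : |ρ| ≤ |r| := by rwa [abs_of_nonneg h0, abs_of_nonneg hr]
  rw [sonineTerm, norm_mul, norm_mul, norm_mul, norm_mul, norm_mul, norm_mul, norm_pow, norm_pow,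
    norm_pow, norm_pow, norm_mul, norm_mul, norm_mul, norm_mul, norm_pow, norm_pow]
  simp only [Real.norm_eq_abs]
  calc |ρ| * (|besselCoeff z.1| * (|w| * |ρ| ^ 2) ^ z.1 *
        (|sonineCoeff z.2| * (|l| * |r ^ 2 - ρ ^ 2|) ^ z.2))
      ≤ |r| * (|besselCoeff z.1| * (|w| * |r| ^ 2) ^ z.1 *
        (|sonineCoeff z.2| * (|l| * |r| ^ 2) ^ z.2)) := by gcongr
    _ = _ := by rw [abs_of_nonneg hr]

lemma hasSum_integral_sonineTerm (w l : ℝ) {r : ℝ} (hr : 0 ≤ r) :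
    HasSum (fun z => ∫ ρ in (0 : ℝ)..r, sonineTerm w l r z ρ)
      (∫ ρ in (0 : ℝ)..r, ρ * (besselJ (w * ρ ^ 2) * sonineN (l * (r ^ 2 - ρ ^ 2)))) := by
  have hb := (besselCoeff_decay.summable_norm (w * r ^ 2)).mul_of_nonneg
    (sonineCoeff_decay.summable_norm (l * r ^ 2)) (fun n => norm_nonneg _) (fun n => norm_nonneg _)
  refine intervalIntegral.hasSum_integral_of_dominated_convergence
    (fun z _ => r * (‖besselCoeff z.1 * (w * r ^ 2) ^ z.1‖ *
      ‖sonineCoeff z.2 * (l * r ^ 2) ^ z.2‖)) (fun z => ?_) (fun z => ?_) ?_ ?_ ?_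
  · exact (by unfold sonineTerm; fun_prop :
      Continuous (sonineTerm w l r z)).aestronglyMeasurable
  · refine ae_of_all _ fun ρ hρ => ?_
    rw [Set.uIoc_of_le hr] at hρ
    exact norm_sonineTerm_le w l hρ.1.le hρ.2 z
  · exact ae_of_all _ fun ρ _ => hb.mul_left r
  · exact intervalIntegrable_const
  · exact ae_of_all _ fun ρ _ => hasSum_sonineTerm w l r ρ

/-- The Beta integral raises the second index by one and the factor `l / 2` supplies the missing
power of `l`. Hence the integral in Sonine's formula accounts exactly for the terms of positive
second index. -/
lemma integral_sonineTerm (w l r : ℝ) (z : ℕ × ℕ) :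
    l / 2 * ∫ ρ in (0 : ℝ)..r, sonineTerm w l r z ρ = shiftTerm w l (r ^ 2) (z.1, z.2 + 1) := by
  have e : sonineTerm w l r z = fun ρ => besselCoeff z.1 * w ^ z.1 * sonineCoeff z.2 * l ^ z.2 *
      (ρ ^ (2 * z.1 + 1) * (r ^ 2 - ρ ^ 2) ^ z.2) := by
    ext ρ; rw [sonineTerm, mul_pow, mul_pow]; ring
  rw [e, intervalIntegral.integral_const_mul, integral_pow_mul_sub_sq_pow, besselCoeff,
    sonineCoeff, shiftTerm]
  rw [Nat.factorial_succ z.2, show z.1 + (z.2 + 1) = z.1 + z.2 + 1 by ring,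
    show -w / 4 = (-1 / 4) * w by ring, show l / 4 = 1 / 4 * l by ring, mul_pow, mul_pow]
  push_cast
  have h1 : (z.1.factorial : ℝ) ≠ 0 := by positivity
  have h2 : (z.2.factorial : ℝ) ≠ 0 := by positivity
  have h3 : ((z.1 + z.2 + 1).factorial : ℝ) ≠ 0 := by positivity
  generalize (-1 / 4 : ℝ) ^ z.1 = A
  field_simp
  ring

/-- Sonine's integral for `J₀`. -/
lemma sonine (w l : ℝ) {r : ℝ} (hr : 0 ≤ r) :
    besselJ ((w - l) * r ^ 2) = besselJ (w * r ^ 2) +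
      l / 2 * ∫ ρ in (0 : ℝ)..r, ρ * (besselJ (w * ρ ^ 2) * sonineN (l * (r ^ 2 - ρ ^ 2))) := by
  have hs := summable_shiftTerm w l (r ^ 2)
  rw [← tsum_shiftTerm, hs.tsum_prod]
  have hs' : Summable fun z : ℕ × ℕ => shiftTerm w l (r ^ 2) (z.1, z.2 + 1) :=
    hs.comp_injective (i := fun z : ℕ × ℕ => (z.1, z.2 + 1)) (by
      rintro ⟨a, b⟩ ⟨c, d⟩ h; simpa using h)
  -- The column of second index zero is the unshifted Bessel series; the other columns form the
  -- integral.
  have h0 : HasSum (fun p => shiftTerm w l (r ^ 2) (p, 0)) (besselJ (w * r ^ 2)) := by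
    refine (besselCoeff_decay.hasSum (w * r ^ 2)).congr_fun fun p => ?_
    simp only [shiftTerm, besselCoeff, pow_zero, add_zero, Nat.factorial_zero, Nat.cast_one]
    rw [show -w / 4 = (-1 / 4) * w by ring, mul_pow, mul_pow]
    field_simp
  have h1 := ((hasSum_integral_sonineTerm w l hr).mul_left (l / 2)).tsum_eq
  simp only [integral_sonineTerm] at h1
  rw [← h1, hs'.tsum_prod, ← h0.tsum_eq, ← h0.summable.tsum_add hs'.prod]
  refine tsum_congr fun p => ?_
  exact (hs.prod_factor p).tsum_eq_zero_add

end Sigma2D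

end

noncomputable section

namespace Sigma2D

/-! ### Logarithmic moments of the Bessel function -/

lemma continuous_mul_log_sub (a : ℝ) : Continuous fun r : ℝ => r * (log a - log r) := by
  have : (fun r : ℝ => r * (log a - log r)) = fun r => r * log a - r * log r := by ext; ring
  rw [this]
  exact (continuous_id.mul continuous_const).sub Real.continuous_mul_log

lemma hasDerivAt_besselJ_sq (w r : ℝ) :
    HasDerivAt (fun r => besselJ (w * r ^ 2)) (2 * w * r * besselJ' (w * r ^ 2)) r := by
  have := (hasDerivAt_besselJ (w * r ^ 2)).comp r ((hasDerivAt_pow 2 r).const_mul w)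
  refine this.congr_deriv ?_
  push_cast; ring

lemma hasDerivAt_mul_besselJ'_sq (w r : ℝ) :
    HasDerivAt (fun r => 2 * w * r ^ 2 * besselJ' (w * r ^ 2)) (-w * r * besselJ (w * r ^ 2)) r := by
  have h1 := (hasDerivAt_besselJ' (w * r ^ 2)).comp r ((hasDerivAt_pow 2 r).const_mul w)
  have h2 := ((hasDerivAt_pow 2 r).const_mul (2 * w)).mul h1
  refine h2.congr_deriv ?_
  simp only [Function.comp_apply]
  push_cast
  linear_combination w * r * besselJ_ode (w * r ^ 2)

/-- Green's identity for the radial Laplacian: `log a - log r` is harmonic off the origin and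
vanishes at `r = a`, and `J` satisfies `(r ∂_r J)' = -w r J`. So `-(r ∂_r J)(log a - log r) - J` is
a primitive of the integrand times `w`, and only the values of `J` at the two ends survive. -/
lemma integral_log_mul_besselJ (w : ℝ) {a : ℝ} (ha : 0 ≤ a) :
    w * ∫ r in (0 : ℝ)..a, r * (log a - log r) * besselJ (w * r ^ 2) =
      1 - besselJ (w * a ^ 2) := by
  have hc1 := continuous_besselJ'
  have hc0 := continuous_besselJ
  have hl := continuous_mul_log_sub a
  -- The factor `r` is kept next to the logarithm so that the primitive is continuous at `0`; its
  -- derivative is needed only on the open interval.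
  have hc : Continuous fun r : ℝ => -(2 * w * r * besselJ' (w * r ^ 2)) * (r * (log a - log r)) -
      besselJ (w * r ^ 2) := by fun_prop
  have hd : ∀ r ∈ Set.Ioo 0 a, HasDerivAt
      (fun r : ℝ => -(2 * w * r * besselJ' (w * r ^ 2)) * (r * (log a - log r)) -
      besselJ (w * r ^ 2)) (w * (r * (log a - log r) * besselJ (w * r ^ 2))) r := by
    intro r hr
    have h0 : r ≠ 0 := hr.1.ne'
    have e : (fun r : ℝ => -(2 * w * r * besselJ' (w * r ^ 2)) * (r * (log a - log r)) -
      besselJ (w * r ^ 2)) = fun r => -(2 * w * r ^ 2 * besselJ' (w * r ^ 2)) *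
        (log a - log r) - besselJ (w * r ^ 2) := by ext; ring
    rw [e]
    have := ((hasDerivAt_mul_besselJ'_sq w r).neg.mul ((Real.hasDerivAt_log h0).const_sub
      (log a))).sub (hasDerivAt_besselJ_sq w r)
    refine this.congr_deriv ?_
    simp only [Pi.neg_apply]
    field_simp
    ring
  have h := intervalIntegral.integral_eq_sub_of_hasDerivAt_of_le ha hc.continuousOn hd
    (Continuous.intervalIntegrable (by fun_prop) _ _)
  rw [intervalIntegral.integral_const_mul] at h
  rw [h]
  simp [besselJ_zero]
  ring

/-- The weight `u = ((a² + r²)(log a - log r) - (a² - r²))/4` satisfies `(r u')' = r (log a - log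
r)` and `u(a) = u'(a) = 0`. Green's identity reduces the integral to the previous moment. The
boundary value `r u' → -a²/4` at `0` produces the term `w a²/4`. -/
lemma integral_log_poly_mul_besselJ (w : ℝ) {a : ℝ} (ha : 0 ≤ a) :
    w ^ 2 * ∫ r in (0 : ℝ)..a, r * (1 / 4 * ((a ^ 2 + r ^ 2) * (log a - log r) -
      (a ^ 2 - r ^ 2))) * besselJ (w * r ^ 2) = besselJ (w * a ^ 2) - 1 + w * a ^ 2 / 4 := by
  have hc1 := continuous_besselJ'
  have hc0 := continuous_besselJ
  have hl := continuous_mul_log_sub a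
  set G : ℝ → ℝ := fun r => w * (1 / 2 * r * (r * (log a - log r)) - 1 / 4 * a ^ 2 +
      1 / 4 * r ^ 2) * besselJ (w * r ^ 2) -
      w * (1 / 4 * ((a ^ 2 + r ^ 2) * (r * (log a - log r)) - r * (a ^ 2 - r ^ 2))) *
      (2 * w * r * besselJ' (w * r ^ 2)) +
      ((2 * w * r * besselJ' (w * r ^ 2)) * (r * (log a - log r)) + besselJ (w * r ^ 2)) with hG
  have hc : Continuous G := by fun_prop
  have hd : ∀ r ∈ Set.Ioo 0 a, HasDerivAt G
      (w ^ 2 * (1 / 4 * ((a ^ 2 + r ^ 2) * (r * (log a - log r)) -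
      r * (a ^ 2 - r ^ 2)) * besselJ (w * r ^ 2))) r := by
    intro r hr
    have h0 : r ≠ 0 := hr.1.ne'
    have e : G = fun r => w * (1 / 2 * (r ^ 2 * (log a - log r)) - 1 / 4 * a ^ 2 +
      1 / 4 * r ^ 2) * besselJ (w * r ^ 2) -
      w * (1 / 4 * ((a ^ 2 + r ^ 2) * (log a - log r) - (a ^ 2 - r ^ 2))) *
      (2 * w * r ^ 2 * besselJ' (w * r ^ 2)) +
      ((2 * w * r ^ 2 * besselJ' (w * r ^ 2)) * (log a - log r) + besselJ (w * r ^ 2)) := by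
      ext; simp only [hG]; ring
    rw [e]
    have hlog := (Real.hasDerivAt_log h0).const_sub (log a)
    have hsq := hasDerivAt_pow 2 r
    have hJ := hasDerivAt_besselJ_sq w r
    have hJ' := hasDerivAt_mul_besselJ'_sq w r
    have h1 := ((((hsq.mul hlog).const_mul (1 / 2)).sub_const (1 / 4 * a ^ 2)).add
      (hsq.const_mul (1 / 4))).const_mul w |>.mul hJ
    have h2 := ((((hsq.const_add (a ^ 2)).mul hlog).sub (hsq.const_sub (a ^ 2))).const_mul
      (1 / 4)).const_mul w |>.mul hJ'
    have h3 := (hJ'.mul hlog).add hJ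
    refine ((h1.sub h2).add h3).congr_deriv ?_
    simp only [Pi.mul_apply, Pi.add_apply, Pi.sub_apply]
    push_cast
    field_simp
    ring
  have h := intervalIntegral.integral_eq_sub_of_hasDerivAt_of_le ha hc.continuousOn hd
    (Continuous.intervalIntegrable (by fun_prop) _ _)
  rw [intervalIntegral.integral_const_mul] at h
  have e : ∀ r : ℝ, r * (1 / 4 * ((a ^ 2 + r ^ 2) * (log a - log r) -
      (a ^ 2 - r ^ 2))) * besselJ (w * r ^ 2) = 1 / 4 * ((a ^ 2 + r ^ 2) * (r * (log a - log r)) -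
      r * (a ^ 2 - r ^ 2)) * besselJ (w * r ^ 2) := fun r => by ring
  simp only [e]
  rw [h]
  simp [hG, besselJ_zero]
  ring

/-! ### Iterated integrals over a triangle -/

/-- The bound is required only for `y > 0` and `g` only has to be measurable, so that integrands
containing `log y` are allowed. -/
lemma integral_triangle_swap {g : ℝ → ℝ → ℝ} (hg : Measurable (Function.uncurry g)) {a C : ℝ}
    (ha : 0 ≤ a) (hC : ∀ x y, 0 < y → y ≤ x → x ≤ a → ‖g x y‖ ≤ C) :
    ∫ x in (0 : ℝ)..a, ∫ y in (0 : ℝ)..x, g x y = ∫ y in (0 : ℝ)..a, ∫ x in y..a, g x y := by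
  set G : ℝ → ℝ → ℝ := fun x y => if 0 < y ∧ y ≤ x ∧ x ≤ a then g x y else 0 with hG
  have hGm : Measurable (Function.uncurry G) := by
    refine Measurable.ite ?_ hg measurable_const
    refine (measurableSet_lt measurable_const measurable_snd).inter
      ((measurableSet_le measurable_snd measurable_fst).inter
        (measurableSet_le measurable_fst measurable_const))
  have hGb : ∀ x y, ‖G x y‖ ≤ |C| := by
    intro x y
    simp only [hG]
    split_ifs with h
    · exact (hC x y h.1 h.2.1 h.2.2).trans (le_abs_self C)
    · simp
  have e1 : ∀ x ∈ Set.uIoc 0 a, ∫ y in (0 : ℝ)..x, g x y = ∫ y in (0 : ℝ)..a, G x y := by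
    intro x hx
    rw [Set.uIoc_of_le ha] at hx
    rw [intervalIntegral.integral_of_le hx.1.le, intervalIntegral.integral_of_le ha,
      ← integral_indicator measurableSet_Ioc, ← integral_indicator measurableSet_Ioc]
    congr 1; ext y
    simp only [Set.indicator_apply, Set.mem_Ioc, hG]
    have := hx.2
    split_ifs <;> first | rfl | (exfalso; grind)
  have e2 : ∀ y ∈ Set.uIoc 0 a, ∫ x in y..a, g x y = ∫ x in (0 : ℝ)..a, G x y := by
    intro y hy
    rw [Set.uIoc_of_le ha] at hy
    -- The cut-off `G` includes the diagonal `x = y`, which the half-open interval omits; the two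
    -- differ by a null set.
    rw [intervalIntegral.integral_of_le hy.2, intervalIntegral.integral_of_le ha,
      integral_Ioc_eq_integral_Ioo, ← integral_Icc_eq_integral_Ioo,
      ← integral_indicator measurableSet_Icc, ← integral_indicator measurableSet_Ioc]
    congr 1; ext x
    simp only [Set.indicator_apply, Set.mem_Ioc, Set.mem_Icc, hG]
    have := hy.1
    split_ifs <;> first | rfl | (exfalso; grind)
  rw [intervalIntegral.integral_congr_ae (ae_of_all _ e1),
    intervalIntegral.integral_congr_ae (ae_of_all _ e2)]
  simp only [intervalIntegral.integral_of_le ha]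
  refine integral_integral_swap ?_
  exact Integrable.of_bound hGm.aestronglyMeasurable |C| (ae_of_all _ fun z => hGb z.1 z.2)

/-! ### Bessel's integral -/

lemma integral_cos_pow_even_period (n : ℕ) :
    ∫ θ in (-π)..π, cos θ ^ (2 * n) = 2 * π * ((2 * n).factorial / (4 ^ n * (n.factorial : ℝ) ^ 2)) := by
  induction n with
  | zero => simp; ring
  | succ n ih =>
    rw [show 2 * (n + 1) = 2 * n + 2 by ring, integral_cos_pow, ih]
    simp only [sin_pi, sin_neg, mul_zero, neg_zero, sub_zero, zero_div, zero_add]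
    rw [Nat.factorial_succ, Nat.factorial_succ, Nat.factorial_succ]
    push_cast
    have h0 : (n.factorial : ℝ) ≠ 0 := by positivity
    field_simp
    ring

lemma integral_cos_pow_odd_period (n : ℕ) : ∫ θ in (-π)..π, cos θ ^ (2 * n + 1) = 0 := by
  induction n with
  | zero => simp
  | succ n ih =>
    rw [show 2 * (n + 1) + 1 = (2 * n + 1) + 2 by ring, integral_cos_pow, ih]
    simp

/-- The terms of the exponential series of `exp(-i c cos θ)`. -/
def expCosTerm (c : ℝ) (n : ℕ) (θ : ℝ) : ℂ :=
  (-(Complex.I * ((c * cos θ : ℝ) : ℂ))) ^ n / (n.factorial : ℂ)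

lemma norm_expCosTerm_le (c : ℝ) (n : ℕ) (θ : ℝ) :
    ‖expCosTerm c n θ‖ ≤ |c| ^ n / (n.factorial : ℝ) := by
  simp only [expCosTerm, norm_div, norm_pow, norm_neg, norm_mul, Complex.norm_I, one_mul,
    Complex.norm_real, Complex.norm_natCast, Real.norm_eq_abs]
  gcongr
  calc |c| * |cos θ| ≤ |c| * 1 := by gcongr; exact abs_cos_le_one θ
    _ = |c| := mul_one _

lemma hasSum_integral_expCosTerm (c : ℝ) :
    HasSum (fun n => ∫ θ in (-π)..π, expCosTerm c n θ)
      (∫ θ in (-π)..π, Complex.exp (-(Complex.I * ((c * cos θ : ℝ) : ℂ)))) := by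
  refine intervalIntegral.hasSum_integral_of_dominated_convergence
    (fun n _ => |c| ^ n / (n.factorial : ℝ)) (fun n => ?_)
    (fun n => ae_of_all _ fun θ _ => norm_expCosTerm_le c n θ) ?_ ?_ ?_
  · exact (by unfold expCosTerm; fun_prop : Continuous (expCosTerm c n)).aestronglyMeasurable
  · exact ae_of_all _ fun θ _ => Real.summable_pow_div_factorial |c|
  · exact intervalIntegrable_const
  · refine ae_of_all _ fun θ _ => ?_
    rw [Complex.exp_eq_exp_ℂ]
    exact NormedSpace.expSeries_div_hasSum_exp _

lemma integral_expCosTerm (c : ℝ) (n : ℕ) :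
    ∫ θ in (-π)..π, expCosTerm c n θ = (-(Complex.I * (c : ℂ))) ^ n / (n.factorial : ℂ) *
      ((∫ θ in (-π)..π, cos θ ^ n : ℝ) : ℂ) := by
  rw [← intervalIntegral.integral_ofReal, ← intervalIntegral.integral_const_mul]
  congr 1; ext θ
  rw [expCosTerm, Complex.ofReal_mul, Complex.ofReal_pow, ← mul_assoc, ← neg_mul, mul_pow]
  ring

lemma integral_expCosTerm_even (c : ℝ) (n : ℕ) :
    ∫ θ in (-π)..π, expCosTerm c (2 * n) θ =
      ((2 * π * (besselCoeff n * (c ^ 2) ^ n) : ℝ) : ℂ) := by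
  have h0 : (n.factorial : ℂ) ≠ 0 := by exact_mod_cast n.factorial_ne_zero
  have h1 : ((2 * n).factorial : ℂ) ≠ 0 := by exact_mod_cast (2 * n).factorial_ne_zero
  have h2 : (-(Complex.I * (c : ℂ))) ^ (2 * n) = (-1) ^ n * ((c : ℂ) ^ 2) ^ n := by
    rw [pow_mul, ← mul_pow]; congr 1
    rw [neg_sq, mul_pow, Complex.I_sq]
  rw [integral_expCosTerm, integral_cos_pow_even_period, h2, besselCoeff, div_pow]
  generalize (2 * n).factorial = A at *
  generalize n.factorial = A' at *
  push_cast
  generalize ((c : ℂ) ^ 2) ^ n = X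
  generalize (-1 : ℂ) ^ n = Y
  field_simp

/-- Expansion of the exponential under the integral: odd moments of the cosine vanish, and the even
moments replace `(2n)!` by `4^n (n!)²`. -/
lemma integral_exp_cos (c : ℝ) :
    ∫ θ in (-π)..π, Complex.exp (-(Complex.I * ((c * cos θ : ℝ) : ℂ))) =
      ((2 * π * besselJ (c ^ 2) : ℝ) : ℂ) := by
  have hev : HasSum (fun n => ∫ θ in (-π)..π, expCosTerm c (2 * n) θ)
      ((2 * π * besselJ (c ^ 2) : ℝ) : ℂ) := by
    simp only [integral_expCosTerm_even]
    exact Complex.hasSum_ofReal.2 ((besselCoeff_decay.hasSum (c ^ 2)).mul_left (2 * π))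
  have hod : HasSum (fun n => ∫ θ in (-π)..π, expCosTerm c (2 * n + 1) θ) 0 := by
    simp only [integral_expCosTerm, integral_cos_pow_odd_period, Complex.ofReal_zero, mul_zero]
    exact hasSum_zero
  have h := HasSum.even_add_odd (f := fun n => ∫ θ in (-π)..π, expCosTerm c n θ) hev hod
  rw [add_zero] at h
  exact (hasSum_integral_expCosTerm c).unique h

end Sigma2D

end

noncomputable section

namespace Sigma2D

open FourierTransform

/-! ### Fourier transforms of functions with rapid decay, as multipliers -/

/-- Every derivative of `𝓕 k` is the Fourier transform of a moment of `k`, hence bounded by an `L¹`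
norm. -/
lemma hasTemperateGrowth_fourier {k : Plane → ℂ}
    (hk : ∀ n : ℕ, Integrable fun v => ‖v‖ ^ n * ‖k v‖) (hm : AEStronglyMeasurable k) :
    (𝓕 k : Plane → ℂ).HasTemperateGrowth := by
  refine ⟨contDiff_fourier fun n _ => hk n, fun n => ⟨0,
    ∫ v, ‖VectorFourier.fourierPowSMulRight (innerSL ℝ) k v n‖, fun x => ?_⟩⟩
  rw [iteratedFDeriv_fourier (N := ⊤) (fun n _ => hk n) hm le_top, pow_zero, mul_one]
  exact VectorFourier.norm_fourierIntegral_le_integral_norm _ _ _ _ _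

/-- Multiplying by `𝓕 k` on the Fourier side is convolution with `k`, so a unit mass at `y` becomes
`k (· - y)`. The computation moves the Fourier transform from `k` to the modulated test function
`g`, whose transform is a translate of `φ`. -/
lemma multiplier_fourier_delta {k : Plane → ℂ} (hk : Integrable k)
    (hg : (𝓕 k : Plane → ℂ).HasTemperateGrowth) (y : Plane) :
    Represents (TemperedDistribution.fourierMultiplierCLM ℂ (𝓕 k) (TemperedDistribution.delta y))
      (fun x => k (x - y)) := by
  intro φ
  have hky : Integrable fun x => k (x - y) := hk.comp_sub_right y
  refine ⟨?_, ?_⟩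
  · exact hky.bdd_mul (c := SchwartzMap.seminorm ℝ 0 0 φ) φ.continuous.aestronglyMeasurable
      (ae_of_all _ fun x => φ.norm_le_seminorm ℝ x)
  · rw [TemperedDistribution.fourierMultiplierCLM_apply_apply, TemperedDistribution.delta_apply,
      SchwartzMap.fourier_coe, Real.fourier_eq]
    set ψ : 𝓢(Plane, ℂ) := 𝓕⁻ φ with hψ
    set g : Plane → ℂ := fun ξ => (𝐞 (-inner ℝ ξ y) : Circle) • ψ ξ with hgdef
    have hgi : Integrable g := by
      refine (ψ.integrable (μ := volume)).mono ?_ (ae_of_all _ fun ξ => by simp [hgdef])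
      refine Continuous.aestronglyMeasurable ?_
      have : Continuous fun ξ : Plane => (𝐞 (-inner ℝ ξ y) : Circle) :=
        Real.continuous_fourierChar.comp (by fun_prop)
      exact this.smul ψ.continuous
    have h1 : ∀ x, (𝓕 g : Plane → ℂ) x = φ (x + y) := by
      intro x
      have h2 : φ = 𝓕 ψ := by rw [hψ, FourierTransform.fourier_fourierInv_eq]
      rw [h2, SchwartzMap.fourier_coe, Real.fourier_eq, Real.fourier_eq]
      congr 1; ext ξ
      rw [hgdef, smul_smul, ← AddChar.map_add_eq_mul, inner_add_right, neg_add]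
    have h2 := VectorFourier.integral_fourierIntegral_smul_eq_flip (μ := (volume : Measure Plane))
      (ν := (volume : Measure Plane)) (e := 𝐞) (L := innerₗ Plane) (f := k) (g := g)
      Real.continuous_fourierChar continuous_inner hk hgi
    rw [flip_innerₗ] at h2
    have h3 : ∫ ξ, (𝓕 k : Plane → ℂ) ξ • g ξ = ∫ x, k x • φ (x + y) := by
      simp only [← h1]
      exact h2
    calc _ = ∫ ξ, (𝓕 k : Plane → ℂ) ξ • g ξ := by
          congr 1; ext ξ
          rw [SchwartzMap.smulLeftCLM_apply_apply hg, hgdef]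
          simp only [Circle.smul_def, smul_eq_mul]; ring
      _ = _ := by
          rw [h3, ← integral_sub_right_eq_self _ y]
          congr 1; ext x
          simp only [sub_add_cancel, smul_eq_mul, mul_comm]

/-! ### Polar coordinates in the Euclidean plane -/

/-- The point of the plane with Cartesian coordinates `p`. -/
def planePoint (p : ℝ × ℝ) : Plane := WithLp.toLp 2 ![p.1, p.2]

lemma measurePreserving_planePoint : MeasurePreserving planePoint := by
  have h := (PiLp.volume_preserving_toLp (Fin 2)).comp (volume_preserving_finTwoArrow ℝ).symm
  exact h

lemma measurableEmbedding_planePoint : MeasurableEmbedding planePoint := by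
  have h1 : MeasurableEmbedding (WithLp.toLp 2 : (Fin 2 → ℝ) → Plane) :=
    (MeasurableEquiv.toLp 2 (Fin 2 → ℝ)).measurableEmbedding
  exact h1.comp (MeasurableEquiv.finTwoArrow (α := ℝ)).symm.measurableEmbedding

lemma integral_plane_polar (f : Plane → ℂ) :
    ∫ x, f x = ∫ p in Set.Ioi (0 : ℝ) ×ˢ Set.Ioo (-π) π,
      p.1 • f (planePoint (p.1 * cos p.2, p.1 * sin p.2)) := by
  rw [← measurePreserving_planePoint.integral_comp measurableEmbedding_planePoint,
    ← integral_comp_polarCoord_symm, polarCoord_target]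
  simp only [polarCoord_symm_apply]

lemma norm_planePoint_polar {r : ℝ} (hr : 0 ≤ r) (θ : ℝ) :
    ‖planePoint (r * cos θ, r * sin θ)‖ = r := by
  rw [planePoint, EuclideanSpace.norm_eq]
  simp only [Fin.sum_univ_two, Matrix.cons_val_zero, Matrix.cons_val_one, Real.norm_eq_abs, sq_abs]
  rw [show (r * cos θ) ^ 2 + (r * sin θ) ^ 2 = r ^ 2 * (sin θ ^ 2 + cos θ ^ 2) by ring,
    sin_sq_add_cos_sq, mul_one, Real.sqrt_sq hr]

lemma exists_angle (ξ : Plane) : ∃ α : ℝ, ∀ r θ : ℝ,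
    inner ℝ (planePoint (r * cos θ, r * sin θ)) ξ = r * ‖ξ‖ * cos (θ - α) := by
  set z : ℂ := ⟨ξ 0, ξ 1⟩
  have hz : ‖z‖ = ‖ξ‖ := by
    rw [EuclideanSpace.norm_eq, Fin.sum_univ_two, Complex.norm_def, Complex.normSq_mk]
    simp only [Real.norm_eq_abs, sq_abs]
    ring_nf
  refine ⟨z.arg, fun r θ => ?_⟩
  have h1 := Complex.norm_mul_cos_arg z
  have h2 := Complex.norm_mul_sin_arg z
  rw [hz] at h1 h2
  rw [planePoint, PiLp.inner_apply, Fin.sum_univ_two, cos_sub]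
  simp only [Matrix.cons_val_zero, Matrix.cons_val_one, RCLike.inner_apply, conj_trivial]
  linear_combination (-r * cos θ) * h1 - (r * sin θ) * h2

/-- The squared length of `2πξ`, the symbol of `-∂_μ∂_μ`. -/
def laplaceSymbol (ξ : Plane) : ℝ := (2 * π * ‖ξ‖) ^ 2

/-- After rotation by the argument of `ξ`, which periodicity permits, this is Bessel's integral with
`c = 2π r ‖ξ‖`. -/
lemma integral_circle_exp (ξ : Plane) (r : ℝ) :
    ∫ θ in Set.Ioo (-π) π, ((𝐞 (-inner ℝ (planePoint (r * cos θ, r * sin θ)) ξ) : Circle) : ℂ) =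
      ((2 * π * besselJ (laplaceSymbol ξ * r ^ 2) : ℝ) : ℂ) := by
  obtain ⟨α, hα⟩ := exists_angle ξ
  have hp : Function.Periodic
      (fun θ : ℝ => Complex.exp (-(Complex.I * (((2 * π * r * ‖ξ‖) * cos θ : ℝ) : ℂ)))) (2 * π) := by
    intro θ; simp only [cos_add_two_pi]
  have h := integral_exp_cos (2 * π * r * ‖ξ‖)
  have e : π = -π + 2 * π := by ring
  have h2 := hp.intervalIntegral_add_eq (-π) (-π - α)
  rw [show -π - α + 2 * π = π - α by ring, ← e, h,
    ← intervalIntegral.integral_comp_sub_right _ α,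
    intervalIntegral.integral_of_le (by linarith [pi_pos]), integral_Ioc_eq_integral_Ioo] at h2
  rw [show laplaceSymbol ξ * r ^ 2 = (2 * π * r * ‖ξ‖) ^ 2 by rw [laplaceSymbol]; ring, h2]
  congr 1; ext θ
  rw [Real.fourierChar_apply, hα]
  congr 1
  push_cast
  ring

/-! ### Radial functions supported in a disk -/

/-- The area element contributes a factor `r`, so boundedness of `r κ(r)` suffices. This admits
kernels with a logarithmic singularity. -/
lemma integrable_radial {κ : ℝ → ℝ} {a C : ℝ} (hκ : Measurable κ)
    (hsupp : ∀ r, a < r → κ r = 0) (hb : ∀ r, 0 < r → r ≤ a → |r * κ r| ≤ C) :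
    Integrable fun x : Plane => (κ ‖x‖ : ℂ) := by
  rw [integrable_fun_norm_addHaar volume (f := fun r => (κ r : ℂ))]
  have : Module.finrank ℝ Plane = 2 := by simp
  rw [this]
  have h1 : IntegrableOn (fun r : ℝ => r ^ (2 - 1) • (κ r : ℂ)) (Set.Ioc 0 a) := by
    refine Measure.integrableOn_of_bounded (M := C) (by simp) ?_ ?_
    · exact ((measurable_id.pow_const _).smul (Complex.measurable_ofReal.comp hκ)).aestronglyMeasurable
    · refine (ae_restrict_iff' measurableSet_Ioc).2 (ae_of_all _ fun r hr => ?_)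
      have := hb r hr.1 hr.2
      simpa [abs_mul] using this
  have h2 : IntegrableOn (fun r : ℝ => r ^ (2 - 1) • (κ r : ℂ)) (Set.Ioi a) := by
    refine IntegrableOn.congr_fun integrableOn_zero (fun r hr => ?_) measurableSet_Ioi
    simp [hsupp r hr]
  refine (h1.union h2).mono_set fun r hr => ?_
  rcases le_or_gt r a with h | h
  · exact Or.inl ⟨hr, h⟩
  · exact Or.inr h

lemma integrable_pow_mul_radial {κ : ℝ → ℝ} {a C : ℝ} (hκ : Measurable κ)
    (hsupp : ∀ r, a < r → κ r = 0) (hb : ∀ r, 0 < r → r ≤ a → |r * κ r| ≤ C) (n : ℕ) :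
    Integrable fun x : Plane => ‖x‖ ^ n * ‖(κ ‖x‖ : ℂ)‖ := by
  have h := integrable_radial (κ := fun r => r ^ n * κ r) (a := a) (C := a ^ n * C) (by fun_prop)
    (fun r hr => by simp [hsupp r hr]) (fun r h0 h1 => by
      have := hb r h0 h1
      rw [mul_left_comm, abs_mul, abs_of_nonneg (by positivity)]
      have hC : 0 ≤ C := (abs_nonneg _).trans this
      have ha : 0 ≤ a := h0.le.trans h1
      gcongr)
  refine h.norm.congr (ae_of_all _ fun x => ?_)
  simp

/-- In polar coordinates the angular integral is `2π J₀`, so the Fourier transform becomes a Hankel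
transform. All kernel symbols below are computed through this formula. -/
lemma fourier_radial {κ : ℝ → ℝ} {a C : ℝ} (ha : 0 ≤ a) (hκ : Measurable κ)
    (hsupp : ∀ r, a < r → κ r = 0) (hb : ∀ r, 0 < r → r ≤ a → |r * κ r| ≤ C) (ξ : Plane) :
    (𝓕 (fun x : Plane => (κ ‖x‖ : ℂ)) : Plane → ℂ) ξ =
      ((2 * π * ∫ r in (0 : ℝ)..a, r * κ r * besselJ (laplaceSymbol ξ * r ^ 2) : ℝ) : ℂ) := by
  rw [Real.fourier_eq, integral_plane_polar]
  set F : ℝ × ℝ → ℂ := fun p => p.1 •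
    ((𝐞 (-inner ℝ (planePoint (p.1 * cos p.2, p.1 * sin p.2)) ξ) : Circle) •
      (κ ‖planePoint (p.1 * cos p.2, p.1 * sin p.2)‖ : ℂ)) with hF
  set G : ℝ × ℝ → ℂ := fun p =>
    ((𝐞 (-inner ℝ (planePoint (p.1 * cos p.2, p.1 * sin p.2)) ξ) : Circle) : ℂ) *
      ((p.1 * κ p.1 : ℝ) : ℂ) with hG
  have hFG : ∀ p ∈ Set.Ioi (0 : ℝ) ×ˢ Set.Ioo (-π) π, F p = G p := by
    intro p hp
    simp only [hF, hG, norm_planePoint_polar (le_of_lt hp.1), Circle.smul_def, Complex.real_smul,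
      smul_eq_mul]
    push_cast; ring
  have hms : MeasurableSet (Set.Ioi (0 : ℝ) ×ˢ Set.Ioo (-π) π) :=
    measurableSet_Ioi.prod measurableSet_Ioo
  have hGm : Measurable G := by
    refine Measurable.mul ?_ ?_
    · have : Continuous fun p : ℝ × ℝ =>
          ((𝐞 (-inner ℝ (planePoint (p.1 * cos p.2, p.1 * sin p.2)) ξ) : Circle) : ℂ) := by
        refine continuous_subtype_val.comp (Real.continuous_fourierChar.comp ?_)
        have : Continuous fun p : ℝ × ℝ => planePoint (p.1 * cos p.2, p.1 * sin p.2) := by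
          unfold planePoint
          refine (PiLp.continuous_toLp 2 _).comp (continuous_pi fun i => ?_)
          fin_cases i <;> simp <;> fun_prop
        fun_prop
      exact this.measurable
    · exact Complex.measurable_ofReal.comp
        (measurable_fst.mul (hκ.comp measurable_fst))
  have hGi : IntegrableOn G (Set.Ioi (0 : ℝ) ×ˢ Set.Ioo (-π) π) (volume.prod volume) := by
    have h1 : IntegrableOn G (Set.Ioc (0 : ℝ) a ×ˢ Set.Ioo (-π) π) (volume.prod volume) := by
      refine Measure.integrableOn_of_bounded (M := C) ?_ hGm.aestronglyMeasurable ?_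
      · rw [Measure.prod_prod]
        simp [ENNReal.mul_eq_top]
      · refine (ae_restrict_iff' (measurableSet_Ioc.prod measurableSet_Ioo)).2
          (ae_of_all _ fun p hp => ?_)
        have := hb p.1 hp.1.1 hp.1.2
        rw [hG, norm_mul, Circle.norm_coe, one_mul, Complex.norm_real]
        exact this
    have h2 : IntegrableOn G (Set.Ioi a ×ˢ Set.Ioo (-π) π) (volume.prod volume) := by
      refine IntegrableOn.congr_fun integrableOn_zero (fun p hp => ?_)
        (measurableSet_Ioi.prod measurableSet_Ioo)
      simp [hG, hsupp p.1 hp.1]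
    refine (h1.union h2).mono_set fun p hp => ?_
    rcases le_or_gt p.1 a with h | h
    · exact Or.inl ⟨⟨hp.1, h⟩, hp.2⟩
    · exact Or.inr ⟨h, hp.2⟩
  rw [setIntegral_congr_fun hms hFG, Measure.volume_eq_prod, setIntegral_prod _ hGi]
  have h3 : ∀ r : ℝ, ∫ θ in Set.Ioo (-π) π, G (r, θ) =
      ((2 * π * (r * κ r * besselJ (laplaceSymbol ξ * r ^ 2)) : ℝ) : ℂ) := by
    intro r
    simp only [hG]
    rw [integral_mul_const, integral_circle_exp]
    push_cast; ring
  simp only [h3]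
  rw [intervalIntegral.integral_of_le ha, ← integral_const_mul, integral_complex_ofReal]
  congr 1
  refine setIntegral_eq_of_subset_of_forall_sdiff_eq_zero measurableSet_Ioi
    Set.Ioc_subset_Ioi_self fun r hr => ?_
  have : a < r := by
    by_contra h
    exact hr.2 ⟨hr.1, not_lt.1 h⟩
  simp [hsupp r this]

end Sigma2D

end

noncomputable section

namespace Sigma2D

open FourierTransform

/-! ### The kernels of the Bessel multipliers -/

/-- The correction of order `l` in `greenKernel`. -/
def greenCorrection (a l ρ : ℝ) : ℝ :=
  ∫ r in ρ..a, r * (log a - log r) * sonineN (l * (r ^ 2 - ρ ^ 2))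

/-- The radial function whose Fourier transform is `(J₀(a√(w - l)) - 1) / (w - l)`, where `w` is
the symbol of `-∂_μ∂_μ`. -/
def greenKernel (a l ρ : ℝ) : ℝ :=
  -(1 / (2 * π)) * ((log a - log (min ρ a)) + l / 2 * greenCorrection a l (min ρ a))

/-- The correction of order `l` in `shiftKernel`. -/
def shiftCorrection (a l ρ : ℝ) : ℝ :=
  ∫ r in ρ..a, r * sonineN (l * (a ^ 2 - r ^ 2)) * (log r - log ρ)

/-- The radial function whose Fourier transform is `(J₀(a√(w - l)) - J₀(a√(-l))) / w`. -/
def shiftKernel (a l ρ : ℝ) : ℝ :=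
  -(1 / (2 * π)) * ((log a - log (min ρ a)) + l / 2 * shiftCorrection a l (min ρ a))

/-- The radial function whose Fourier transform is `(J₀(a√w) - 1 + w a²/4) / w²`. -/
def biharmonicKernel (a ρ : ℝ) : ℝ :=
  1 / (2 * π) * (1 / 4 * ((a ^ 2 + min ρ a ^ 2) * (log a - log (min ρ a)) -
    (a ^ 2 - min ρ a ^ 2)))

/-- Joint continuity in `(l, ρ)`, down to `ρ = 0`, is what later makes the expansion uniform. It
holds because `r (log a - log r)` is continuous at `0`. -/
lemma continuous_greenCorrection (a : ℝ) :
    Continuous fun p : ℝ × ℝ => greenCorrection a p.1 p.2 := by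
  have hN := continuous_sonineN
  have hl := continuous_mul_log_sub a
  have h := intervalIntegral.continuous_parametric_intervalIntegral_of_continuous
    (μ := volume) (a₀ := a)
    (f := fun (p : ℝ × ℝ) (r : ℝ) => r * (log a - log r) * sonineN (p.1 * (r ^ 2 - p.2 ^ 2)))
    (by
      have h1 : Continuous fun q : (ℝ × ℝ) × ℝ => q.2 * (log a - log q.2) :=
        hl.comp continuous_snd
      simp only [Function.uncurry_def]
      fun_prop) (s := fun p => p.2) continuous_snd
  refine h.neg.congr fun p => ?_
  rw [greenCorrection, intervalIntegral.integral_symm]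
  simp

lemma continuous_shiftWeight (a l : ℝ) :
    Continuous fun r : ℝ => r * sonineN (l * (a ^ 2 - r ^ 2)) := by
  have hN := continuous_sonineN
  fun_prop

/-- Pulling out `log ρ` isolates the only factor that is discontinuous at `ρ = 0`; both remaining
integrals are continuous in `ρ`. -/
lemma shiftCorrection_eq (a l ρ : ℝ) : shiftCorrection a l ρ =
    (∫ r in ρ..a, r * log r * sonineN (l * (a ^ 2 - r ^ 2))) -
      log ρ * ∫ r in ρ..a, r * sonineN (l * (a ^ 2 - r ^ 2)) := by
  have hN := continuous_sonineN
  have hl := Real.continuous_mul_log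
  have hw := continuous_shiftWeight a l
  rw [shiftCorrection, ← intervalIntegral.integral_const_mul, ← intervalIntegral.integral_sub
    (Continuous.intervalIntegrable (by fun_prop) _ _)
    (Continuous.intervalIntegrable (by fun_prop) _ _)]
  refine intervalIntegral.integral_congr fun r _ => ?_
  ring

lemma continuous_integral_left {f : ℝ → ℝ} (hf : Continuous f) (a : ℝ) :
    Continuous fun ρ => ∫ r in ρ..a, f r := by
  have h := (intervalIntegral.continuous_primitive (μ := volume) (fun b c => hf.intervalIntegrable b c) a).neg
  refine h.congr fun ρ => ?_
  rw [intervalIntegral.integral_symm]; simp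

lemma measurable_shiftCorrection (a l : ℝ) : Measurable (shiftCorrection a l) := by
  have hN := continuous_sonineN
  have hl := Real.continuous_mul_log
  rw [show shiftCorrection a l = _ from funext (shiftCorrection_eq a l)]
  refine Measurable.sub (continuous_integral_left (by fun_prop) a).measurable
    (Real.measurable_log.mul (continuous_integral_left (continuous_shiftWeight a l) a).measurable)

lemma measurable_greenKernel (a l : ℝ) : Measurable (greenKernel a l) := by
  have h : Measurable fun ρ => greenCorrection a l ρ :=
    ((continuous_greenCorrection a).comp (Continuous.prodMk_right l)).measurable
  have hm : Measurable fun ρ : ℝ => min ρ a := measurable_id.min measurable_const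
  exact (((Real.measurable_log.comp hm).const_sub _).add ((h.comp hm).const_mul _)).const_mul _

lemma measurable_shiftKernel (a l : ℝ) : Measurable (shiftKernel a l) := by
  have hm : Measurable fun ρ : ℝ => min ρ a := measurable_id.min measurable_const
  exact (((Real.measurable_log.comp hm).const_sub _).add
    (((measurable_shiftCorrection a l).comp hm).const_mul _)).const_mul _

lemma measurable_biharmonicKernel (a : ℝ) : Measurable (biharmonicKernel a) := by
  have hm : Measurable fun ρ : ℝ => min ρ a := measurable_id.min measurable_const
  have := Real.measurable_log
  unfold biharmonicKernel
  fun_prop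

lemma greenKernel_eq_zero {a l ρ : ℝ} (h : a < ρ) : greenKernel a l ρ = 0 := by
  simp [greenKernel, greenCorrection, min_eq_right h.le]

lemma shiftKernel_eq_zero {a l ρ : ℝ} (h : a < ρ) : shiftKernel a l ρ = 0 := by
  simp [shiftKernel, shiftCorrection, min_eq_right h.le]

lemma biharmonicKernel_eq_zero {a ρ : ℝ} (h : a < ρ) : biharmonicKernel a ρ = 0 := by
  simp [biharmonicKernel, min_eq_right h.le]

lemma exists_bound_mul {κ f : ℝ → ℝ} {a : ℝ} (hf : Continuous f)
    (h : ∀ r, 0 < r → r ≤ a → r * κ r = f r) :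
    ∃ C, ∀ r, 0 < r → r ≤ a → |r * κ r| ≤ C := by
  obtain ⟨C, hC⟩ := (isCompact_Icc (a := (0 : ℝ)) (b := a)).exists_bound_of_continuousOn
    hf.continuousOn
  exact ⟨C, fun r h0 h1 => by rw [h r h0 h1]; exact hC r ⟨h0.le, h1⟩⟩

lemma exists_bound_greenKernel (a l : ℝ) :
    ∃ C, ∀ r, 0 < r → r ≤ a → |r * greenKernel a l r| ≤ C := by
  have h : Continuous fun ρ => greenCorrection a l ρ :=
    (continuous_greenCorrection a).comp (Continuous.prodMk_right l)
  have hl := continuous_mul_log_sub a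
  refine exists_bound_mul (f := fun r => -(1 / (2 * π)) * (r * (log a - log r) +
    l / 2 * (r * greenCorrection a l r))) (by fun_prop) fun r _ h1 => ?_
  rw [greenKernel, min_eq_left h1]; ring

lemma exists_bound_shiftKernel (a l : ℝ) :
    ∃ C, ∀ r, 0 < r → r ≤ a → |r * shiftKernel a l r| ≤ C := by
  have hN := continuous_sonineN
  have hl := Real.continuous_mul_log
  have hl' := continuous_mul_log_sub a
  have h1 := continuous_integral_left (f := fun r => r * log r * sonineN (l * (a ^ 2 - r ^ 2)))
    (by fun_prop) a
  have h2 := continuous_integral_left (continuous_shiftWeight a l) a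
  refine exists_bound_mul (f := fun ρ => -(1 / (2 * π)) * (ρ * (log a - log ρ) +
    l / 2 * (ρ * (∫ r in ρ..a, r * log r * sonineN (l * (a ^ 2 - r ^ 2))) -
      (ρ * log ρ) * ∫ r in ρ..a, r * sonineN (l * (a ^ 2 - r ^ 2))))) (by fun_prop)
    fun r _ h1 => ?_
  rw [shiftKernel, min_eq_left h1, shiftCorrection_eq]; ring

lemma exists_bound_biharmonicKernel (a : ℝ) :
    ∃ C, ∀ r, 0 < r → r ≤ a → |r * biharmonicKernel a r| ≤ C := by
  have hl := continuous_mul_log_sub a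
  refine exists_bound_mul (f := fun r => 1 / (2 * π) * (1 / 4 * ((a ^ 2 + r ^ 2) *
    (r * (log a - log r)) - r * (a ^ 2 - r ^ 2)))) (by fun_prop) fun r _ h1 => ?_
  rw [biharmonicKernel, min_eq_left h1]; ring

/-- The Fourier transform of `greenKernel`. -/
def greenSymbol (a l : ℝ) : Plane → ℂ := 𝓕 (fun x : Plane => (greenKernel a l ‖x‖ : ℂ))

/-- The Fourier transform of `shiftKernel`. -/
def shiftSymbol (a l : ℝ) : Plane → ℂ := 𝓕 (fun x : Plane => (shiftKernel a l ‖x‖ : ℂ))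

/-- The Fourier transform of `biharmonicKernel`. -/
def biharmonicSymbol (a : ℝ) : Plane → ℂ := 𝓕 (fun x : Plane => (biharmonicKernel a ‖x‖ : ℂ))

lemma integral_min_eq {a : ℝ} (ha : 0 ≤ a) (f : ℝ → ℝ → ℝ) :
    ∫ ρ in (0 : ℝ)..a, f ρ (min ρ a) = ∫ ρ in (0 : ℝ)..a, f ρ ρ := by
  refine intervalIntegral.integral_congr fun ρ hρ => ?_
  rw [Set.uIcc_of_le ha] at hρ
  simp only [min_eq_left hρ.2]

/-- Sonine's integral expresses `J((w - l) r²)` through the values `J(w ρ²)` with `ρ ≤ r`.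
Exchanging the two integrations collects the coefficient of `J(w ρ²)`, which is the correction term
of the kernel. -/
lemma integral_greenKernel {a : ℝ} (ha : 0 ≤ a) (l w : ℝ) :
    2 * π * ∫ ρ in (0 : ℝ)..a, ρ * greenKernel a l ρ * besselJ (w * ρ ^ 2) =
      -∫ r in (0 : ℝ)..a, r * (log a - log r) * besselJ ((w - l) * r ^ 2) := by
  have hN := continuous_sonineN
  have hJ := continuous_besselJ
  have hl := continuous_mul_log_sub a
  have hG : Continuous fun ρ => greenCorrection a l ρ :=
    (continuous_greenCorrection a).comp (Continuous.prodMk_right l)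
  have e1 : ∫ ρ in (0 : ℝ)..a, ρ * greenKernel a l ρ * besselJ (w * ρ ^ 2) =
      -(1 / (2 * π)) * ((∫ ρ in (0 : ℝ)..a, ρ * (log a - log ρ) * besselJ (w * ρ ^ 2)) +
        l / 2 * ∫ ρ in (0 : ℝ)..a, ρ * besselJ (w * ρ ^ 2) * greenCorrection a l ρ) := by
    rw [← intervalIntegral.integral_const_mul, ← intervalIntegral.integral_add
      (Continuous.intervalIntegrable (by fun_prop) _ _)
      (Continuous.intervalIntegrable (by fun_prop) _ _), ← intervalIntegral.integral_const_mul]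
    rw [← integral_min_eq ha fun ρ c => -(1 / (2 * π)) * (ρ * (log a - log c) *
      besselJ (w * ρ ^ 2) + l / 2 * (ρ * besselJ (w * ρ ^ 2) * greenCorrection a l c))]
    refine intervalIntegral.integral_congr fun ρ _ => ?_
    simp only [greenKernel]; ring
  have hcont : Continuous (Function.uncurry fun x y : ℝ => (y * besselJ (w * y ^ 2)) *
      ((x * (log a - log x)) * sonineN (l * (x ^ 2 - y ^ 2)))) := by
    have h1 : Continuous fun q : ℝ × ℝ => q.1 * (log a - log q.1) := hl.comp continuous_fst
    simp only [Function.uncurry_def]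
    fun_prop
  obtain ⟨C, hC⟩ := ((isCompact_Icc (a := (0 : ℝ)) (b := a)).prod
    (isCompact_Icc (a := (0 : ℝ)) (b := a))).exists_bound_of_continuousOn hcont.continuousOn
  have e2 := integral_triangle_swap hcont.measurable ha (C := C) fun x y h0 h1 h2 =>
    hC (x, y) ⟨⟨(h0.trans_le h1).le, h2⟩, ⟨h0.le, h1.trans h2⟩⟩
  simp only [intervalIntegral.integral_const_mul] at e2
  have e3 : ∫ r in (0 : ℝ)..a, r * (log a - log r) * besselJ ((w - l) * r ^ 2) =
      (∫ r in (0 : ℝ)..a, r * (log a - log r) * besselJ (w * r ^ 2)) +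
        l / 2 * ∫ x in (0 : ℝ)..a, ∫ y in (0 : ℝ)..x, (y * besselJ (w * y ^ 2)) *
      ((x * (log a - log x)) * sonineN (l * (x ^ 2 - y ^ 2))) := by
    have e4 : ∀ x ∈ Set.uIcc 0 a, l / 2 * ∫ y in (0 : ℝ)..x, (y * besselJ (w * y ^ 2)) *
        ((x * (log a - log x)) * sonineN (l * (x ^ 2 - y ^ 2))) =
        (x * (log a - log x)) * (besselJ ((w - l) * x ^ 2) - besselJ (w * x ^ 2)) := by
      intro x hx
      rw [Set.uIcc_of_le ha] at hx
      rw [sonine w l hx.1, add_sub_cancel_left, mul_left_comm,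
        ← intervalIntegral.integral_const_mul (x * _)]
      congr 1
      refine intervalIntegral.integral_congr fun y _ => ?_
      ring
    rw [← intervalIntegral.integral_const_mul (l / 2), intervalIntegral.integral_congr e4,
      ← intervalIntegral.integral_add
      (Continuous.intervalIntegrable (by fun_prop) _ _)
      (Continuous.intervalIntegrable (by fun_prop) _ _)]
    refine intervalIntegral.integral_congr fun y _ => ?_
    ring
  rw [e1, e3, e2]
  simp only [greenCorrection]
  rw [← mul_assoc, mul_neg, mul_one_div_cancel (by positivity), neg_one_mul]

/-- Sonine's formula at `w` minus the one at `0` contains only differences `J(w r²) - 1`. Each of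
these is `-w` times a logarithmic moment over the disk of radius `r`, and exchanging the
integrations gives the kernel. -/
lemma integral_shiftKernel {a : ℝ} (ha : 0 ≤ a) (l w : ℝ) :
    w * (2 * π * ∫ ρ in (0 : ℝ)..a, ρ * shiftKernel a l ρ * besselJ (w * ρ ^ 2)) =
      besselJ ((w - l) * a ^ 2) - besselJ (-l * a ^ 2) := by
  have hN := continuous_sonineN
  have hJ := continuous_besselJ
  have hl := continuous_mul_log_sub a
  have hl0 := Real.continuous_mul_log
  have hS : Continuous fun ρ => ρ * shiftCorrection a l ρ := by
    have h1 := continuous_integral_left (f := fun r => r * log r * sonineN (l * (a ^ 2 - r ^ 2)))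
      (by fun_prop) a
    have h2 := continuous_integral_left (continuous_shiftWeight a l) a
    have : Continuous fun ρ => (ρ * (∫ r in ρ..a, r * log r * sonineN (l * (a ^ 2 - r ^ 2))) -
      (ρ * log ρ) * ∫ r in ρ..a, r * sonineN (l * (a ^ 2 - r ^ 2))) := by fun_prop
    refine this.congr fun ρ => ?_
    rw [shiftCorrection_eq]; ring
  have e1 : ∫ ρ in (0 : ℝ)..a, ρ * shiftKernel a l ρ * besselJ (w * ρ ^ 2) =
      -(1 / (2 * π)) * ((∫ ρ in (0 : ℝ)..a, ρ * (log a - log ρ) * besselJ (w * ρ ^ 2)) +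
        l / 2 * ∫ ρ in (0 : ℝ)..a, ρ * shiftCorrection a l ρ * besselJ (w * ρ ^ 2)) := by
    rw [← intervalIntegral.integral_const_mul, ← intervalIntegral.integral_add
      (Continuous.intervalIntegrable (by fun_prop) _ _)
      (Continuous.intervalIntegrable (by fun_prop) _ _), ← intervalIntegral.integral_const_mul]
    rw [← integral_min_eq ha fun ρ c => -(1 / (2 * π)) * (ρ * (log a - log c) *
      besselJ (w * ρ ^ 2) + l / 2 * (ρ * shiftCorrection a l c * besselJ (w * ρ ^ 2)))]
    refine intervalIntegral.integral_congr fun ρ _ => ?_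
    simp only [shiftKernel]; ring
  have hm : Measurable (Function.uncurry fun x y : ℝ => (x * sonineN (l * (a ^ 2 - x ^ 2))) *
      (y * (log x - log y) * besselJ (w * y ^ 2))) := by
    have := hN.measurable
    have := hJ.measurable
    have := Real.measurable_log
    simp only [Function.uncurry_def]
    fun_prop
  obtain ⟨C₁, hC₁⟩ := (isCompact_Icc (a := (0 : ℝ)) (b := a)).exists_bound_of_continuousOn
    (continuous_shiftWeight a l).continuousOn
  obtain ⟨C₂, hC₂⟩ := (isCompact_Icc (a := (0 : ℝ)) (b := a)).exists_bound_of_continuousOn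
    (by fun_prop : Continuous fun y => besselJ (w * y ^ 2)).continuousOn
  have e2 := integral_triangle_swap hm ha (C := C₁ * (a * C₂)) fun x y h0 h1 h2 => by
    have hx : 0 < x := h0.trans_le h1
    have b1 := hC₁ x ⟨hx.le, h2⟩
    have b2 := hC₂ y ⟨h0.le, h1.trans h2⟩
    -- By `log u ≤ u - 1` at `u = x / y`, the product is at most `x - y`; the logarithmic
    -- singularity at `y = 0` is thus harmless.
    have b3 : |y * (log x - log y)| ≤ a := by
      have c1 := Real.log_le_sub_one_of_pos (div_pos hx h0)
      rw [Real.log_div hx.ne' h0.ne'] at c1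
      have c2 : 0 ≤ log x - log y := sub_nonneg.2 (Real.log_le_log h0 h1)
      rw [abs_of_nonneg (by positivity)]
      calc y * (log x - log y) ≤ y * (x / y - 1) := by gcongr
        _ = x - y := by field_simp
        _ ≤ a := by linarith
    rw [norm_mul, norm_mul (_ * _)]
    exact mul_le_mul b1 (mul_le_mul b3 b2 (norm_nonneg _) ((abs_nonneg _).trans b3))
      (by positivity) ((norm_nonneg _).trans b1)
  have e3 : ∫ y in (0 : ℝ)..a, ∫ x in y..a, (x * sonineN (l * (a ^ 2 - x ^ 2))) *
      (y * (log x - log y) * besselJ (w * y ^ 2)) =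
      ∫ ρ in (0 : ℝ)..a, ρ * shiftCorrection a l ρ * besselJ (w * ρ ^ 2) := by
    refine intervalIntegral.integral_congr fun y _ => ?_
    simp only [shiftCorrection]
    rw [mul_right_comm, ← intervalIntegral.integral_const_mul]
    refine intervalIntegral.integral_congr fun x _ => ?_
    ring
  have e4 : ∀ x ∈ Set.uIcc 0 a, w * ∫ y in (0 : ℝ)..x, (x * sonineN (l * (a ^ 2 - x ^ 2))) *
      (y * (log x - log y) * besselJ (w * y ^ 2)) =
      x * (besselJ (0 * x ^ 2) * sonineN (l * (a ^ 2 - x ^ 2))) -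
        x * (besselJ (w * x ^ 2) * sonineN (l * (a ^ 2 - x ^ 2))) := by
    intro x hx
    rw [Set.uIcc_of_le ha] at hx
    rw [intervalIntegral.integral_const_mul, mul_left_comm, integral_log_mul_besselJ w hx.1,
      zero_mul, besselJ_zero]
    ring
  have e5 : w * ∫ ρ in (0 : ℝ)..a, ρ * shiftCorrection a l ρ * besselJ (w * ρ ^ 2) =
      (∫ x in (0 : ℝ)..a, x * (besselJ (0 * x ^ 2) * sonineN (l * (a ^ 2 - x ^ 2)))) -
        ∫ x in (0 : ℝ)..a, x * (besselJ (w * x ^ 2) * sonineN (l * (a ^ 2 - x ^ 2))) := by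
    rw [← e3, ← e2, ← intervalIntegral.integral_const_mul, intervalIntegral.integral_congr e4,
      intervalIntegral.integral_sub (Continuous.intervalIntegrable (by fun_prop) _ _)
      (Continuous.intervalIntegrable (by fun_prop) _ _)]
  have s1 := sonine w l ha
  have s2 := sonine 0 l ha
  have s3 := integral_log_mul_besselJ w ha
  rw [zero_mul, besselJ_zero, zero_sub] at s2
  rw [e1]
  have : w * (2 * π * (-(1 / (2 * π)) * ((∫ ρ in (0 : ℝ)..a, ρ * (log a - log ρ) *
      besselJ (w * ρ ^ 2)) + l / 2 * ∫ ρ in (0 : ℝ)..a, ρ * shiftCorrection a l ρ *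
      besselJ (w * ρ ^ 2)))) = -(w * (∫ ρ in (0 : ℝ)..a, ρ * (log a - log ρ) *
      besselJ (w * ρ ^ 2))) - l / 2 * (w * ∫ ρ in (0 : ℝ)..a, ρ * shiftCorrection a l ρ *
      besselJ (w * ρ ^ 2)) := by field_simp; ring
  rw [this, s3, e5, s1, s2]
  ring

/-- Stated without division, since `w - l` may vanish on a circle of frequencies. -/
lemma greenSymbol_apply {a : ℝ} (ha : 0 ≤ a) (l : ℝ) (ξ : Plane) :
    ((laplaceSymbol ξ - l : ℝ) : ℂ) * greenSymbol a l ξ =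
      ((besselJ ((laplaceSymbol ξ - l) * a ^ 2) - 1 : ℝ) : ℂ) := by
  obtain ⟨C, hC⟩ := exists_bound_greenKernel a l
  rw [greenSymbol, fourier_radial ha (measurable_greenKernel a l)
    (fun r hr => greenKernel_eq_zero hr) hC, integral_greenKernel ha, ← Complex.ofReal_mul]
  congr 1
  rw [mul_neg, integral_log_mul_besselJ _ ha]; ring

lemma shiftSymbol_apply {a : ℝ} (ha : 0 ≤ a) (l : ℝ) (ξ : Plane) :
    (laplaceSymbol ξ : ℂ) * shiftSymbol a l ξ =
      ((besselJ ((laplaceSymbol ξ - l) * a ^ 2) - besselJ (-l * a ^ 2) : ℝ) : ℂ) := by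
  obtain ⟨C, hC⟩ := exists_bound_shiftKernel a l
  rw [shiftSymbol, fourier_radial ha (measurable_shiftKernel a l)
    (fun r hr => shiftKernel_eq_zero hr) hC, ← Complex.ofReal_mul, integral_shiftKernel ha]

lemma biharmonicSymbol_apply {a : ℝ} (ha : 0 ≤ a) (ξ : Plane) :
    (laplaceSymbol ξ : ℂ) ^ 2 * biharmonicSymbol a ξ =
      ((besselJ (laplaceSymbol ξ * a ^ 2) - 1 + laplaceSymbol ξ * a ^ 2 / 4 : ℝ) : ℂ) := by
  obtain ⟨C, hC⟩ := exists_bound_biharmonicKernel a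
  rw [biharmonicSymbol, fourier_radial ha (measurable_biharmonicKernel a)
    (fun r hr => biharmonicKernel_eq_zero hr) hC, ← Complex.ofReal_pow, ← Complex.ofReal_mul,
    ← integral_log_poly_mul_besselJ _ ha]
  congr 1
  rw [← intervalIntegral.integral_const_mul, ← intervalIntegral.integral_const_mul,
    ← intervalIntegral.integral_const_mul]
  rw [← integral_min_eq ha fun r c => laplaceSymbol ξ ^ 2 * (r * (1 / 4 * ((a ^ 2 + c ^ 2) *
    (log a - log c) - (a ^ 2 - c ^ 2))) * besselJ (laplaceSymbol ξ * r ^ 2))]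
  refine intervalIntegral.integral_congr fun r _ => ?_
  simp only [biharmonicKernel]
  field_simp

end Sigma2D

end

noncomputable section

namespace Sigma2D

open FourierTransform

/-! ### Distributions given by functions -/

lemma Represents.add {T S : 𝓢'(Plane, ℂ)} {u v : Plane → ℂ} (hT : Represents T u)
    (hS : Represents S v) : Represents (T + S) (fun x => u x + v x) := by
  intro φ
  obtain ⟨h1, h2⟩ := hT φ
  obtain ⟨h3, h4⟩ := hS φ
  simp only [mul_add]
  refine ⟨h1.add h3, ?_⟩
  rw [integral_add h1 h3, ← h2, ← h4]; rfl

lemma Represents.smul {T : 𝓢'(Plane, ℂ)} {u : Plane → ℂ} (hT : Represents T u) (c : ℂ) :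
    Represents (c • T) (fun x => c * u x) := by
  intro φ
  obtain ⟨h1, h2⟩ := hT φ
  simp only [mul_left_comm _ c]
  refine ⟨h1.const_mul c, ?_⟩
  rw [integral_const_mul, ← h2]; rfl

lemma represents_zero : Represents 0 (fun _ => 0) := by
  intro φ
  simp only [mul_zero, integral_zero]
  exact ⟨integrable_zero _ _ _, rfl⟩

lemma Represents.sum {α : Type*} (s : Finset α) {T : α → 𝓢'(Plane, ℂ)} {u : α → Plane → ℂ}
    (h : ∀ i ∈ s, Represents (T i) (u i)) :
    Represents (∑ i ∈ s, T i) (fun x => ∑ i ∈ s, u i x) := by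
  classical
  induction s using Finset.induction_on with
  | empty => simpa using represents_zero
  | insert i s hi ih =>
    simp only [Finset.sum_insert hi]
    exact (h i (Finset.mem_insert_self i s)).add
      (ih fun j hj => h j (Finset.mem_insert_of_mem hj))

lemma Represents.congr_ae {T : 𝓢'(Plane, ℂ)} {u v : Plane → ℂ} (hT : Represents T u)
    (h : u =ᵐ[volume] v) : Represents T v := by
  intro φ
  obtain ⟨h1, h2⟩ := hT φ
  have e : (fun x => φ x * u x) =ᵐ[volume] fun x => φ x * v x := by
    filter_upwards [h] with x hx; rw [hx]
  exact ⟨h1.congr e, h2.trans (integral_congr_ae e)⟩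

lemma ae_ne_point (y : Plane) : ∀ᵐ x : Plane, x ≠ y :=
  compl_mem_ae_iff.2 (measure_singleton y)

lemma Represents.congr_off {T : 𝓢'(Plane, ℂ)} {u v : Plane → ℂ} (hT : Represents T u) (y : Plane)
    (h : ∀ x, x ≠ y → u x = v x) : Represents T v :=
  hT.congr_ae (by filter_upwards [ae_ne_point y] with x hx using h x hx)

lemma Represents.smulLeft {T : 𝓢'(Plane, ℂ)} {u f : Plane → ℂ} (hT : Represents T u)
    (hf : f.HasTemperateGrowth) :
    Represents (TemperedDistribution.smulLeftCLM ℂ f T) (fun x => f x * u x) := by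
  intro φ
  obtain ⟨h1, h2⟩ := hT (SchwartzMap.smulLeftCLM ℂ f φ)
  have e : (fun x => SchwartzMap.smulLeftCLM ℂ f φ x * u x) = fun x => φ x * (f x * u x) := by
    ext x; rw [SchwartzMap.smulLeftCLM_apply_apply hf, smul_eq_mul]; ring
  rw [e] at h1 h2
  exact ⟨h1, h2⟩

lemma represents_of_integrable {v : Plane → ℂ} (hv : Integrable v) :
    ∃ T : 𝓢'(Plane, ℂ), Represents T v := by
  have hm : MemLp v 1 volume := memLp_one_iff_integrable.2 hv
  refine ⟨Lp.toTemperedDistribution (hm.toLp v), fun φ => ⟨?_, ?_⟩⟩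
  · exact hv.bdd_mul (c := SchwartzMap.seminorm ℝ 0 0 φ) φ.continuous.aestronglyMeasurable
      (ae_of_all _ fun x => φ.norm_le_seminorm ℝ x)
  · rw [Lp.toTemperedDistribution_apply]
    refine integral_congr_ae ?_
    filter_upwards [hm.coeFn_toLp] with x hx
    rw [hx, smul_eq_mul]

/-- Functions of polynomial growth with at most a `1 / |x|` singularity at the origin. -/
def Moderate (u : Plane → ℂ) : Prop :=
  AEStronglyMeasurable u ∧ ∃ (C : ℝ) (n : ℕ), ∀ x, x ≠ 0 → ‖u x‖ ≤ C * (1 + ‖x‖) ^ n / ‖x‖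

/-- The planar area element `r dr` cancels the singularity `1 / r`. -/
lemma integrable_inv_norm_mul : Integrable fun x : Plane => ‖x‖⁻¹ * (1 + ‖x‖ ^ 2)⁻¹ := by
  rw [integrable_fun_norm_addHaar volume (f := fun r : ℝ => r⁻¹ * (1 + r ^ 2)⁻¹)]
  have : Module.finrank ℝ Plane = 2 := by simp
  rw [this]
  refine (integrable_inv_one_add_sq.integrableOn (s := Set.Ioi 0)).congr_fun (fun r hr => ?_)
    measurableSet_Ioi
  have : r ≠ 0 := ne_of_gt hr
  simp only [smul_eq_mul, show 2 - 1 = 1 from rfl, pow_one]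
  field_simp

lemma Moderate.exists_integrable {u : Plane → ℂ} (hu : Moderate u) :
    ∃ n : ℕ, Integrable fun x => ((1 + ‖x‖ ^ 2) ^ n : ℝ)⁻¹ • u x := by
  obtain ⟨hm, C, n, hC⟩ := hu
  refine ⟨n + 1, (integrable_inv_norm_mul.const_mul (|C| * 2 ^ n)).mono' ?_ ?_⟩
  · have hc : Continuous fun x : Plane => ((1 + ‖x‖ ^ 2) ^ (n + 1) : ℝ)⁻¹ :=
      Continuous.inv₀ (by fun_prop) fun x => by positivity
    exact hc.aestronglyMeasurable.smul hm
  · filter_upwards [ae_ne_point 0] with x hx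
    have hx' : 0 < ‖x‖ := norm_pos_iff.2 hx
    have h1 : (1 + ‖x‖) ^ n ≤ 2 ^ n * (1 + ‖x‖ ^ 2) ^ n := by
      rw [← mul_pow]
      gcongr
      nlinarith [sq_nonneg (‖x‖ - 1)]
    rw [norm_smul, norm_inv, Real.norm_of_nonneg (by positivity)]
    calc ((1 + ‖x‖ ^ 2) ^ (n + 1))⁻¹ * ‖u x‖
        ≤ ((1 + ‖x‖ ^ 2) ^ (n + 1))⁻¹ * (|C| * (2 ^ n * (1 + ‖x‖ ^ 2) ^ n) / ‖x‖) := by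
          gcongr
          refine (hC x hx).trans ?_
          gcongr
          exact le_abs_self C
      _ = _ := by
          rw [pow_succ]
          field_simp

lemma hasTemperateGrowth_one_add_sq_pow (n : ℕ) :
    (fun x : Plane => (((1 + ‖x‖ ^ 2) ^ n : ℝ) : ℂ)).HasTemperateGrowth := by
  have h : (fun x : Plane => ‖x‖ ^ 2).HasTemperateGrowth :=
    Function.hasTemperateGrowth_norm_sq Plane
  have h2 := ((Function.HasTemperateGrowth.const (1 : ℝ)).add h).pow n
  exact Function.Complex.hasTemperateGrowth_ofReal.comp h2

/-- Division by a power of `1 + |x|²` makes the function integrable; the resulting distribution is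
then multiplied by that power again. -/
lemma Moderate.exists_represents {u : Plane → ℂ} (hu : Moderate u) :
    ∃ T : 𝓢'(Plane, ℂ), Represents T u := by
  obtain ⟨n, hn⟩ := hu.exists_integrable
  obtain ⟨S, hS⟩ := represents_of_integrable hn
  refine ⟨_, (hS.smulLeft (hasTemperateGrowth_one_add_sq_pow n)).congr_ae (ae_of_all _ fun x => ?_)⟩
  have : (1 + ‖x‖ ^ 2 : ℝ) ≠ 0 := by positivity
  simp only [Complex.real_smul, ← mul_assoc, ← Complex.ofReal_mul]
  rw [mul_inv_cancel₀ (pow_ne_zero _ this), Complex.ofReal_one, one_mul]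

lemma Moderate.integrable_mul {u : Plane → ℂ} (hu : Moderate u) (φ : 𝓢(Plane, ℂ)) :
    Integrable fun x => φ x * u x := by
  obtain ⟨T, hT⟩ := hu.exists_represents
  exact (hT φ).1

lemma moderate_of_continuous {u : Plane → ℂ} (hu : Continuous u) {C : ℝ} {n : ℕ}
    (h : ∀ x, ‖u x‖ ≤ C * (1 + ‖x‖) ^ n) : Moderate u := by
  refine ⟨hu.aestronglyMeasurable, |C|, n + 1, fun x hx => ?_⟩
  have hx' : 0 < ‖x‖ := norm_pos_iff.2 hx
  rw [le_div_iff₀ hx', pow_succ, ← mul_assoc]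
  have h1 : ‖u x‖ ≤ |C| * (1 + ‖x‖) ^ n :=
    (h x).trans (by gcongr; exact le_abs_self C)
  gcongr
  linarith

/-! ### Translations -/

/-- Translation of a tempered distribution by `y`. -/
def shiftDist (y : Plane) (T : 𝓢'(Plane, ℂ)) : 𝓢'(Plane, ℂ) :=
  PointwiseConvergenceCLM.precomp ℂ (SchwartzMap.compSubConstCLM ℂ (-y)) T

lemma shiftDist_apply (y : Plane) (T : 𝓢'(Plane, ℂ)) (φ : 𝓢(Plane, ℂ)) :
    shiftDist y T φ = T (SchwartzMap.compSubConstCLM ℂ (-y) φ) := rfl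

lemma Represents.shift {T : 𝓢'(Plane, ℂ)} {u : Plane → ℂ} (hT : Represents T u) (y : Plane) :
    Represents (shiftDist y T) (fun x => u (x - y)) := by
  intro φ
  obtain ⟨h1, h2⟩ := hT (SchwartzMap.compSubConstCLM ℂ (-y) φ)
  have e : (fun x => SchwartzMap.compSubConstCLM ℂ (-y) φ x * u x) =
      fun x => (fun x => φ x * u (x - y)) (x + y) := by
    ext x; simp
  rw [e] at h1 h2
  refine ⟨?_, ?_⟩
  · simpa using h1.comp_sub_right y
  · rw [shiftDist_apply, h2, integral_add_right_eq_self (fun x => φ x * u (x - y)) y]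

lemma shiftDist_delta (y : Plane) :
    shiftDist y (TemperedDistribution.delta 0) = TemperedDistribution.delta y := by
  ext φ
  rw [shiftDist_apply, TemperedDistribution.delta_apply, TemperedDistribution.delta_apply,
    SchwartzMap.compSubConstCLM_apply]
  simp

lemma fourierInv_compSubConst (y : Plane) (φ : 𝓢(Plane, ℂ)) (ξ : Plane) :
    (𝓕⁻ (SchwartzMap.compSubConstCLM ℂ (-y) φ) : 𝓢(Plane, ℂ)) ξ =
      (𝐞 (-inner ℝ y ξ) : Circle) • (𝓕⁻ φ : 𝓢(Plane, ℂ)) ξ := by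
  rw [SchwartzMap.fourierInv_coe, SchwartzMap.fourierInv_coe, Real.fourierInv_eq,
    Real.fourierInv_eq, Circle.smul_def, ← integral_smul,
    ← integral_sub_right_eq_self (fun v => (𝐞 (inner ℝ v ξ) : Circle) •
      (SchwartzMap.compSubConstCLM ℂ (-y) φ) v) y]
  congr 1; ext v
  rw [SchwartzMap.compSubConstCLM_apply, ← Circle.smul_def, smul_smul,
    ← AddChar.map_add_eq_mul, inner_sub_left, sub_neg_eq_add, sub_add_cancel, neg_add_eq_sub]

lemma multiplier_shiftDist {g : Plane → ℂ} (hg : g.HasTemperateGrowth) (y : Plane)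
    (T : 𝓢'(Plane, ℂ)) :
    TemperedDistribution.fourierMultiplierCLM ℂ g (shiftDist y T) =
      shiftDist y (TemperedDistribution.fourierMultiplierCLM ℂ g T) := by
  ext φ
  rw [shiftDist_apply, TemperedDistribution.fourierMultiplierCLM_apply_apply,
    TemperedDistribution.fourierMultiplierCLM_apply_apply, shiftDist_apply]
  congr 1
  ext x
  rw [SchwartzMap.compSubConstCLM_apply, SchwartzMap.fourier_coe, SchwartzMap.fourier_coe,
    Real.fourier_eq, Real.fourier_eq]
  congr 1; ext ξ
  rw [SchwartzMap.smulLeftCLM_apply_apply hg, SchwartzMap.smulLeftCLM_apply_apply hg,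
    fourierInv_compSubConst, sub_neg_eq_add, inner_add_right, neg_add, AddChar.map_add_eq_mul,
    mul_smul, smul_comm (g ξ), real_inner_comm y ξ]

/-! ### Multiplication by a plane wave -/

/-- The plane wave `C exp(2πi⟨c, x⟩)`. -/
def planeWave (C : ℂ) (c x : Plane) : ℂ := C * (𝐞 (inner ℝ x c) : Circle)

lemma hasTemperateGrowth_planeWave (C : ℂ) (c : Plane) :
    (planeWave C c).HasTemperateGrowth := by
  have h1 : (fun t : ℝ => ((𝐞 t : Circle) : ℂ)).HasTemperateGrowth := by
    have hd : ∀ n : ℕ, iteratedDeriv n (fun t : ℝ => ((𝐞 t : Circle) : ℂ)) =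
        fun t => (2 * π * Complex.I) ^ n * ((𝐞 t : Circle) : ℂ) := by
      intro n
      induction n with
      | zero => simp
      | succ n ih =>
        ext t
        rw [iteratedDeriv_succ, ih, deriv_const_mul_field, Real.deriv_fourierChar]
        ring
    refine ⟨?_, fun n => ⟨0, (2 * π) ^ n, fun x => ?_⟩⟩
    · refine contDiff_of_differentiable_iteratedDeriv fun n _ => ?_
      rw [hd n]
      exact Real.differentiable_fourierChar.const_mul _
    · rw [norm_iteratedFDeriv_eq_norm_iteratedDeriv, hd n]
      rw [norm_mul, Circle.norm_coe]
      simp [abs_of_pos pi_pos]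
  have h2 : (fun x : Plane => inner ℝ x c).HasTemperateGrowth :=
    Function.hasTemperateGrowth_inner_left c
  exact (Function.HasTemperateGrowth.const C).mul (h1.comp h2)

/-- Modulation of `φ` translates its inverse Fourier transform by `c`. After the substitution `ξ ↦ ξ
+ c` the two phases `e^{±2πi⟨c, x⟩}` cancel. -/
lemma planeWave_mul_fourier_multiplier {g : Plane → ℂ} {c : Plane} (C : ℂ)
    (hg : g.HasTemperateGrowth) (hg' : (fun ξ => g (ξ + c)).HasTemperateGrowth)
    (φ : 𝓢(Plane, ℂ)) :
    SchwartzMap.smulLeftCLM ℂ (planeWave C c) (𝓕 (SchwartzMap.smulLeftCLM ℂ g (𝓕⁻ φ))) =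
      𝓕 (SchwartzMap.smulLeftCLM ℂ (fun ξ => g (ξ + c))
        (𝓕⁻ (SchwartzMap.smulLeftCLM ℂ (planeWave C c) φ))) := by
  have hw := hasTemperateGrowth_planeWave C c
  have h1 : ∀ ξ, (𝓕⁻ (SchwartzMap.smulLeftCLM ℂ (planeWave C c) φ) : 𝓢(Plane, ℂ)) ξ =
      C * (𝓕⁻ φ : 𝓢(Plane, ℂ)) (ξ + c) := by
    intro ξ
    rw [SchwartzMap.fourierInv_coe, SchwartzMap.fourierInv_coe, Real.fourierInv_eq,
      Real.fourierInv_eq, ← integral_const_mul]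
    congr 1; ext v
    rw [SchwartzMap.smulLeftCLM_apply_apply hw, planeWave, inner_add_right, AddChar.map_add_eq_mul]
    simp only [Circle.smul_def, smul_eq_mul, Circle.coe_mul]
    ring
  ext x
  rw [SchwartzMap.smulLeftCLM_apply_apply hw, SchwartzMap.fourier_coe, SchwartzMap.fourier_coe,
    Real.fourier_eq, Real.fourier_eq, smul_eq_mul, ← integral_const_mul]
  rw [← integral_add_right_eq_self _ c]
  congr 1; ext ξ
  rw [SchwartzMap.smulLeftCLM_apply_apply hg, SchwartzMap.smulLeftCLM_apply_apply hg', h1,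
    planeWave, inner_add_left, neg_add, AddChar.map_add_eq_mul, real_inner_comm c x]
  have : ((𝐞 (inner ℝ c x) : Circle) : ℂ) * ((𝐞 (-inner ℝ c x) : Circle) : ℂ) = 1 := by
    rw [← Circle.coe_mul, ← AddChar.map_add_eq_mul, add_neg_cancel, AddChar.map_zero_eq_one,
      Circle.coe_one]
  simp only [Circle.smul_def, smul_eq_mul, Circle.coe_mul]
  linear_combination C * ((𝐞 (-inner ℝ ξ x) : Circle) : ℂ) * g (ξ + c) *
    (𝓕⁻ φ : 𝓢(Plane, ℂ)) (ξ + c) * this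

/-- A Fourier multiplier conjugated with a plane wave is the multiplier with shifted symbol. -/
lemma multiplier_planeWave {g : Plane → ℂ} {c : Plane} (C : ℂ)
    (hg : g.HasTemperateGrowth) (hg' : (fun ξ => g (ξ + c)).HasTemperateGrowth)
    (T : 𝓢'(Plane, ℂ)) :
    TemperedDistribution.fourierMultiplierCLM ℂ g
      (TemperedDistribution.smulLeftCLM ℂ (planeWave C c) T) =
    TemperedDistribution.smulLeftCLM ℂ (planeWave C c)
      (TemperedDistribution.fourierMultiplierCLM ℂ (fun ξ => g (ξ + c)) T) := by
  ext φ
  rw [TemperedDistribution.fourierMultiplierCLM_apply_apply,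
    TemperedDistribution.smulLeftCLM_apply_apply, TemperedDistribution.smulLeftCLM_apply_apply,
    TemperedDistribution.fourierMultiplierCLM_apply_apply,
    planeWave_mul_fourier_multiplier C hg hg']

lemma smulLeft_delta {f : Plane → ℂ} (hf : f.HasTemperateGrowth) (y : Plane) :
    TemperedDistribution.smulLeftCLM ℂ f (TemperedDistribution.delta y) =
      f y • TemperedDistribution.delta y := by
  ext φ
  rw [TemperedDistribution.smulLeftCLM_apply_apply, TemperedDistribution.delta_apply,
    SchwartzMap.smulLeftCLM_apply_apply hf]
  rfl

end Sigma2D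

end

noncomputable section

namespace Sigma2D

open Laplacian

/-! ### The Laplacian of radial functions in the sense of distributions -/

lemma moderate_of_shifted_bound {u : Plane → ℂ} (hu : Continuous u) {C ε : ℝ} {n : ℕ} (hε : 0 ≤ ε)
    (h : ∀ x, ‖u x‖ ≤ C * (1 + ‖x‖) * (1 + (‖x‖ ^ 2 + ε)) ^ n) : Moderate u := by
  refine moderate_of_continuous hu (C := |C| * (1 + ε) ^ n) (n := 1 + 2 * n) fun x => ?_
  have h1 : 1 + (‖x‖ ^ 2 + ε) ≤ (1 + ε) * (1 + ‖x‖) ^ 2 := by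
    nlinarith [norm_nonneg x, mul_nonneg hε (norm_nonneg x), mul_nonneg hε (sq_nonneg ‖x‖)]
  calc ‖u x‖ ≤ C * (1 + ‖x‖) * (1 + (‖x‖ ^ 2 + ε)) ^ n := h x
    _ ≤ |C| * (1 + ‖x‖) * ((1 + ε) * (1 + ‖x‖) ^ 2) ^ n := by
        gcongr
        exact le_abs_self C
    _ = _ := by rw [mul_pow, ← pow_mul]; ring

lemma hasFDerivAt_radial {f : ℝ → ℝ} {f' ε : ℝ} {x : Plane} (hf : HasDerivAt f f' (‖x‖ ^ 2 + ε)) :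
    HasFDerivAt (fun x : Plane => f (‖x‖ ^ 2 + ε)) (f' • (2 • innerSL ℝ x)) x := by
  have h1 : HasFDerivAt (fun x : Plane => ‖x‖ ^ 2 + ε) (2 • innerSL ℝ x) x :=
    (hasStrictFDerivAt_norm_sq x).hasFDerivAt.add_const ε
  exact hf.comp_hasFDerivAt x h1

lemma hasFDerivAt_coord_mul_radial {f : ℝ → ℝ} {f' ε : ℝ} {x : Plane} (i : Fin 2)
    (hf : HasDerivAt f f' (‖x‖ ^ 2 + ε)) :
    HasFDerivAt (fun x : Plane => 2 * x i * f (‖x‖ ^ 2 + ε))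
      ((2 * x i) • (f' • (2 • innerSL ℝ x)) +
        f (‖x‖ ^ 2 + ε) • ((2 : ℝ) • EuclideanSpace.proj i)) x := by
  have h1 : HasFDerivAt (fun x : Plane => 2 * x i)
      ((2 : ℝ) • (EuclideanSpace.proj i : Plane →L[ℝ] ℝ)) x :=
    ((EuclideanSpace.proj i : Plane →L[ℝ] ℝ).hasFDerivAt).const_mul 2
  exact h1.mul (hasFDerivAt_radial hf)

lemma integral_mul_lineDeriv {u u' : Plane → ℂ} {v : Plane} (hu : Differentiable ℝ u)
    (hu' : ∀ x, fderiv ℝ u x v = u' x) (m : Moderate u) (m' : Moderate u') (φ : 𝓢(Plane, ℂ)) :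
    ∫ x, u x * (∂_{v} φ : 𝓢(Plane, ℂ)) x = -∫ x, u' x * φ x := by
  have h := integral_mul_fderiv_eq_neg_fderiv_mul_of_integrable (μ := (volume : Measure Plane))
    (f := u) (g := φ) (v := v) ?_ ?_ ?_ (fun x _ => hu x) (fun x _ => φ.differentiableAt)
  · simp only [hu'] at h
    exact h
  · simp only [hu']
    exact (m'.integrable_mul φ).congr (ae_of_all _ fun x => mul_comm _ _)
  · exact (m.integrable_mul (∂_{v} φ)).congr (ae_of_all _ fun x => mul_comm _ _)
  · exact (m.integrable_mul φ).congr (ae_of_all _ fun x => mul_comm _ _)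

lemma abs_coord_le (x : Plane) (i : Fin 2) : |x i| ≤ ‖x‖ := PiLp.norm_apply_le x i

lemma continuous_coord (i : Fin 2) : Continuous fun x : Plane => x i :=
  (EuclideanSpace.proj i : Plane →L[ℝ] ℝ).continuous

lemma laplacian_eq (φ : 𝓢(Plane, ℂ)) :
    Δ φ = ∑ i : Fin 2, (∂_{(EuclideanSpace.single i (1 : ℝ) : Plane)}
      (∂_{(EuclideanSpace.single i (1 : ℝ) : Plane)} φ) : 𝓢(Plane, ℂ)) := by
  rw [SchwartzMap.laplacian_eq_sum (EuclideanSpace.basisFun (Fin 2) ℝ)]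
  simp

/-- The data of a twice differentiable function of `t = |x|²` with controlled growth. -/
structure RadialData (g g₁ g₂ : ℝ → ℝ) (C : ℝ) (n : ℕ) : Prop where
  deriv : ∀ t > 0, HasDerivAt g (g₁ t) t
  deriv' : ∀ t > 0, HasDerivAt g₁ (g₂ t) t
  cont : ContinuousOn g₂ (Set.Ioi 0)
  bound : ∀ t > 0, |g t| ≤ C * (1 + t) ^ n / √t
  bound₁ : ∀ t > 0, |t * g₁ t| ≤ C * (1 + t) ^ n
  bound₂ : ∀ t > 0, |t ^ 2 * g₂ t| ≤ C * (1 + t) ^ n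
  boundLap : ∀ t > 0, |4 * (t * g₂ t + g₁ t)| ≤ C * (1 + t) ^ n / √t

namespace RadialData

variable {g g₁ g₂ : ℝ → ℝ} {C : ℝ} {n : ℕ}

lemma continuousOn (h : RadialData g g₁ g₂ C n) : ContinuousOn g (Set.Ioi 0) :=
  fun t ht => (h.deriv t ht).continuousAt.continuousWithinAt

lemma continuousOn₁ (h : RadialData g g₁ g₂ C n) : ContinuousOn g₁ (Set.Ioi 0) :=
  fun t ht => (h.deriv' t ht).continuousAt.continuousWithinAt

lemma continuousOnLap (h : RadialData g g₁ g₂ C n) :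
    ContinuousOn (fun t => 4 * (t * g₂ t + g₁ t)) (Set.Ioi 0) :=
  continuousOn_const.mul ((continuousOn_id.mul h.cont).add h.continuousOn₁)

lemma const_nonneg (h : RadialData g g₁ g₂ C n) : 0 ≤ C := by
  have := (abs_nonneg _).trans (h.bound₁ 1 one_pos)
  exact nonneg_of_mul_nonneg_left this (by positivity)

end RadialData

lemma continuous_comp_shift {f : ℝ → ℝ} (hf : ContinuousOn f (Set.Ioi 0)) {ε : ℝ} (hε : 0 < ε) :
    Continuous fun x : Plane => f (‖x‖ ^ 2 + ε) :=
  hf.comp_continuous (by fun_prop) fun x => by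
    show 0 < ‖x‖ ^ 2 + ε
    positivity

lemma moderate_of_radial {f : ℝ → ℝ} (hf : ContinuousOn f (Set.Ioi 0)) {C : ℝ} {n : ℕ}
    (hb : ∀ t > 0, |f t| ≤ C * (1 + t) ^ n / √t) :
    Moderate fun x : Plane => (f (‖x‖ ^ 2) : ℂ) := by
  refine ⟨?_, |C|, 2 * n, fun x hx => ?_⟩
  · have hc : ContinuousOn (fun x : Plane => (f (‖x‖ ^ 2) : ℂ)) {0}ᶜ := by
      refine Complex.continuous_ofReal.comp_continuousOn
        (hf.comp (by fun_prop) fun x hx => ?_)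
      have : 0 < ‖x‖ := norm_pos_iff.2 hx
      show 0 < ‖x‖ ^ 2
      positivity
    have := hc.aestronglyMeasurable (μ := volume) (measurableSet_singleton (0 : Plane)).compl
    have e : (volume : Measure Plane).restrict {0}ᶜ = volume :=
      Measure.restrict_eq_self_of_ae_mem (ae_ne_point 0)
    rwa [e] at this
  · have hx' : 0 < ‖x‖ := norm_pos_iff.2 hx
    rw [Complex.norm_real, Real.norm_eq_abs]
    refine (hb (‖x‖ ^ 2) (by positivity)).trans ?_
    rw [Real.sqrt_sq hx'.le, pow_mul]
    gcongr
    · exact le_abs_self C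
    · nlinarith

/-- The shift by `ε > 0` keeps the argument of `g` away from `0`, so the function is twice
differentiable on the whole plane. Integration by parts against a Schwartz function then leaves no
boundary term. -/
lemma integral_laplacian_shift {g g₁ g₂ : ℝ → ℝ} {C : ℝ} {n : ℕ} (h : RadialData g g₁ g₂ C n)
    {ε : ℝ} (hε : 0 < ε) (φ : 𝓢(Plane, ℂ)) :
    ∫ x, (g (‖x‖ ^ 2 + ε) : ℂ) * (Δ φ : 𝓢(Plane, ℂ)) x =
      ∫ x, ((4 * (‖x‖ ^ 2 * g₂ (‖x‖ ^ 2 + ε) + g₁ (‖x‖ ^ 2 + ε)) : ℝ) : ℂ) * φ x := by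
  have hC := h.const_nonneg
  have hpos : ∀ x : Plane, 0 < ‖x‖ ^ 2 + ε := fun x => by positivity
  set e : Fin 2 → Plane := fun i => EuclideanSpace.single i (1 : ℝ) with he
  have hin : ∀ (x : Plane) i, inner ℝ x (e i) = x i := fun x i => by
    simp [he, EuclideanSpace.inner_single_right]
  set u : Plane → ℂ := fun x => ((g (‖x‖ ^ 2 + ε) : ℝ) : ℂ) with hu
  set v : Fin 2 → Plane → ℂ := fun i x => ((2 * x i * g₁ (‖x‖ ^ 2 + ε) : ℝ) : ℂ) with hv
  set w : Fin 2 → Plane → ℂ := fun i x =>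
    ((2 * g₁ (‖x‖ ^ 2 + ε) + 4 * x i ^ 2 * g₂ (‖x‖ ^ 2 + ε) : ℝ) : ℂ) with hw
  have hdu : ∀ x, HasFDerivAt u (Complex.ofRealCLM.comp
      (g₁ (‖x‖ ^ 2 + ε) • (2 • innerSL ℝ x))) x := fun x =>
    Complex.ofRealCLM.hasFDerivAt.comp x (hasFDerivAt_radial (h.deriv _ (hpos x)))
  have hdv : ∀ i x, HasFDerivAt (v i) (Complex.ofRealCLM.comp
      ((2 * x i) • (g₂ (‖x‖ ^ 2 + ε) • (2 • innerSL ℝ x)) +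
        g₁ (‖x‖ ^ 2 + ε) • ((2 : ℝ) • EuclideanSpace.proj i))) x := fun i x =>
    Complex.ofRealCLM.hasFDerivAt.comp x (hasFDerivAt_coord_mul_radial i (h.deriv' _ (hpos x)))
  have hu' : ∀ i x, fderiv ℝ u x (e i) = v i x := by
    intro i x
    rw [(hdu x).fderiv]
    simp [hv, hin]
    ring
  have hv' : ∀ i x, fderiv ℝ (v i) x (e i) = w i x := by
    intro i x
    rw [(hdv i x).fderiv]
    simp [hw, hin]
    simp [he]
    ring
  -- With `t ≥ ε` the singular factors in the growth bounds become constants depending on `ε`.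
  have b0 : ∀ x : Plane, |g (‖x‖ ^ 2 + ε)| ≤ C * (1 + (‖x‖ ^ 2 + ε)) ^ n / √ε := fun x =>
    (h.bound _ (hpos x)).trans (by gcongr; nlinarith [sq_nonneg ‖x‖])
  have b1 : ∀ x : Plane, |g₁ (‖x‖ ^ 2 + ε)| ≤ C * (1 + (‖x‖ ^ 2 + ε)) ^ n / ε := fun x => by
    have := h.bound₁ _ (hpos x)
    rw [abs_mul, abs_of_pos (hpos x)] at this
    rw [le_div_iff₀ hε, mul_comm]
    refine le_trans ?_ this
    gcongr
    nlinarith [sq_nonneg ‖x‖]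
  -- Both `x i ^ 2` and `ε` are at most `t = ‖x‖² + ε`, so their product is at most `t²`, which the
  -- bound on `t² g₂` controls.
  have b2 : ∀ (x : Plane) i, |x i ^ 2 * g₂ (‖x‖ ^ 2 + ε)| ≤ C * (1 + (‖x‖ ^ 2 + ε)) ^ n / ε := by
    intro x i
    have := h.bound₂ _ (hpos x)
    rw [abs_mul, abs_of_pos (by have := hpos x; positivity)] at this
    rw [le_div_iff₀ hε, abs_mul, abs_of_nonneg (sq_nonneg _)]
    refine le_trans ?_ this
    have hx : x i ^ 2 ≤ ‖x‖ ^ 2 := by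
      rw [← sq_abs (x i)]; gcongr; exact abs_coord_le x i
    have : x i ^ 2 * ε ≤ (‖x‖ ^ 2 + ε) ^ 2 := by nlinarith [sq_nonneg ‖x‖, sq_nonneg (x i)]
    calc x i ^ 2 * |g₂ (‖x‖ ^ 2 + ε)| * ε = (x i ^ 2 * ε) * |g₂ (‖x‖ ^ 2 + ε)| := by ring
      _ ≤ _ := by gcongr
  have mu : Moderate u := by
    refine moderate_of_shifted_bound (C := C / √ε) (n := n)
      (Complex.continuous_ofReal.comp (continuous_comp_shift h.continuousOn hε)) hε.le fun x => ?_
    rw [hu, Complex.norm_real, Real.norm_eq_abs]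
    refine (b0 x).trans ?_
    rw [div_mul_eq_mul_div, div_mul_eq_mul_div]
    gcongr
    nlinarith [norm_nonneg x]
  have mv : ∀ i, Moderate (v i) := by
    intro i
    have hc := continuous_comp_shift h.continuousOn₁ hε
    refine moderate_of_shifted_bound (C := 2 * (C / ε)) (n := n)
      (Complex.continuous_ofReal.comp ((continuous_const.mul (continuous_coord i)).mul hc))
      hε.le fun x => ?_
    rw [hv, Complex.norm_real, Real.norm_eq_abs, abs_mul, abs_mul, abs_two]
    have := abs_coord_le x i
    calc 2 * |x i| * |g₁ (‖x‖ ^ 2 + ε)|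
        ≤ 2 * (1 + ‖x‖) * (C * (1 + (‖x‖ ^ 2 + ε)) ^ n / ε) := by
          gcongr
          · linarith
          · exact b1 x
      _ = _ := by ring
  have mw : ∀ i, Moderate (w i) := by
    intro i
    have hc := continuous_comp_shift h.continuousOn₁ hε
    have hc2 := continuous_comp_shift h.cont hε
    refine moderate_of_shifted_bound (C := 6 * (C / ε)) (n := n)
      (Complex.continuous_ofReal.comp ((continuous_const.mul hc).add
        ((continuous_const.mul ((continuous_coord i).pow 2)).mul hc2))) hε.le fun x => ?_
    rw [hw, Complex.norm_real, Real.norm_eq_abs]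
    calc |2 * g₁ (‖x‖ ^ 2 + ε) + 4 * x i ^ 2 * g₂ (‖x‖ ^ 2 + ε)|
        ≤ |2 * g₁ (‖x‖ ^ 2 + ε)| + |4 * x i ^ 2 * g₂ (‖x‖ ^ 2 + ε)| := abs_add_le _ _
      _ = 2 * |g₁ (‖x‖ ^ 2 + ε)| + 4 * |x i ^ 2 * g₂ (‖x‖ ^ 2 + ε)| := by
          rw [mul_assoc 4, abs_mul, abs_mul 4, abs_two, abs_of_pos (by norm_num : (0 : ℝ) < 4)]
      _ ≤ 2 * (C * (1 + (‖x‖ ^ 2 + ε)) ^ n / ε) + 4 * (C * (1 + (‖x‖ ^ 2 + ε)) ^ n / ε) := by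
          gcongr
          · exact b1 x
          · exact b2 x i
      _ = 6 * (C / ε) * 1 * (1 + (‖x‖ ^ 2 + ε)) ^ n := by ring
      _ ≤ _ := by
          gcongr
          linarith [norm_nonneg x]
  have step : ∀ i, ∫ x, u x * (∂_{e i} (∂_{e i} φ) : 𝓢(Plane, ℂ)) x = ∫ x, w i x * φ x := by
    intro i
    rw [integral_mul_lineDeriv (fun x => (hdu x).differentiableAt) (hu' i) mu (mv i),
      integral_mul_lineDeriv (fun x => (hdv i x).differentiableAt) (hv' i) (mv i) (mw i), neg_neg]
  calc ∫ x, u x * (Δ φ : 𝓢(Plane, ℂ)) x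
      = ∑ i, ∫ x, u x * (∂_{e i} (∂_{e i} φ) : 𝓢(Plane, ℂ)) x := by
        rw [laplacian_eq, ← integral_finsetSum _ fun i _ =>
          (mu.integrable_mul _).congr (ae_of_all _ fun x => mul_comm _ _)]
        congr 1; ext x
        rw [Fin.sum_univ_two, Fin.sum_univ_two, ← mul_add]; rfl
    _ = ∑ i, ∫ x, w i x * φ x := Finset.sum_congr rfl fun i _ => step i
    _ = _ := by
        rw [← integral_finsetSum _ fun i _ =>
          ((mw i).integrable_mul _).congr (ae_of_all _ fun x => mul_comm _ _)]
        congr 1; ext x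
        have hn : ‖x‖ ^ 2 = x 0 ^ 2 + x 1 ^ 2 := by
          rw [EuclideanSpace.norm_sq_eq, Fin.sum_univ_two, Real.norm_eq_abs, Real.norm_eq_abs,
            sq_abs, sq_abs]
        rw [Fin.sum_univ_two, ← add_mul, ← Complex.ofReal_add]
        congr 2
        linear_combination -4 * g₂ (‖x‖ ^ 2 + ε) * hn

/-- This is the total mass of the profile that concentrates at the origin in
`tendsto_concentrating_integral`. -/
lemma integral_inv_one_add_sq_sq : ∫ x : Plane, (1 + ‖x‖ ^ 2 : ℝ)⁻¹ ^ 2 = π := by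
  rw [integral_fun_norm_addHaar volume (fun r : ℝ => (1 + r ^ 2)⁻¹ ^ 2)]
  have h0 : Module.finrank ℝ Plane = 2 := by simp
  have hd : ∀ r ∈ Set.Ici (0 : ℝ), HasDerivAt (fun r : ℝ => -(1 / 2) * (1 + r ^ 2)⁻¹)
      (r ^ (2 - 1) • (1 + r ^ 2)⁻¹ ^ 2) r := by
    intro r _
    have h1 : (1 + r ^ 2 : ℝ) ≠ 0 := by positivity
    refine ((((hasDerivAt_pow 2 r).const_add 1).inv h1).const_mul (-(1 / 2))).congr_deriv ?_
    simp only [smul_eq_mul]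
    push_cast
    field_simp
  have hlim : Tendsto (fun r : ℝ => -(1 / 2) * (1 + r ^ 2)⁻¹) atTop (𝓝 0) := by
    have : Tendsto (fun r : ℝ => 1 + r ^ 2) atTop atTop :=
      tendsto_atTop_add_const_left _ _ (tendsto_pow_atTop two_ne_zero)
    have h := this.inv_tendsto_atTop.const_mul (-(1 / 2))
    rw [mul_zero] at h
    exact h
  have h1 := integral_Ioi_of_hasDerivAt_of_nonneg' hd (fun r hr => by
    have : (0 : ℝ) < r := hr
    positivity) hlim
  rw [h0, h1, Measure.real, EuclideanSpace.volume_ball_fin_two]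
  simp [pi_pos.le]
  ring

/-- A function that is not integrable has integral `0` by convention, and the integral is `π`. -/
lemma integrable_inv_one_add_sq_sq : Integrable fun x : Plane => (1 + ‖x‖ ^ 2 : ℝ)⁻¹ ^ 2 := by
  by_contra h
  have := integral_inv_one_add_sq_sq
  rw [integral_undef h] at this
  exact pi_pos.ne this

lemma exists_bound_schwartz (φ : 𝓢(Plane, ℂ)) (n : ℕ) :
    ∃ K, ∀ x, (2 + ‖x‖ ^ 2) ^ n * ‖φ x‖ ≤ K := by
  set ψ := SchwartzMap.smulLeftCLM ℂ (fun x : Plane => (((1 + ‖x‖ ^ 2) ^ n : ℝ) : ℂ)) φ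
  refine ⟨2 ^ n * SchwartzMap.seminorm ℝ 0 0 ψ, fun x => ?_⟩
  have h := ψ.norm_le_seminorm ℝ x
  rw [SchwartzMap.smulLeftCLM_apply_apply (hasTemperateGrowth_one_add_sq_pow n), norm_smul,
    Complex.norm_real, Real.norm_of_nonneg (by positivity)] at h
  calc (2 + ‖x‖ ^ 2) ^ n * ‖φ x‖ ≤ (2 * (1 + ‖x‖ ^ 2)) ^ n * ‖φ x‖ := by
        gcongr; nlinarith [sq_nonneg ‖x‖]
    _ = 2 ^ n * ((1 + ‖x‖ ^ 2) ^ n * ‖φ x‖) := by rw [mul_pow]; ring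
    _ ≤ _ := by gcongr

/-- Dominated convergence: `‖x‖ ≤ √(‖x‖² + ε)` makes the bound by a multiple of `1 / ‖x‖` uniform in
`ε < 1`, and this singularity is integrable in the plane. -/
lemma tendsto_shift_integral {f : ℝ → ℝ} (hf : ContinuousOn f (Set.Ioi 0)) {C : ℝ} {n : ℕ}
    (hC : 0 ≤ C) (hb : ∀ t > 0, |f t| ≤ C * (1 + t) ^ n / √t) (φ : 𝓢(Plane, ℂ)) :
    Tendsto (fun ε : ℝ => ∫ x, (f (‖x‖ ^ 2 + ε) : ℂ) * φ x) (𝓝[>] 0)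
      (𝓝 (∫ x, (f (‖x‖ ^ 2) : ℂ) * φ x)) := by
  have hm : Moderate fun x : Plane => ((C * (2 + ‖x‖ ^ 2) ^ n / ‖x‖ : ℝ) : ℂ) := by
    refine ⟨(Complex.measurable_ofReal.comp (by fun_prop)).aestronglyMeasurable, C * 2 ^ n, 2 * n,
      fun x hx => ?_⟩
    rw [Complex.norm_real, Real.norm_of_nonneg (by positivity), pow_mul, mul_assoc, ← mul_pow]
    gcongr
    nlinarith [norm_nonneg x]
  refine tendsto_integral_filter_of_dominated_convergence
    (fun x => ‖φ x * ((C * (2 + ‖x‖ ^ 2) ^ n / ‖x‖ : ℝ) : ℂ)‖) ?_ ?_ (hm.integrable_mul φ).norm ?_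
  · filter_upwards [self_mem_nhdsWithin] with ε hε
    exact ((Complex.continuous_ofReal.comp (continuous_comp_shift hf hε)).mul
      φ.continuous).aestronglyMeasurable
  · filter_upwards [self_mem_nhdsWithin, Ioo_mem_nhdsGT one_pos] with ε hε hε1
    filter_upwards [ae_ne_point 0] with x hx
    have hx' : 0 < ‖x‖ := norm_pos_iff.2 hx
    have hε' : 0 < ε := hε
    rw [norm_mul, norm_mul, mul_comm, Complex.norm_real, Complex.norm_real,
      Real.norm_of_nonneg (r := C * _ / _) (by positivity), Real.norm_eq_abs]
    gcongr
    refine (hb _ (by positivity)).trans ?_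
    have h1 : ‖x‖ ≤ √(‖x‖ ^ 2 + ε) := by
      apply Real.le_sqrt_of_sq_le; linarith
    gcongr C * ?_ ^ n / ?_
    linarith [hε1.2]
  · filter_upwards [ae_ne_point 0] with x hx
    have hx' : 0 < ‖x‖ := norm_pos_iff.2 hx
    have hc : ContinuousAt f (‖x‖ ^ 2) := hf.continuousAt (Ioi_mem_nhds (by positivity))
    have ht : Tendsto (fun ε : ℝ => ‖x‖ ^ 2 + ε) (𝓝[>] 0) (𝓝 (‖x‖ ^ 2)) := by
      have : Tendsto (fun ε : ℝ => ‖x‖ ^ 2 + ε) (𝓝 0) (𝓝 (‖x‖ ^ 2 + 0)) :=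
        tendsto_const_nhds.add tendsto_id
      rw [add_zero] at this
      exact this.mono_left nhdsWithin_le_nhds
    exact ((Complex.continuous_ofReal.tendsto _).comp (hc.tendsto.comp ht)).mul_const _

/-- Under `x = √ε y` the weight becomes `4 t² f(t) (1 + |y|²)⁻²` at `t = ε (1 + |y|²)`. It tends to
`(c/π)(1 + |y|²)⁻²`, a profile of mass `c`, while `φ (√ε y)` tends to `φ 0`. -/
lemma tendsto_concentrating_integral {f : ℝ → ℝ} (hf : ContinuousOn f (Set.Ioi 0)) {C c : ℝ}
    {n : ℕ} (hC : 0 ≤ C) (hb : ∀ t > 0, |t ^ 2 * f t| ≤ C * (1 + t) ^ n)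
    (hlim : Tendsto (fun t => t ^ 2 * f t) (𝓝[>] 0) (𝓝 (c / (4 * π)))) (φ : 𝓢(Plane, ℂ)) :
    Tendsto (fun ε : ℝ => ∫ x, ((4 * ε * f (‖x‖ ^ 2 + ε) : ℝ) : ℂ) * φ x) (𝓝[>] 0)
      (𝓝 (c * φ 0)) := by
  obtain ⟨K, hK⟩ := exists_bound_schwartz φ n
  have hscale : ∀ ε > 0, ∫ x, ((4 * ε * f (‖x‖ ^ 2 + ε) : ℝ) : ℂ) * φ x =
      ∫ y, ((4 * ((ε * (1 + ‖y‖ ^ 2)) ^ 2 * f (ε * (1 + ‖y‖ ^ 2))) *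
        (1 + ‖y‖ ^ 2 : ℝ)⁻¹ ^ 2 : ℝ) : ℂ) * φ (√ε • y) := by
    intro ε hε
    have h := Measure.integral_comp_smul (volume : Measure Plane)
      (fun x => ((4 * ε * f (‖x‖ ^ 2 + ε) : ℝ) : ℂ) * φ x) (√ε)
    have h0 : Module.finrank ℝ Plane = 2 := by simp
    rw [h0, Real.sq_sqrt hε.le, abs_of_pos (inv_pos.2 hε)] at h
    rw [← one_smul ℝ (∫ x, ((4 * ε * f (‖x‖ ^ 2 + ε) : ℝ) : ℂ) * φ x), ← mul_inv_cancel₀ hε.ne',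
      mul_smul, ← h, ← integral_smul]
    congr 1; ext y
    have e1 : ‖√ε • y‖ ^ 2 + ε = ε * (1 + ‖y‖ ^ 2) := by
      rw [norm_smul, mul_pow, Real.norm_eq_abs, sq_abs, Real.sq_sqrt hε.le]; ring
    rw [e1, Complex.real_smul, ← mul_assoc, ← Complex.ofReal_mul]
    congr 2
    have : (1 + ‖y‖ ^ 2 : ℝ) ≠ 0 := by positivity
    field_simp
  have hval : (c * φ 0 : ℂ) = ∫ y : Plane, ((4 * (c / (4 * π)) *
      (1 + ‖y‖ ^ 2 : ℝ)⁻¹ ^ 2 : ℝ) : ℂ) * φ 0 := by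
    rw [integral_mul_const, integral_complex_ofReal, integral_const_mul, integral_inv_one_add_sq_sq]
    congr 2
    have := pi_pos.ne'
    field_simp
  rw [hval]
  refine Tendsto.congr' (f₁ := fun ε : ℝ => ∫ y, ((4 * ((ε * (1 + ‖y‖ ^ 2)) ^ 2 *
    f (ε * (1 + ‖y‖ ^ 2))) * (1 + ‖y‖ ^ 2 : ℝ)⁻¹ ^ 2 : ℝ) : ℂ) * φ (√ε • y)) ?_ ?_
  · filter_upwards [self_mem_nhdsWithin] with ε hε using (hscale ε hε).symm
  refine tendsto_integral_filter_of_dominated_convergence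
    (fun y => 4 * C * K * (1 + ‖y‖ ^ 2 : ℝ)⁻¹ ^ 2) ?_ ?_
    (integrable_inv_one_add_sq_sq.const_mul _) ?_
  · filter_upwards [self_mem_nhdsWithin] with ε hε
    have hε' : 0 < ε := hε
    have h1 : Continuous fun y : Plane => f (ε * (1 + ‖y‖ ^ 2)) :=
      hf.comp_continuous (by fun_prop) fun x => by
        show 0 < ε * (1 + ‖x‖ ^ 2)
        positivity
    have h2 : Continuous fun y : Plane => (1 + ‖y‖ ^ 2 : ℝ)⁻¹ :=
      Continuous.inv₀ (by fun_prop) fun x => by positivity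
    have h3 : Continuous fun y : Plane => φ (√ε • y) := φ.continuous.comp (by fun_prop)
    have h4 : Continuous fun y : Plane => (ε * (1 + ‖y‖ ^ 2)) ^ 2 := by fun_prop
    exact ((Complex.continuous_ofReal.comp ((continuous_const.mul (h4.mul h1)).mul
      (h2.pow 2))).mul h3).aestronglyMeasurable
  · filter_upwards [self_mem_nhdsWithin, Ioo_mem_nhdsGT one_pos] with ε hε hε1
    refine ae_of_all _ fun y => ?_
    have hε' : 0 < ε := hε
    have h1 := hb (ε * (1 + ‖y‖ ^ 2)) (by positivity)
    have h2 := hK (√ε • y)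
    rw [norm_smul, mul_pow, Real.norm_eq_abs, sq_abs, Real.sq_sqrt hε'.le] at h2
    rw [norm_mul, Complex.norm_real, norm_mul, norm_mul, Real.norm_eq_abs (_ * f _),
      Real.norm_of_nonneg (r := _ ^ 2) (by positivity), Real.norm_of_nonneg (r := 4) (by norm_num)]
    calc 4 * |(ε * (1 + ‖y‖ ^ 2)) ^ 2 * f (ε * (1 + ‖y‖ ^ 2))| * (1 + ‖y‖ ^ 2)⁻¹ ^ 2 * ‖φ (√ε • y)‖
        ≤ 4 * (C * (2 + ε * ‖y‖ ^ 2) ^ n) * (1 + ‖y‖ ^ 2)⁻¹ ^ 2 * ‖φ (√ε • y)‖ := by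
          gcongr
          refine h1.trans (mul_le_mul_of_nonneg_left (pow_le_pow_left₀ (by positivity) ?_ _) hC)
          linarith [hε1.2]
      _ = 4 * C * ((2 + ε * ‖y‖ ^ 2) ^ n * ‖φ (√ε • y)‖) * (1 + ‖y‖ ^ 2)⁻¹ ^ 2 := by ring
      _ ≤ _ := by gcongr
  · refine ae_of_all _ fun y => ?_
    have ht : Tendsto (fun ε : ℝ => ε * (1 + ‖y‖ ^ 2)) (𝓝[>] 0) (𝓝[>] 0) := by
      refine tendsto_nhdsWithin_iff.2 ⟨?_, ?_⟩
      · have : Tendsto (fun ε : ℝ => ε * (1 + ‖y‖ ^ 2)) (𝓝 0) (𝓝 (0 * (1 + ‖y‖ ^ 2))) :=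
          tendsto_id.mul_const _
        rw [zero_mul] at this
        exact this.mono_left nhdsWithin_le_nhds
      · filter_upwards [self_mem_nhdsWithin] with ε hε
        have hε' : 0 < ε := hε
        show 0 < ε * (1 + ‖y‖ ^ 2)
        positivity
    have hφ : Tendsto (fun ε : ℝ => φ (√ε • y)) (𝓝[>] 0) (𝓝 (φ 0)) := by
      have h1 : Continuous fun ε : ℝ => φ (√ε • y) := φ.continuous.comp (by fun_prop)
      have h2 := h1.tendsto 0
      rw [Real.sqrt_zero, zero_smul] at h2
      exact h2.mono_left nhdsWithin_le_nhds
    exact ((Complex.continuous_ofReal.tendsto _).comp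
      (((hlim.comp ht).const_mul 4).mul_const _)).mul hφ

/-- The distributional Laplacian of a radial function with a logarithmic singularity. -/
lemma integral_laplacian_radial {g g₁ g₂ : ℝ → ℝ} {C c : ℝ} {n : ℕ} (h : RadialData g g₁ g₂ C n)
    (hlim : Tendsto (fun t => t ^ 2 * g₂ t) (𝓝[>] 0) (𝓝 (c / (4 * π)))) (φ : 𝓢(Plane, ℂ)) :
    ∫ x, (g (‖x‖ ^ 2) : ℂ) * (Δ φ : 𝓢(Plane, ℂ)) x =
      (∫ x, ((4 * (‖x‖ ^ 2 * g₂ (‖x‖ ^ 2) + g₁ (‖x‖ ^ 2)) : ℝ) : ℂ) * φ x) - c * φ 0 := by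
  have hC := h.const_nonneg
  have h1 := tendsto_shift_integral h.continuousOn hC h.bound (Δ φ)
  have h2 := tendsto_shift_integral h.continuousOnLap hC h.boundLap φ
  have h3 := tendsto_concentrating_integral h.cont hC h.bound₂ hlim φ
  -- With `t = ‖x‖² + ε` one has `‖x‖² g₂(t) = t g₂(t) - ε g₂(t)`. The first part together with `g₁`
  -- converges to the pointwise Laplacian, and the second concentrates at the origin.
  refine tendsto_nhds_unique h1 ((h2.sub h3).congr' ?_)
  filter_upwards [self_mem_nhdsWithin] with ε hε
  have hε' : 0 < ε := hε
  rw [integral_laplacian_shift h hε', ← integral_sub]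
  · congr 1; ext x
    rw [← sub_mul, ← Complex.ofReal_sub]
    congr 2
    ring
  · have hc := (Complex.continuous_ofReal.comp (continuous_comp_shift h.continuousOnLap hε'))
    refine ((moderate_of_shifted_bound (C := C / √ε) (n := n) hc hε'.le fun x => ?_).integrable_mul
      φ).congr (ae_of_all _ fun x => mul_comm _ _)
    have hp : 0 < ‖x‖ ^ 2 + ε := by positivity
    simp only [Function.comp_apply]
    rw [Complex.norm_real, Real.norm_eq_abs]
    refine (h.boundLap _ hp).trans ?_
    rw [div_mul_eq_mul_div, div_mul_eq_mul_div, mul_assoc]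
    have h1 : √ε ≤ √(‖x‖ ^ 2 + ε) := Real.sqrt_le_sqrt (by nlinarith [sq_nonneg ‖x‖])
    gcongr
    exact le_mul_of_one_le_left (by positivity) (by linarith [norm_nonneg x])
  · have hc2 := continuous_comp_shift h.cont hε'
    have hc : Continuous fun x : Plane => ((4 * ε * g₂ (‖x‖ ^ 2 + ε) : ℝ) : ℂ) :=
      Complex.continuous_ofReal.comp (continuous_const.mul hc2)
    refine ((moderate_of_shifted_bound (C := 4 * (C / ε)) (n := n) hc hε'.le
      fun x => ?_).integrable_mul φ).congr (ae_of_all _ fun x => mul_comm _ _)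
    have hp : 0 < ‖x‖ ^ 2 + ε := by positivity
    have hb := h.bound₂ _ hp
    rw [abs_mul, abs_of_pos (by positivity)] at hb
    rw [Complex.norm_real, Real.norm_eq_abs, abs_mul, abs_of_pos (by positivity)]
    have : ε ^ 2 * |g₂ (‖x‖ ^ 2 + ε)| ≤ C * (1 + (‖x‖ ^ 2 + ε)) ^ n := by
      refine le_trans ?_ hb
      gcongr
      nlinarith [sq_nonneg ‖x‖]
    calc 4 * ε * |g₂ (‖x‖ ^ 2 + ε)| = 4 / ε * (ε ^ 2 * |g₂ (‖x‖ ^ 2 + ε)|) := by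
          field_simp
      _ ≤ 4 / ε * (C * (1 + (‖x‖ ^ 2 + ε)) ^ n) := by gcongr
      _ = 4 * (C / ε) * 1 * (1 + (‖x‖ ^ 2 + ε)) ^ n := by ring
      _ ≤ _ := by
          gcongr
          linarith [norm_nonneg x]

end Sigma2D

end

noncomputable section

namespace Sigma2D

open Laplacian TemperedDistribution

/-! ### Fundamental solutions -/

/-- The symbol `|2πξ|² - l` of `-Δ - l`. -/
def helmholtzSymbol (l : ℝ) (ξ : Plane) : ℂ := ((laplaceSymbol ξ - l : ℝ) : ℂ)

lemma hasTemperateGrowth_laplaceSymbol : laplaceSymbol.HasTemperateGrowth := by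
  have h : laplaceSymbol = fun ξ : Plane => (2 * π) ^ 2 * ‖ξ‖ ^ 2 := by
    ext ξ; rw [laplaceSymbol, mul_pow]
  rw [h]
  exact (Function.HasTemperateGrowth.const _).mul (Function.hasTemperateGrowth_norm_sq Plane)

lemma hasTemperateGrowth_helmholtzSymbol (l : ℝ) : (helmholtzSymbol l).HasTemperateGrowth :=
  Function.Complex.hasTemperateGrowth_ofReal.comp
    (hasTemperateGrowth_laplaceSymbol.sub (Function.HasTemperateGrowth.const l))

lemma multiplier_add {f g : Plane → ℂ} (hf : f.HasTemperateGrowth) (hg : g.HasTemperateGrowth)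
    (T : 𝓢'(Plane, ℂ)) : fourierMultiplierCLM ℂ (f + g) T =
      fourierMultiplierCLM ℂ f T + fourierMultiplierCLM ℂ g T := by
  ext φ
  simp [SchwartzMap.smulLeftCLM_add hf hg]

lemma multiplier_const (c : ℂ) (T : 𝓢'(Plane, ℂ)) :
    fourierMultiplierCLM ℂ (fun _ => c) T = c • T := by
  rw [fourierMultiplierCLM_const]; rfl

lemma multiplier_mul {f g : Plane → ℂ} (hf : f.HasTemperateGrowth) (hg : g.HasTemperateGrowth)
    (T : 𝓢'(Plane, ℂ)) : fourierMultiplierCLM ℂ (fun ξ => f ξ * g ξ) T =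
      fourierMultiplierCLM ℂ g (fourierMultiplierCLM ℂ f T) := by
  rw [fourierMultiplierCLM_fourierMultiplierCLM_apply hf hg]; rfl

lemma multiplier_const_mul {g : Plane → ℂ} (hg : g.HasTemperateGrowth) (c : ℂ) (T : 𝓢'(Plane, ℂ)) :
    fourierMultiplierCLM ℂ (fun ξ => c * g ξ) T = c • fourierMultiplierCLM ℂ g T := by
  rw [multiplier_mul (.const c) hg, multiplier_const, map_smul]

lemma multiplier_helmholtz (l : ℝ) (T : 𝓢'(Plane, ℂ)) :
    fourierMultiplierCLM ℂ (helmholtzSymbol l) T = -Δ T - (l : ℂ) • T := by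
  have h1 : helmholtzSymbol l = (fun ξ : Plane => (((2 * π) ^ 2 : ℝ) : ℂ) *
      Complex.ofReal (‖ξ‖ ^ 2)) + fun _ => (-l : ℂ) := by
    ext ξ
    simp [helmholtzSymbol, laplaceSymbol, mul_pow, sub_eq_add_neg]
  have ht : (fun ξ : Plane => Complex.ofReal (‖ξ‖ ^ 2)).HasTemperateGrowth :=
    Function.Complex.hasTemperateGrowth_ofReal.comp (Function.hasTemperateGrowth_norm_sq Plane)
  have hm : (fun ξ : Plane => (((2 * π) ^ 2 : ℝ) : ℂ) *
      Complex.ofReal (‖ξ‖ ^ 2)).HasTemperateGrowth := .mul (.const _) ht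
  rw [h1, multiplier_add hm (.const _), multiplier_const_mul ht,
    multiplier_const, laplacian_eq_fourierMultiplierCLM, neg_smul, neg_neg, ← Complex.coe_smul]
  ext φ
  change _ + (-l : ℂ) * T φ = _ - (l : ℂ) * T φ
  ring

/-- The distribution `S` is the pointwise value of `(-Δ - l) g` off the origin; the point mass
enters `Δ` with `-c`, hence `-Δ` with `+c`. -/
lemma multiplier_helmholtz_radial {g g₁ g₂ : ℝ → ℝ} {C c l : ℝ} {n : ℕ} (h : RadialData g g₁ g₂ C n)
    (hlim : Tendsto (fun t => t ^ 2 * g₂ t) (𝓝[>] 0) (𝓝 (c / (4 * π)))) {T S : 𝓢'(Plane, ℂ)}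
    (hT : Represents T fun x => (g (‖x‖ ^ 2) : ℂ))
    (hS : Represents S fun x => ((-4 * (‖x‖ ^ 2 * g₂ (‖x‖ ^ 2) + g₁ (‖x‖ ^ 2)) -
      l * g (‖x‖ ^ 2) : ℝ) : ℂ)) :
    fourierMultiplierCLM ℂ (helmholtzSymbol l) T = S + (c : ℂ) • delta 0 := by
  rw [multiplier_helmholtz]
  ext φ
  have h1 : T (Δ φ) = ∫ x, (g (‖x‖ ^ 2) : ℂ) * (Δ φ : 𝓢(Plane, ℂ)) x := by
    rw [(hT (Δ φ)).2]; congr 1; ext x; rw [mul_comm]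
  have h2 : ∫ x, ((4 * (‖x‖ ^ 2 * g₂ (‖x‖ ^ 2) + g₁ (‖x‖ ^ 2)) : ℝ) : ℂ) * φ x =
      -S φ - l * T φ := by
    have h3 := ((hS.add (hT.smul (l : ℂ))).smul (-1) φ).2
    have h4 : ((-1 : ℂ) • (S + (l : ℂ) • T)) φ = -S φ - l * T φ := by
      change (-1 : ℂ) * (S φ + (l : ℂ) * T φ) = _
      ring
    rw [← h4, h3]
    congr 1; ext x
    push_cast
    ring
  have h5 : (-Δ T - (l : ℂ) • T) φ = -(T (Δ φ)) - l * T φ := by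
    rw [← laplacian_apply_apply]; rfl
  rw [h5, h1, integral_laplacian_radial h hlim, h2]
  change _ = S φ + (c : ℂ) * φ 0
  ring

lemma abs_log_mul_le {M : ℝ} (hM : 0 < M) : ∃ C, 0 ≤ C ∧ ∀ t > 0,
    |log (t * M ^ 2)| ≤ C * (1 + t) / √t := by
  refine ⟨2 + |log (M ^ 2)|, by positivity, fun t ht => ?_⟩
  have hs : 0 < √t := Real.sqrt_pos.2 ht
  have hst : √t ^ 2 = t := Real.sq_sqrt ht.le
  have h1 : log t = 2 * log (√t) := by
    conv_lhs => rw [← hst, Real.log_pow]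
    norm_num
  -- For `u = √t` the bound reads `|log u| ≤ u + 1/u`, which follows from `1 - 1/u ≤ log u ≤ u - 1`.
  have h2 : |log (√t)| ≤ (1 + t) / √t := by
    have a := Real.log_le_sub_one_of_pos hs
    have b := Real.one_sub_inv_le_log_of_pos hs
    have e : (1 + t) / √t = (√t)⁻¹ + √t := by
      rw [← hst, Real.sqrt_sq hs.le]; field_simp
    have := inv_pos.2 hs
    rw [e, abs_le]; constructor <;> linarith
  have h3 : 1 ≤ (1 + t) / √t := by
    rw [le_div_iff₀ hs, one_mul]; nlinarith [sq_nonneg (√t - 1)]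
  rw [Real.log_mul ht.ne' (by positivity), h1]
  calc |2 * log (√t) + log (M ^ 2)| ≤ 2 * |log (√t)| + |log (M ^ 2)| * 1 := by
        rw [mul_one]
        refine (abs_add_le _ _).trans ?_
        rw [abs_mul, abs_two]
    _ ≤ 2 * ((1 + t) / √t) + |log (M ^ 2)| * ((1 + t) / √t) := by gcongr
    _ = _ := by ring

/-- A radial solution of the Helmholtz equation off the origin that is logarithmically bounded at
the origin is controlled at infinity by its energy. -/
lemma exists_radialData {g g₁ g₂ : ℝ → ℝ} {l K : ℝ} (hl : 0 < l) (hK : 0 ≤ K)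
    (d : ∀ t > 0, HasDerivAt g (g₁ t) t) (d' : ∀ t > 0, HasDerivAt g₁ (g₂ t) t)
    (hc : ContinuousOn g₂ (Set.Ioi 0)) (ode : ∀ t > 0, 4 * (t * g₂ t + g₁ t) = -l * g t)
    (b : ∀ t > 0, t ≤ 1 → |g t| ≤ K / √t) (b₁ : ∀ t > 0, t ≤ 1 → |t * g₁ t| ≤ K) :
    ∃ C n, RadialData g g₁ g₂ C n := by
  -- By the differential equation the energy has derivative `-4 g₁²`, so it is bounded by its value
  -- at `1` for all `t ≥ 1`.
  set E : ℝ → ℝ := fun t => 4 * (t * g₁ t ^ 2) + l * g t ^ 2 with hE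
  have dE : ∀ t > 0, HasDerivAt E (-4 * g₁ t ^ 2) t := by
    intro t ht
    refine (((((hasDerivAt_id t).mul ((d' t ht).pow 2))).const_mul 4).add
      (((d t ht).pow 2).const_mul l)).congr_deriv ?_
    simp only [id, Pi.pow_apply]
    push_cast
    linear_combination 2 * g₁ t * ode t ht
  have hanti : AntitoneOn E (Set.Ici 1) := by
    refine antitoneOn_of_deriv_nonpos (convex_Ici 1) ?_ ?_ ?_
    · intro t ht
      exact (dE t (lt_of_lt_of_le one_pos ht)).continuousAt.continuousWithinAt
    · intro t ht
      rw [interior_Ici] at ht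
      exact (dE t (one_pos.trans ht)).differentiableAt.differentiableWithinAt
    · intro t ht
      rw [interior_Ici] at ht
      rw [(dE t (one_pos.trans ht)).deriv]
      nlinarith [sq_nonneg (g₁ t)]
  have hE1 : ∀ t, 1 ≤ t → E t ≤ E 1 := fun t ht => hanti (Set.mem_Ici.2 le_rfl) ht ht
  -- The summand `1` ensures `A ≤ A²`, so that bounds of squares by `A` become bounds of absolute
  -- values by `A`.
  set A := 1 + E 1 / l + E 1 with hA
  have hE0 : 0 ≤ E 1 := by simp only [hE]; positivity
  have hA1 : 1 ≤ A := by have : 0 ≤ E 1 / l := by positivity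
                         linarith
  have big : ∀ t, 1 ≤ t → |g t| ≤ A ∧ |t * g₁ t| ≤ A * t := by
    intro t ht
    have h := hE1 t ht
    simp only [hE] at h
    change _ ≤ E 1 at h
    have h0 : 0 ≤ t * g₁ t ^ 2 := by positivity
    have h0' : 0 ≤ l * g t ^ 2 := by positivity
    have hg : g t ^ 2 ≤ A := by
      have : g t ^ 2 ≤ E 1 / l := by rw [le_div_iff₀ hl]; linarith
      linarith
    have hg1 : g₁ t ^ 2 ≤ A := by
      have : g₁ t ^ 2 ≤ t * g₁ t ^ 2 := le_mul_of_one_le_left (sq_nonneg _) ht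
      have : 0 ≤ E 1 / l := by positivity
      linarith
    refine ⟨abs_le_of_sq_le_sq (by nlinarith) (by linarith), ?_⟩
    rw [abs_mul, abs_of_pos (by linarith), mul_comm]
    gcongr
    exact abs_le_of_sq_le_sq (by nlinarith) (by linarith)
  set C₀ := K + A with hC₀
  have hC₀K : K ≤ C₀ := by linarith
  have hC₀A : A ≤ C₀ := by linarith
  have hC₀0 : 0 ≤ C₀ := by linarith
  have B : ∀ t > 0, |g t| ≤ C₀ * (1 + t) / √t := by
    intro t ht
    have hs : 0 < √t := Real.sqrt_pos.2 ht
    rcases le_total t 1 with h | h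
    · refine (b t ht h).trans ?_
      gcongr
      nlinarith
    · refine (big t h).1.trans ?_
      rw [le_div_iff₀ hs]
      have : √t ≤ 1 + t := by nlinarith [sq_nonneg (√t - 1), Real.sq_sqrt ht.le]
      gcongr
  have B₁ : ∀ t > 0, |t * g₁ t| ≤ C₀ * (1 + t) := by
    intro t ht
    rcases le_total t 1 with h | h
    · exact (b₁ t ht h).trans (by nlinarith)
    · exact (big t h).2.trans (by gcongr; linarith)
  have hC : C₀ ≤ C₀ * (1 + l) := by nlinarith
  refine ⟨C₀ * (1 + l), 2, d, d', hc, fun t ht => ?_, fun t ht => ?_, fun t ht => ?_, fun t ht => ?_⟩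
  · refine (B t ht).trans ?_
    gcongr
    nlinarith
  · refine (B₁ t ht).trans ?_
    gcongr
    nlinarith
  · have e : t ^ 2 * g₂ t = -(l / 4 * (t * g t)) - t * g₁ t := by
      linear_combination t / 4 * ode t ht
    have hs : 0 < √t := Real.sqrt_pos.2 ht
    have h1 : |t * g t| ≤ C₀ * (1 + t) ^ 2 := by
      rw [abs_mul, abs_of_pos ht]
      calc t * |g t| ≤ t * (C₀ * (1 + t) / √t) := by gcongr; exact B t ht
        _ = C₀ * (1 + t) * √t := by
            have e2 : t / √t = √t := Real.div_sqrt
            calc _ = C₀ * (1 + t) * (t / √t) := by ring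
              _ = _ := by rw [e2]
        _ ≤ C₀ * (1 + t) * (1 + t) := by
            gcongr
            nlinarith [sq_nonneg (√t - 1), Real.sq_sqrt ht.le]
        _ = _ := by ring
    have h2 : |t * g₁ t| ≤ C₀ * (1 + t) ^ 2 := (B₁ t ht).trans (by gcongr; nlinarith)
    rw [e]
    calc |-(l / 4 * (t * g t)) - t * g₁ t| ≤ |-(l / 4 * (t * g t))| + |t * g₁ t| :=
          abs_sub _ _
      _ = l / 4 * |t * g t| + |t * g₁ t| := by
          rw [abs_neg, abs_mul, abs_of_pos (by positivity)]
      _ ≤ l / 4 * (C₀ * (1 + t) ^ 2) + C₀ * (1 + t) ^ 2 := by gcongr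
      _ ≤ _ := by
          have : 0 ≤ l * (C₀ * (1 + t) ^ 2) := by positivity
          nlinarith
  · rw [ode t ht, abs_mul, abs_neg, abs_of_pos hl]
    calc l * |g t| ≤ l * (C₀ * (1 + t) / √t) := by gcongr; exact B t ht
      _ = C₀ * l * (1 + t) / √t := by ring
      _ ≤ _ := by
        gcongr
        · linarith
        · nlinarith

/-- The fundamental solution of `-Δ - l`, as a function of `t = |x|²`. -/
def fundSol (M l t : ℝ) : ℝ :=
  -(1 / (4 * π)) * (log (t * M ^ 2) * besselJ (l * t) - 2 * neumannY (l * t))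

/-- The first derivative of `fundSol`. -/
def fundSol' (M l t : ℝ) : ℝ :=
  -(1 / (4 * π)) * (besselJ (l * t) / t + log (t * M ^ 2) * (l * besselJ' (l * t)) -
    2 * (l * neumannY' (l * t)))

/-- The second derivative of `fundSol`. -/
def fundSol'' (M l t : ℝ) : ℝ :=
  -(1 / (4 * π)) * (-besselJ (l * t) / t ^ 2 + 2 * (l * besselJ' (l * t)) / t +
    log (t * M ^ 2) * (l ^ 2 * besselJ'' (l * t)) - 2 * (l ^ 2 * neumannY'' (l * t)))

lemma hasDerivAt_comp_mul {f f' : ℝ → ℝ} (hf : ∀ t, HasDerivAt f (f' t) t) (l t : ℝ) :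
    HasDerivAt (fun t => f (l * t)) (l * f' (l * t)) t := by
  have h := (hf (l * t)).comp t ((hasDerivAt_id t).const_mul l)
  refine h.congr_deriv ?_
  ring

lemma hasDerivAt_log_mul {M t : ℝ} (hM : 0 < M) (ht : 0 < t) :
    HasDerivAt (fun t => log (t * M ^ 2)) t⁻¹ t := by
  have h := ((hasDerivAt_id t).mul_const (M ^ 2)).log (by simp; constructor <;> positivity)
  refine h.congr_deriv ?_
  simp only [id]
  field_simp

lemma hasDerivAt_fundSol {M : ℝ} (hM : 0 < M) (l : ℝ) {t : ℝ} (ht : 0 < t) :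
    HasDerivAt (fundSol M l) (fundSol' M l t) t := by
  refine ((((hasDerivAt_log_mul hM ht).mul (hasDerivAt_comp_mul hasDerivAt_besselJ l t)).sub
    ((hasDerivAt_comp_mul hasDerivAt_neumannY l t).const_mul 2)).const_mul
      (-(1 / (4 * π)))).congr_deriv ?_
  rw [fundSol']
  ring

lemma hasDerivAt_fundSol' {M : ℝ} (hM : 0 < M) (l : ℝ) {t : ℝ} (ht : 0 < t) :
    HasDerivAt (fundSol' M l) (fundSol'' M l t) t := by
  refine (((((hasDerivAt_comp_mul hasDerivAt_besselJ l t).div (hasDerivAt_id t) ht.ne').add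
    ((hasDerivAt_log_mul hM ht).mul ((hasDerivAt_comp_mul hasDerivAt_besselJ' l t).const_mul l))).sub
    (((hasDerivAt_comp_mul hasDerivAt_neumannY' l t).const_mul l).const_mul 2)).const_mul
      (-(1 / (4 * π)))).congr_deriv ?_
  rw [fundSol'']
  simp only [id]
  field_simp
  ring

/-- The term `8 l J'` in which one derivative falls on the logarithm is cancelled by the source term
in the equation for `neumannY`. -/
lemma fundSol_ode (M l : ℝ) {t : ℝ} (ht : 0 < t) :
    4 * (t * fundSol'' M l t + fundSol' M l t) = -l * fundSol M l t := by
  have h1 := besselJ_ode (l * t)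
  have h2 := neumannY_ode (l * t)
  have e : 4 * (t * fundSol'' M l t + fundSol' M l t) = -(1 / (4 * π)) *
      (l * log (t * M ^ 2) * (4 * (l * t * besselJ'' (l * t) + besselJ' (l * t))) +
        8 * l * besselJ' (l * t) -
        2 * l * (4 * (l * t * neumannY'' (l * t) + neumannY' (l * t)))) := by
    rw [fundSol', fundSol'']
    field_simp
    ring
  rw [e, h1, h2, fundSol]
  ring

lemma continuousOn_fundSol'' {M : ℝ} (hM : 0 < M) (l : ℝ) :
    ContinuousOn (fundSol'' M l) (Set.Ioi 0) := by
  have hl : Continuous fun t : ℝ => l * t := continuous_const.mul continuous_id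
  have c1 := (continuous_besselJ.comp hl).continuousOn (s := Set.Ioi (0 : ℝ))
  have c2 := (continuous_besselJ'.comp hl).continuousOn (s := Set.Ioi (0 : ℝ))
  have c3 := (continuous_besselJ''.comp hl).continuousOn (s := Set.Ioi (0 : ℝ))
  have c4 := (neumannCoeff_decay.deriv.deriv.continuous.comp hl).continuousOn (s := Set.Ioi (0 : ℝ))
  have c5 : ContinuousOn (fun t : ℝ => log (t * M ^ 2)) (Set.Ioi 0) := fun t ht =>
    (hasDerivAt_log_mul hM ht).continuousAt.continuousWithinAt
  have ci : ContinuousOn (fun t : ℝ => t) (Set.Ioi 0) := continuousOn_id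
  exact continuousOn_const.mul (((((c1.neg).div (ci.pow 2) fun t ht => pow_ne_zero 2 (ne_of_gt ht)).add
    ((continuousOn_const.mul (continuousOn_const.mul c2)).div ci fun t ht => ne_of_gt ht)).add
    (c5.mul (continuousOn_const.mul c3))).sub (continuousOn_const.mul (continuousOn_const.mul c4)))

lemma continuous_mul_log_add (M : ℝ) :
    Continuous fun t : ℝ => t * log t + t * log (M ^ 2) :=
  Real.continuous_mul_log.add (continuous_id.mul continuous_const)

lemma mul_log_mul {M t : ℝ} (hM : 0 < M) (ht : 0 < t) :
    t * log (t * M ^ 2) = t * log t + t * log (M ^ 2) := by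
  rw [Real.log_mul ht.ne' (by positivity), mul_add]

/-- Only the term `-J / t²`, from two derivatives of the logarithm, survives; the limit says that
the point source has mass `1`. -/
lemma tendsto_fundSol'' {M : ℝ} (hM : 0 < M) (l : ℝ) :
    Tendsto (fun t => t ^ 2 * fundSol'' M l t) (𝓝[>] 0) (𝓝 (1 / (4 * π))) := by
  have hl : Continuous fun t : ℝ => l * t := continuous_const.mul continuous_id
  have hc : Continuous fun t : ℝ => -(1 / (4 * π)) * (-besselJ (l * t) +
      2 * t * (l * besselJ' (l * t)) + (t * log t + t * log (M ^ 2)) * t *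
        (l ^ 2 * besselJ'' (l * t)) - 2 * t ^ 2 * (l ^ 2 * neumannY'' (l * t))) := by
    have c1 := continuous_besselJ.comp hl
    have c2 := continuous_besselJ'.comp hl
    have c3 := continuous_besselJ''.comp hl
    have c4 : Continuous fun t => neumannY'' (l * t) :=
      neumannCoeff_decay.deriv.deriv.continuous.comp hl
    have c5 := continuous_mul_log_add M
    have ci : Continuous fun t : ℝ => t := continuous_id
    exact continuous_const.mul (((c1.neg.add ((continuous_const.mul ci).mul
      (continuous_const.mul c2))).add ((c5.mul ci).mul (continuous_const.mul c3))).sub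
      ((continuous_const.mul (ci.pow 2)).mul (continuous_const.mul c4)))
  have h0 := hc.tendsto 0
  simp only [mul_zero, zero_mul, besselJ_zero, add_zero, ne_eq, OfNat.ofNat_ne_zero,
    not_false_eq_true, zero_pow, sub_zero, mul_neg, mul_one, neg_neg] at h0
  refine (h0.mono_left nhdsWithin_le_nhds).congr' ?_
  filter_upwards [self_mem_nhdsWithin] with t ht
  have ht' : 0 < t := ht
  rw [← mul_log_mul hM ht', fundSol'']
  field_simp

lemma exists_abs_le_of_continuous {f : ℝ → ℝ} (hf : Continuous f) (a b : ℝ) :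
    ∃ K, 0 ≤ K ∧ ∀ t, a ≤ t → t ≤ b → |f t| ≤ K := by
  obtain ⟨K, hK⟩ := (isCompact_Icc (a := a) (b := b)).exists_bound_of_continuousOn hf.continuousOn
  exact ⟨|K|, abs_nonneg K, fun t h1 h2 => (hK t ⟨h1, h2⟩).trans (le_abs_self K)⟩

lemma radialData_fundSol {M l : ℝ} (hM : 0 < M) (hl : 0 ≤ l) :
    ∃ C n, RadialData (fundSol M l) (fundSol' M l) (fundSol'' M l) C n := by
  obtain ⟨A, hA, hlog⟩ := abs_log_mul_le hM
  have h4 : 0 ≤ 1 / (4 * π) := by positivity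
  rcases hl.eq_or_lt with rfl | hl
  -- The energy method needs `l > 0`; for `l = 0` the bounds are read off from the explicit
  -- logarithm.
  · have e0 : ∀ t, fundSol M 0 t = -(1 / (4 * π)) * log (t * M ^ 2) := by
      intro t; simp [fundSol, besselJ_zero, neumannY_zero]
    have e1 : ∀ t, fundSol' M 0 t = -(1 / (4 * π)) * (1 / t) := by
      intro t; simp [fundSol', besselJ_zero]
    have e2 : ∀ t, fundSol'' M 0 t = 1 / (4 * π) * (1 / t ^ 2) := by
      intro t; simp [fundSol'', besselJ_zero, neg_div]
    have hpi : 1 / (4 * π) ≤ 1 := by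
      rw [div_le_one (by positivity)]; linarith [pi_gt_three]
    refine ⟨A + 1, 1, fun t ht => hasDerivAt_fundSol hM 0 ht, fun t ht => hasDerivAt_fundSol' hM 0 ht,
      continuousOn_fundSol'' hM 0, fun t ht => ?_, fun t ht => ?_, fun t ht => ?_, fun t ht => ?_⟩
    · rw [e0, abs_mul, abs_neg, abs_of_nonneg h4, pow_one]
      calc 1 / (4 * π) * |log (t * M ^ 2)| ≤ 1 * (A * (1 + t) / √t) := by
            gcongr; exact hlog t ht
        _ ≤ _ := by
            rw [one_mul]; gcongr; linarith
    · rw [e1]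
      have : t * (-(1 / (4 * π)) * (1 / t)) = -(1 / (4 * π)) := by field_simp
      rw [this, abs_neg, abs_of_nonneg h4]
      nlinarith
    · rw [e2]
      have : t ^ 2 * (1 / (4 * π) * (1 / t ^ 2)) = 1 / (4 * π) := by field_simp
      rw [this, abs_of_nonneg h4]
      nlinarith
    · rw [fundSol_ode M 0 ht, neg_zero, zero_mul, abs_zero]
      positivity
  · have hlc : Continuous fun t : ℝ => l * t := continuous_const.mul continuous_id
    have c1 := continuous_besselJ.comp hlc
    have c2 := continuous_besselJ'.comp hlc
    have c4 := continuous_neumannY'.comp hlc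
    have ci : Continuous fun t : ℝ => t := continuous_id
    obtain ⟨K₁, hK₁, b1⟩ := exists_abs_le_of_continuous c1 0 1
    obtain ⟨K₂, hK₂, b2⟩ := exists_abs_le_of_continuous (continuous_neumannY.comp hlc) 0 1
    obtain ⟨K₃, hK₃, b3⟩ := exists_abs_le_of_continuous (continuous_const.mul ((c1.add
      ((continuous_mul_log_add M).mul (continuous_const.mul c2))).sub
      ((continuous_const.mul (ci.mul (continuous_const.mul c4))))) : Continuous fun t =>
        -(1 / (4 * π)) * (besselJ (l * t) + (t * log t + t * log (M ^ 2)) * (l * besselJ' (l * t)) -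
          2 * (t * (l * neumannY' (l * t))))) 0 1
    refine exists_radialData (K := 1 / (4 * π) * (A * 2 * K₁ + 2 * K₂) + K₃) hl (by positivity)
      (fun t ht => hasDerivAt_fundSol hM l ht) (fun t ht => hasDerivAt_fundSol' hM l ht)
      (continuousOn_fundSol'' hM l) (fun t ht => fundSol_ode M l ht) (fun t ht ht1 => ?_)
      (fun t ht ht1 => ?_)
    · have hs : 0 < √t := Real.sqrt_pos.2 ht
      have hs1 : √t ≤ 1 := Real.sqrt_le_one.2 ht1
      have hb1 : |besselJ (l * t)| ≤ K₁ := b1 t ht.le ht1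
      have hb2 : |neumannY (l * t)| ≤ K₂ := b2 t ht.le ht1
      rw [fundSol, abs_mul, abs_neg, abs_of_nonneg h4, le_div_iff₀ hs]
      have h1 : |log (t * M ^ 2)| * √t ≤ A * 2 := by
        have := hlog t ht
        rw [le_div_iff₀ hs] at this
        nlinarith
      calc 1 / (4 * π) * |log (t * M ^ 2) * besselJ (l * t) - 2 * neumannY (l * t)| * √t
          ≤ 1 / (4 * π) * (|log (t * M ^ 2) * besselJ (l * t)| + |2 * neumannY (l * t)|) * √t := by
            gcongr; exact abs_sub _ _
        _ = 1 / (4 * π) * (|log (t * M ^ 2)| * √t * |besselJ (l * t)| +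
              2 * (|neumannY (l * t)| * √t)) := by
            rw [abs_mul, abs_mul, abs_two]; ring
        _ ≤ 1 / (4 * π) * (A * 2 * K₁ + 2 * (K₂ * 1)) := by gcongr
        _ ≤ _ := by linarith
    · have h := b3 t ht.le ht1
      have e : t * fundSol' M l t = -(1 / (4 * π)) * (besselJ (l * t) + (t * log t +
          t * log (M ^ 2)) * (l * besselJ' (l * t)) - 2 * (t * (l * neumannY' (l * t)))) := by
        rw [← mul_log_mul hM ht, fundSol']
        field_simp
      rw [e]
      refine h.trans ?_
      have : 0 ≤ 1 / (4 * π) * (A * 2 * K₁ + 2 * K₂) := by positivity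
      linarith

/-- The fundamental solution of `-Δ - l` with pole at `y`. -/
lemma exists_fundSol {M l : ℝ} (hM : 0 < M) (hl : 0 ≤ l) (y : Plane) :
    ∃ T : 𝓢'(Plane, ℂ), Represents T (fun x => (fundSol M l (‖x - y‖ ^ 2) : ℂ)) ∧
      fourierMultiplierCLM ℂ (helmholtzSymbol l) T = delta y := by
  obtain ⟨C, n, h⟩ := radialData_fundSol hM hl
  obtain ⟨T, hT⟩ := (moderate_of_radial h.continuousOn h.bound).exists_represents
  refine ⟨shiftDist y T, hT.shift y, ?_⟩
  rw [multiplier_shiftDist (hasTemperateGrowth_helmholtzSymbol l),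
    multiplier_helmholtz_radial h (tendsto_fundSol'' hM l) hT
      (represents_zero.congr_off 0 fun x hx => ?_)]
  · rw [zero_add, Complex.ofReal_one, one_smul, shiftDist_delta]
  · have hx' : 0 < ‖x‖ := norm_pos_iff.2 hx
    have := fundSol_ode M l (t := ‖x‖ ^ 2) (by positivity)
    rw [eq_comm, Complex.ofReal_eq_zero]
    linarith

lemma fundSol_zero_eq_R0 (M : ℝ) (x : Plane) : fundSol M 0 (‖x‖ ^ 2) = R0 M x := by
  simp [fundSol, besselJ_zero, neumannY_zero, R0]

/-- The function `R₁`, in terms of `t = |x|²`. -/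
def radialR1 (M t : ℝ) : ℝ := t * (log (t * M ^ 2) - 2) / (16 * π)

/-- `R₁` is a fundamental solution of the bilaplacian: `-Δ R₁ = R₀` holds without a point mass and
`-Δ R₀ = δ`. -/
lemma exists_R1 {M : ℝ} (hM : 0 < M) : ∃ T S : 𝓢'(Plane, ℂ),
    Represents T (fun x => (R1 M x : ℂ)) ∧ Represents S (fun x => (R0 M x : ℂ)) ∧
      fourierMultiplierCLM ℂ (helmholtzSymbol 0) T = S ∧
      fourierMultiplierCLM ℂ (helmholtzSymbol 0) S = delta 0 := by
  obtain ⟨S, hS, hS'⟩ := exists_fundSol hM le_rfl 0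
  have hS2 : Represents S (fun x => (R0 M x : ℂ)) := by
    simpa only [sub_zero, fundSol_zero_eq_R0] using hS
  obtain ⟨A, hA, hlog⟩ := abs_log_mul_le hM
  have d1 : ∀ t > 0, HasDerivAt (radialR1 M) ((log (t * M ^ 2) - 1) / (16 * π)) t := by
    intro t ht
    refine (((hasDerivAt_id t).mul ((hasDerivAt_log_mul hM ht).sub_const 2)).div_const
      (16 * π)).congr_deriv ?_
    simp only [id]
    field_simp
    ring
  have d2 : ∀ t > 0, HasDerivAt (fun t => (log (t * M ^ 2) - 1) / (16 * π)) (t⁻¹ / (16 * π)) t :=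
    fun t ht => ((hasDerivAt_log_mul hM ht).sub_const 1).div_const (16 * π)
  have hpi : 1 ≤ 16 * π := by linarith [pi_gt_three]
  have hpi0 : 0 < 16 * π := by positivity
  have key : ∀ t > 0, 1 ≤ (1 + t) / √t := fun t ht => by
    have hs := Real.sqrt_pos.2 ht
    rw [le_div_iff₀ hs, one_mul]; nlinarith [sq_nonneg (√t - 1), Real.sq_sqrt ht.le]
  have key2 : ∀ t > 0, ∀ c, 0 ≤ c → |log (t * M ^ 2) - c| ≤ (A + c) * (1 + t) / √t := by
    intro t ht c hc
    calc |log (t * M ^ 2) - c| ≤ |log (t * M ^ 2)| + |c| := abs_sub _ _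
      _ ≤ A * (1 + t) / √t + c * ((1 + t) / √t) := by
          rw [abs_of_nonneg hc]
          exact add_le_add (hlog t ht) (le_mul_of_one_le_right hc (key t ht))
      _ = _ := by ring
  have hR : RadialData (radialR1 M) (fun t => (log (t * M ^ 2) - 1) / (16 * π))
      (fun t => t⁻¹ / (16 * π)) (A + 2) 2 := by
    refine ⟨d1, d2, ?_, fun t ht => ?_, fun t ht => ?_, fun t ht => ?_, fun t ht => ?_⟩
    · exact (continuousOn_inv₀.mono fun t ht => ne_of_gt ht).div_const _
    · rw [radialR1, abs_div, abs_of_pos hpi0]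
      refine (div_le_self (abs_nonneg _) hpi).trans ?_
      rw [abs_mul, abs_of_pos ht]
      calc t * |log (t * M ^ 2) - 2| ≤ (1 + t) * ((A + 2) * (1 + t) / √t) := by
            gcongr
            · linarith
            · exact key2 t ht 2 (by norm_num)
        _ = _ := by ring
    · rw [← mul_div_assoc, abs_div, abs_of_pos hpi0]
      refine (div_le_self (abs_nonneg _) hpi).trans ?_
      rw [abs_mul, abs_of_pos ht]
      calc t * |log (t * M ^ 2) - 1| ≤ t * ((A + 1) * (1 + t) / √t) := by
            gcongr
            exact key2 t ht 1 (by norm_num)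
        _ = (A + 1) * (1 + t) * (t / √t) := by ring
        _ ≤ (A + 2) * (1 + t) * (1 + t) := by
            rw [Real.div_sqrt]
            have : √t ≤ 1 + t := by nlinarith [sq_nonneg (√t - 1), Real.sq_sqrt ht.le]
            gcongr
            linarith
        _ = _ := by ring
    · have e : t ^ 2 * (t⁻¹ / (16 * π)) = t / (16 * π) := by field_simp
      rw [e, abs_of_pos (by positivity)]
      refine (div_le_self ht.le hpi).trans ?_
      nlinarith [mul_nonneg hA (sq_nonneg (1 + t))]
    · have e : 4 * (t * (t⁻¹ / (16 * π)) + (log (t * M ^ 2) - 1) / (16 * π)) =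
          4 * log (t * M ^ 2) / (16 * π) := by field_simp; ring
      rw [e, mul_div_assoc, abs_mul, abs_of_pos (by norm_num : (0 : ℝ) < 4), abs_div,
        abs_of_pos hpi0]
      have hp : 4 ≤ 16 * π := by linarith [pi_gt_three]
      calc 4 * (|log (t * M ^ 2)| / (16 * π)) ≤ |log (t * M ^ 2)| := by
            rw [mul_div_assoc', div_le_iff₀ hpi0, mul_comm]; gcongr
        _ ≤ A * (1 + t) / √t := hlog t ht
        _ ≤ _ := by
            gcongr
            · linarith
            · nlinarith
  -- The singularity `|x|² log |x|` is too weak to produce a point mass, so the source coefficient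
  -- is `0`.
  have hlim : Tendsto (fun t : ℝ => t ^ 2 * (t⁻¹ / (16 * π))) (𝓝[>] 0) (𝓝 (0 / (4 * π))) := by
    have h0 : Tendsto (fun t : ℝ => t / (16 * π)) (𝓝 0) (𝓝 (0 / (16 * π))) :=
      tendsto_id.div_const _
    rw [zero_div] at h0 ⊢
    refine (h0.mono_left nhdsWithin_le_nhds).congr' ?_
    filter_upwards [self_mem_nhdsWithin] with t ht
    have ht' : 0 < t := ht
    field_simp
  obtain ⟨T, hT⟩ := (moderate_of_radial hR.continuousOn hR.bound).exists_represents
  refine ⟨T, S, hT, hS2, ?_, hS'⟩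
  rw [multiplier_helmholtz_radial hR hlim hT (hS2.congr_off 0 fun x hx => ?_), Complex.ofReal_zero]
  · ext φ
    change S φ + (0 : ℂ) * φ 0 = S φ
    ring
  have hx' : 0 < ‖x‖ := norm_pos_iff.2 hx
  rw [Complex.ofReal_inj, R0]
  field_simp
  ring

end Sigma2D

end

noncomputable section

namespace Sigma2D

open FourierTransform TemperedDistribution
open scoped ContDiff

/-! ### A temperate symbol for the second Taylor remainder of the Bessel function -/

/-- The `n`-th derivative of `besselJ`. -/
def besselDeriv (n : ℕ) : ℝ → ℝ := powerSum (derivCoeff^[n] besselCoeff)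

lemma decay_iterate_derivCoeff (n : ℕ) : FactorialDecay (derivCoeff^[n] besselCoeff) := by
  induction n with
  | zero => exact besselCoeff_decay
  | succ n ih => rw [Function.iterate_succ_apply']; exact ih.deriv

lemma hasDerivAt_besselDeriv (n : ℕ) (t : ℝ) :
    HasDerivAt (besselDeriv n) (besselDeriv (n + 1) t) t := by
  have h := (decay_iterate_derivCoeff n).hasDerivAt t
  rwa [← Function.iterate_succ_apply' derivCoeff n besselCoeff] at h

lemma continuous_besselDeriv (n : ℕ) : Continuous (besselDeriv n) :=
  (decay_iterate_derivCoeff n).continuous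

/-- Bessel's equation differentiated `n` times. -/
lemma besselDeriv_ode (n : ℕ) (t : ℝ) :
    4 * (t * besselDeriv (n + 2) t + (n + 1) * besselDeriv (n + 1) t) + besselDeriv n t = 0 := by
  induction n generalizing t with
  | zero =>
    have h := besselJ_ode t
    have h0 : besselDeriv 0 t = besselJ t := rfl
    have h1 : besselDeriv 1 t = besselJ' t := rfl
    have h2 : besselDeriv 2 t = besselJ'' t := rfl
    simp only [Nat.cast_zero, zero_add, h0, h1, h2]
    linarith
  | succ n ih =>
    have h1 := ((((hasDerivAt_id t).mul (hasDerivAt_besselDeriv (n + 2) t)).add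
      ((hasDerivAt_besselDeriv (n + 1) t).const_mul ((n : ℝ) + 1))).const_mul 4).add
      (hasDerivAt_besselDeriv n t)
    have h2 : HasDerivAt (fun _ : ℝ => (0 : ℝ)) 0 t := hasDerivAt_const t 0
    have h3 := h1.unique (h2.congr_of_eventuallyEq (Eventually.of_forall fun u => ih u))
    simp only [id] at h3
    push_cast
    linear_combination h3

/-- The energy `4 t (J⁽ⁿ⁺¹⁾)² + (J⁽ⁿ⁾)²` is nonincreasing by the differentiated equation, and at `t
= 0` only its second term remains. -/
lemma abs_besselDeriv_le (n : ℕ) {t : ℝ} (ht : 0 ≤ t) : |besselDeriv n t| ≤ |besselDeriv n 0| := by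
  set E : ℝ → ℝ := fun t => 4 * (t * besselDeriv (n + 1) t ^ 2) + besselDeriv n t ^ 2 with hE
  have dE : ∀ t, HasDerivAt E (-(8 * n + 4) * besselDeriv (n + 1) t ^ 2) t := by
    intro t
    refine ((((hasDerivAt_id t).mul ((hasDerivAt_besselDeriv (n + 1) t).pow 2)).const_mul 4).add
      ((hasDerivAt_besselDeriv n t).pow 2)).congr_deriv ?_
    simp only [id, Pi.pow_apply]
    push_cast
    linear_combination 2 * besselDeriv (n + 1) t * besselDeriv_ode n t
  have hanti : Antitone E := antitone_of_deriv_nonpos (fun t => (dE t).differentiableAt) fun t => by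
    rw [(dE t).deriv]
    have : 0 ≤ (8 * n + 4 : ℝ) * besselDeriv (n + 1) t ^ 2 := by positivity
    linarith
  have h := hanti ht
  simp only [hE, zero_mul, mul_zero, zero_add] at h
  refine sq_le_sq.1 (le_trans ?_ h)
  have : 0 ≤ 4 * (t * besselDeriv (n + 1) t ^ 2) := by positivity
  linarith

lemma exists_abs_besselDeriv_le (n : ℕ) (B : ℝ) : ∃ K, 0 ≤ K ∧ ∀ t, -B ≤ t → |besselDeriv n t| ≤ K := by
  obtain ⟨K, hK, h⟩ := exists_abs_le_of_continuous (continuous_besselDeriv n) (-B) 0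
  refine ⟨K + |besselDeriv n 0|, by positivity, fun t ht => ?_⟩
  rcases le_total t 0 with h0 | h0
  · exact (h t ht h0).trans (by linarith [abs_nonneg (besselDeriv n 0)])
  · exact (abs_besselDeriv_le n h0).trans (by linarith)

/-- The `n`-th derivative of `(J(v) - 1 + v / 4) / v²`. -/
def besselRemainder (n : ℕ) (v : ℝ) : ℝ :=
  ∫ s in (0 : ℝ)..1, (1 - s) * s ^ n * besselDeriv (n + 2) (v * s)

lemma continuous_besselRemainder_integrand (n m : ℕ) (v : ℝ) :
    Continuous fun s : ℝ => (1 - s) * s ^ n * besselDeriv m (v * s) :=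
  ((continuous_const.sub continuous_id).mul (continuous_id.pow n)).mul
    ((continuous_besselDeriv m).comp (continuous_const.mul continuous_id))

lemma hasDerivAt_besselRemainder (n : ℕ) (v : ℝ) :
    HasDerivAt (besselRemainder n) (besselRemainder (n + 1) v) v := by
  obtain ⟨K, hK, hb⟩ := exists_abs_le_of_continuous (continuous_besselDeriv (n + 3))
    (-(|v| + 1)) (|v| + 1)
  have h := intervalIntegral.hasDerivAt_integral_of_dominated_loc_of_deriv_le (μ := volume)
    (a := 0) (b := 1) (F := fun v s => (1 - s) * s ^ n * besselDeriv (n + 2) (v * s))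
    (F' := fun v s => (1 - s) * s ^ (n + 1) * besselDeriv (n + 3) (v * s)) (x₀ := v)
    (s := Metric.ball v 1) (bound := fun _ => K) (Metric.ball_mem_nhds v one_pos)
    (Eventually.of_forall fun x =>
      (continuous_besselRemainder_integrand n _ x).aestronglyMeasurable)
    ((continuous_besselRemainder_integrand n _ v).intervalIntegrable 0 1)
    (continuous_besselRemainder_integrand (n + 1) _ v).aestronglyMeasurable ?_ (by simp) ?_
  · exact h.2
  · refine ae_of_all _ fun s hs x hx => ?_
    rw [Set.uIoc_of_le zero_le_one] at hs
    have hx1 : |x| ≤ |v| + 1 := by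
      have h1 := Metric.mem_ball.1 hx
      rw [Real.dist_eq] at h1
      have := abs_sub_abs_le_abs_sub x v
      linarith
    have hxs : |x * s| ≤ |v| + 1 := by
      rw [abs_mul, abs_of_pos hs.1]
      nlinarith [abs_nonneg x, hs.1, hs.2]
    have h2 := hb (x * s) (abs_le.1 hxs).1 (abs_le.1 hxs).2
    rw [Real.norm_eq_abs, abs_mul, abs_of_nonneg (by
      have := hs.1; have : 0 ≤ 1 - s := by linarith [hs.2]
      positivity)]
    have h3 : (1 - s) * s ^ (n + 1) ≤ 1 := by
      have : s ^ (n + 1) ≤ 1 := pow_le_one₀ hs.1.le hs.2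
      have : 0 ≤ s ^ (n + 1) := pow_nonneg hs.1.le _
      nlinarith [hs.1, hs.2]
    calc (1 - s) * s ^ (n + 1) * |besselDeriv (n + 3) (x * s)| ≤ 1 * K := by gcongr
      _ = K := one_mul K
  · refine ae_of_all _ fun s _ x _ => ?_
    have h1 := (hasDerivAt_besselDeriv (n + 2) (x * s)).comp x ((hasDerivAt_id x).mul_const s)
    refine (h1.const_mul ((1 - s) * s ^ n)).congr_deriv ?_
    ring

lemma exists_abs_besselRemainder_le (n : ℕ) {B : ℝ} (hB : 0 ≤ B) :
    ∃ K, 0 ≤ K ∧ ∀ v, -B ≤ v → |besselRemainder n v| ≤ K := by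
  obtain ⟨K, hK, h⟩ := exists_abs_besselDeriv_le (n + 2) B
  refine ⟨K, hK, fun v hv => ?_⟩
  have := intervalIntegral.norm_integral_le_of_norm_le_const (a := 0) (b := 1) (C := K)
    (f := fun s => (1 - s) * s ^ n * besselDeriv (n + 2) (v * s)) fun s hs => by
      rw [Set.uIoc_of_le zero_le_one] at hs
      have h2 := h (v * s) (by nlinarith [hs.1, hs.2])
      rw [Real.norm_eq_abs, abs_mul, abs_of_nonneg (by
        have := hs.1; have : 0 ≤ 1 - s := by linarith [hs.2]
        positivity)]
      have h3 : (1 - s) * s ^ n ≤ 1 := by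
        have : s ^ n ≤ 1 := pow_le_one₀ hs.1.le hs.2
        have : 0 ≤ s ^ n := pow_nonneg hs.1.le _
        nlinarith [hs.1, hs.2]
      calc (1 - s) * s ^ n * |besselDeriv (n + 2) (v * s)| ≤ 1 * K := by gcongr
        _ = K := one_mul K
  rw [sub_zero, abs_one, mul_one] at this
  exact this

/-- Taylor's formula with integral remainder, with `J(0) = 1` and `J'(0) = -1/4`. The integral form
shows that the quotient by `v²` is smooth. -/
lemma besselRemainder_apply (v : ℝ) : v ^ 2 * besselRemainder 0 v = besselJ v - 1 + v / 4 := by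
  have hd : ∀ s : ℝ, HasDerivAt (fun s => (1 - s) * (v * besselDeriv 1 (v * s)) +
      besselDeriv 0 (v * s)) (v ^ 2 * ((1 - s) * s ^ 0 * besselDeriv 2 (v * s))) s := by
    intro s
    have h0 := hasDerivAt_comp_mul (hasDerivAt_besselDeriv 0) v s
    have h1 := hasDerivAt_comp_mul (hasDerivAt_besselDeriv 1) v s
    refine ((((hasDerivAt_id s).const_sub 1).mul (h1.const_mul v)).add h0).congr_deriv ?_
    simp only [id]
    ring
  have h := intervalIntegral.integral_eq_sub_of_hasDerivAt (a := 0) (b := 1) (fun s _ => hd s)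
    ((continuous_const.mul (continuous_besselRemainder_integrand 0 2 v)).intervalIntegrable 0 1)
  rw [intervalIntegral.integral_const_mul] at h
  rw [besselRemainder, h]
  have h1 : besselDeriv 1 0 = -1 / 4 := by
    rw [besselDeriv, powerSum_zero]
    simp [derivCoeff, besselCoeff]
  have h0 : besselDeriv 0 = besselJ := rfl
  simp only [mul_one, mul_zero, sub_self, zero_mul, zero_add, sub_zero, one_mul, h0, h1,
    besselJ_zero]
  ring

lemma iteratedDeriv_besselRemainder (n : ℕ) : iteratedDeriv n (besselRemainder 0) = besselRemainder n := by
  induction n with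
  | zero => exact iteratedDeriv_zero
  | succ n ih =>
    rw [iteratedDeriv_succ, ih]
    ext v
    exact (hasDerivAt_besselRemainder n v).deriv

lemma contDiff_besselRemainder : ContDiff ℝ ∞ (besselRemainder 0) := by
  refine contDiff_of_differentiable_iteratedDeriv fun n _ v => ?_
  rw [iteratedDeriv_besselRemainder]
  exact (hasDerivAt_besselRemainder n v).differentiableAt

/-- The symbol `(J(v) - 1 + v / 4) / v²` with `v = |2πξ|² - l`. -/
def remainderSymbol (l : ℝ) (ξ : Plane) : ℂ := (besselRemainder 0 (laplaceSymbol ξ - l) : ℂ)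

lemma laplaceSymbol_nonneg (ξ : Plane) : 0 ≤ laplaceSymbol ξ := sq_nonneg _

/-- For negative argument `J` grows like an exponential of the square root, but `w - l ≥ -|l|`.
Bounds for the derivatives are therefore needed only on a half-line, where the energy estimate
supplies them. -/
lemma hasTemperateGrowth_remainderSymbol (l : ℝ) : (remainderSymbol l).HasTemperateGrowth := by
  refine Function.Complex.hasTemperateGrowth_ofReal.comp ?_
  have hu : UniqueDiffOn ℝ (Set.Ioi (-(|l| + 1))) := isOpen_Ioi.uniqueDiffOn
  refine Function.HasTemperateGrowth.comp' (g := besselRemainder 0)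
    (f := fun ξ => laplaceSymbol ξ - l) (t := Set.Ioi (-(|l| + 1))) ?_ hu
    contDiff_besselRemainder.contDiffOn ?_
    (hasTemperateGrowth_laplaceSymbol.sub (Function.HasTemperateGrowth.const l))
  · rintro _ ⟨ξ, rfl⟩
    have := laplaceSymbol_nonneg ξ
    have := le_abs_self l
    show -(|l| + 1) < laplaceSymbol ξ - l
    linarith
  · intro N
    choose K hK h using fun n => exists_abs_besselRemainder_le n (B := |l| + 1) (by positivity)
    -- Each derivative is bounded on the half-line, so degree `0` suffices, with one constant for
    -- all orders up to `N`.
    refine ⟨0, ∑ n ∈ Finset.range (N + 1), K n, Finset.sum_nonneg fun n _ => hK n,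
      fun n hn x hx => ?_⟩
    rw [iteratedFDerivWithin_eq_iteratedFDeriv hu
      ((contDiff_besselRemainder.of_le (by exact_mod_cast le_top)).contDiffAt) hx,
      norm_iteratedFDeriv_eq_norm_iteratedDeriv, iteratedDeriv_besselRemainder, pow_zero, mul_one]
    exact (h n x (le_of_lt hx)).trans (Finset.single_le_sum (f := K) (fun i _ => hK i)
      (Finset.mem_range.2 (by omega)))

lemma integrable_greenKernel (a l : ℝ) : Integrable fun x : Plane => (greenKernel a l ‖x‖ : ℂ) := by
  obtain ⟨C, hC⟩ := exists_bound_greenKernel a l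
  exact integrable_radial (measurable_greenKernel a l) (fun _ h => greenKernel_eq_zero h) hC

lemma hasTemperateGrowth_greenSymbol (a l : ℝ) : (greenSymbol a l).HasTemperateGrowth := by
  obtain ⟨C, hC⟩ := exists_bound_greenKernel a l
  exact hasTemperateGrowth_fourier (integrable_pow_mul_radial (measurable_greenKernel a l)
    (fun _ h => greenKernel_eq_zero h) hC) (integrable_greenKernel a l).aestronglyMeasurable

/-- Both sides agree after multiplication by `w - l`. This vanishes at most on a circle, which is a
null set, and both sides are continuous. -/
lemma greenSymbol_eq_remainder (l : ℝ) : greenSymbol 1 l =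
    fun ξ => (-1 / 4 : ℂ) + helmholtzSymbol l ξ * remainderSymbol l ξ := by
  have hc : Continuous fun ξ => (-1 / 4 : ℂ) + helmholtzSymbol l ξ * remainderSymbol l ξ :=
    continuous_const.add ((hasTemperateGrowth_helmholtzSymbol l).1.continuous.mul
      (hasTemperateGrowth_remainderSymbol l).1.continuous)
  refine ((hasTemperateGrowth_greenSymbol 1 l).1.continuous.ae_eq_iff_eq volume hc).1 ?_
  have hs : ∀ᵐ ξ : Plane, ξ ∉ Metric.sphere (0 : Plane) (√l / (2 * π)) :=
    measure_eq_zero_iff_ae_notMem.1 (Measure.addHaar_sphere volume 0 _)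
  filter_upwards [hs] with ξ hξ
  have hv : laplaceSymbol ξ - l ≠ 0 := by
    intro h
    apply hξ
    have h1 : l = (2 * π * ‖ξ‖) ^ 2 := by rw [laplaceSymbol] at h; linarith
    have hp := pi_pos
    rw [mem_sphere_zero_iff_norm, h1, Real.sqrt_sq (by positivity)]
    field_simp
  have h1 := greenSymbol_apply zero_le_one l ξ
  rw [one_pow, mul_one] at h1
  have h2 := besselRemainder_apply (laplaceSymbol ξ - l)
  have h3 : besselJ (laplaceSymbol ξ - l) - 1 = (laplaceSymbol ξ - l) *
      (-1 / 4 + (laplaceSymbol ξ - l) * besselRemainder 0 (laplaceSymbol ξ - l)) := by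
    linear_combination -h2
  rw [h3, Complex.ofReal_mul] at h1
  rw [mul_left_cancel₀ (Complex.ofReal_ne_zero.2 hv) h1, helmholtzSymbol, remainderSymbol]
  push_cast
  ring

/-- Every solution of the Helmholtz equation is reproduced by the multiplier `greenSymbol 1 l`. -/
lemma multiplier_greenSymbol_of_solution {l : ℝ} {T : 𝓢'(Plane, ℂ)}
    (hT : fourierMultiplierCLM ℂ (helmholtzSymbol l) T = 0) :
    fourierMultiplierCLM ℂ (greenSymbol 1 l) T = (-1 / 4 : ℂ) • T := by
  have h1 := hasTemperateGrowth_helmholtzSymbol l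
  have h2 := hasTemperateGrowth_remainderSymbol l
  have h := multiplier_add (.const (-1 / 4 : ℂ)) (h1.mul h2) T
  rw [greenSymbol_eq_remainder]
  refine h.trans ?_
  rw [multiplier_const]
  refine (congrArg _ (multiplier_mul h1 h2 T)).trans ?_
  rw [hT, map_zero, add_zero]

/-! ### Removable singularities of solutions of the Helmholtz equation -/

lemma multiplier_fourier_apply {k : Plane → ℂ} (hk : Integrable k)
    (hg : (𝓕 k : Plane → ℂ).HasTemperateGrowth) {T : 𝓢'(Plane, ℂ)} {h : Plane → ℂ}
    (hT : Represents T h) (φ : 𝓢(Plane, ℂ)) :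
    fourierMultiplierCLM ℂ (𝓕 k) T φ = ∫ y, (∫ x, φ x * k (x - y)) * h y := by
  rw [fourierMultiplierCLM_apply_apply, (hT _).2]
  congr 1; ext y
  rw [← (multiplier_fourier_delta hk hg y φ).2, fourierMultiplierCLM_apply_apply, delta_apply]

/-- Dominated convergence; `h (x - z)` is discontinuous in `x` at `x₀` at most for `z = x₀`, a null
set. -/
lemma continuous_convolution_of_locally_bounded {k h : Plane → ℂ} (hk : Integrable k) {a : ℝ}
    (hsupp : ∀ z, a < ‖z‖ → k z = 0) (hloc : ∀ R, ∃ C, ∀ x, ‖x‖ ≤ R → ‖h x‖ ≤ C)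
    (hc : ContinuousOn h {0}ᶜ) : Continuous fun x => ∫ z, k z * h (x - z) := by
  have hm : Measurable h := measurable_of_continuousOn_compl_singleton 0 hc
  refine continuous_iff_continuousAt.2 fun x₀ => ?_
  obtain ⟨C, hC⟩ := hloc (‖x₀‖ + 1 + a)
  refine continuousAt_of_dominated (bound := fun z => ‖k z‖ * C) ?_ ?_ (hk.norm.mul_const C) ?_
  · exact Eventually.of_forall fun x => hk.aestronglyMeasurable.mul
      (hm.comp (measurable_const.sub measurable_id)).aestronglyMeasurable
  · filter_upwards [Metric.ball_mem_nhds x₀ one_pos] with x hx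
    refine ae_of_all _ fun z => ?_
    rw [norm_mul]
    rcases lt_or_ge a ‖z‖ with hz | hz
    · simp [hsupp z hz]
    · gcongr
      refine hC _ ?_
      have h1 : ‖x - x₀‖ < 1 := by rwa [← dist_eq_norm]
      have h2 := norm_sub_le x z
      have h3 := norm_sub_norm_le x x₀
      linarith
  · filter_upwards [ae_ne_point x₀] with z hz
    have h1 : ContinuousAt h (x₀ - z) :=
      hc.continuousAt (isOpen_compl_singleton.mem_nhds (sub_ne_zero.2 hz.symm))
    have h2 : ContinuousAt (fun x : Plane => x - z) x₀ := by fun_prop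
    exact continuousAt_const.mul (ContinuousAt.comp (g := h) (f := fun x => x - z) h1 h2)

/-- Fubini applies although `h` may grow at infinity, because the supports of `φ` and `k` confine
`y` to a bounded set. -/
lemma integral_convolution_swap {k h φ : Plane → ℂ} (hk : Integrable k) {a R : ℝ}
    (hsupp : ∀ z, a < ‖z‖ → k z = 0) (heven : ∀ z, k (-z) = k z)
    (hloc : ∀ R, ∃ C, ∀ x, ‖x‖ ≤ R → ‖h x‖ ≤ C) (hm : Measurable h) (hφ : Integrable φ)
    (hφR : ∀ x, R < ‖x‖ → φ x = 0) :
    ∫ y, (∫ x, φ x * k (x - y)) * h y = ∫ x, φ x * ∫ z, k z * h (x - z) := by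
  obtain ⟨C, hC⟩ := hloc (R + a)
  have hC' : ∀ y x, φ x * k (x - y) ≠ 0 → ‖h y‖ ≤ C := by
    intro y x hxy
    have h1 : ‖x‖ ≤ R := not_lt.1 fun h => hxy (by rw [hφR x h, zero_mul])
    have h2 : ‖x - y‖ ≤ a := not_lt.1 fun h => hxy (by rw [hsupp _ h, mul_zero])
    refine hC y ?_
    have := norm_sub_norm_le y x
    rw [norm_sub_rev] at this
    linarith
  have hconv : Integrable (fun p : Plane × Plane => φ p.2 * k (p.2 - p.1)) (volume.prod volume) := by
    have := hφ.convolution_integrand (ContinuousLinearMap.mul ℝ ℂ) hk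
    refine this.congr (ae_of_all _ fun p => ?_)
    simp only [ContinuousLinearMap.mul_apply']
    rw [← heven (p.1 - p.2), neg_sub]
  have hint : Integrable (fun p : Plane × Plane => φ p.2 * k (p.2 - p.1) * h p.1)
      (volume.prod volume) := by
    refine (hconv.norm.mul_const C).mono' (hconv.aestronglyMeasurable.mul
      (hm.comp measurable_fst).aestronglyMeasurable) (ae_of_all _ fun p => ?_)
    rw [norm_mul]
    by_cases h0 : φ p.2 * k (p.2 - p.1) = 0
    · simp [h0]
    · gcongr
      exact hC' _ _ h0
  calc ∫ y, (∫ x, φ x * k (x - y)) * h y = ∫ y, ∫ x, φ x * k (x - y) * h y := by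
        congr 1; ext y; rw [integral_mul_const]
    _ = ∫ x, ∫ y, φ x * k (x - y) * h y := integral_integral_swap hint
    _ = _ := by
        congr 1; ext x
        simp only [mul_assoc]
        rw [integral_const_mul, ← integral_sub_left_eq_self _ volume x]
        simp only [sub_sub_cancel]

/-- A locally bounded distributional solution of the Helmholtz equation, continuous off the origin,
agrees almost everywhere with a continuous function. -/
lemma exists_continuous_of_solution {l : ℝ} {T : 𝓢'(Plane, ℂ)} {h : Plane → ℂ}
    (hT : Represents T h) (hloc : ∀ R, ∃ C, ∀ x, ‖x‖ ≤ R → ‖h x‖ ≤ C)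
    (hc : ContinuousOn h {0}ᶜ) (hsol : fourierMultiplierCLM ℂ (helmholtzSymbol l) T = 0) :
    ∃ u : Plane → ℂ, Continuous u ∧ ∀ x, x ≠ 0 → h x = u x := by
  set k : Plane → ℂ := fun x => (greenKernel 1 l ‖x‖ : ℂ) with hkdef
  have hk : Integrable k := integrable_greenKernel 1 l
  have hsupp : ∀ z, 1 < ‖z‖ → k z = 0 := fun z hz => by
    rw [hkdef]; simp only [greenKernel_eq_zero hz, Complex.ofReal_zero]
  have hm : Measurable h := measurable_of_continuousOn_compl_singleton 0 hc
  have hu := continuous_convolution_of_locally_bounded hk hsupp hloc hc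
  -- Convolution with `k` acts on solutions as `-1/4`, so `h` must equal `-4 (k ∗ h)` almost
  -- everywhere.
  set u : Plane → ℂ := fun x => -4 * ∫ z, k z * h (x - z) with hudef
  have huc : Continuous u := continuous_const.mul hu
  have hli : LocallyIntegrable h := by
    refine (locallyIntegrable_iff).2 fun K hK => ?_
    obtain ⟨R, hR⟩ := hK.isBounded.exists_norm_le
    obtain ⟨C, hC⟩ := hloc R
    refine Measure.integrableOn_of_bounded (M := C) hK.measure_lt_top.ne hm.aestronglyMeasurable ?_
    exact (ae_restrict_iff' hK.measurableSet).2 (ae_of_all _ fun x hx => hC x (hR x hx))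
  have hae : ∀ᵐ x, h x = u x := by
    refine ae_eq_of_integral_contDiff_smul_eq hli huc.locallyIntegrable fun g hg hgs => ?_
    have hg' : ContDiff ℝ ∞ fun x => (g x : ℂ) := Complex.ofRealCLM.contDiff.comp hg
    have hgs' : HasCompactSupport fun x => (g x : ℂ) := hgs.comp_left Complex.ofReal_zero
    set φ : 𝓢(Plane, ℂ) := hgs'.toSchwartzMap hg'
    have hφ : ∀ x, φ x = g x := fun x => rfl
    obtain ⟨R, hR⟩ := hgs.isBounded.exists_norm_le
    have h1 := multiplier_fourier_apply hk (hasTemperateGrowth_greenSymbol 1 l) hT φ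
    have h2 : fourierMultiplierCLM ℂ (greenSymbol 1 l) T φ = (-1 / 4 : ℂ) * T φ := by
      rw [multiplier_greenSymbol_of_solution hsol]; rfl
    have h3 : fourierMultiplierCLM ℂ (greenSymbol 1 l) T φ =
      fourierMultiplierCLM ℂ (𝓕 k) T φ := rfl
    rw [integral_convolution_swap (R := R) hk hsupp (fun z => by rw [hkdef]; simp only [norm_neg])
      hloc hm φ.integrable (fun x hx => by
        rw [hφ, image_eq_zero_of_notMem_tsupport fun h => not_lt.2 (hR x h) hx,
          Complex.ofReal_zero]), ← h3, h2, (hT φ).2] at h1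
    have h4 : ∀ f : Plane → ℂ, ∫ x, g x • f x = ∫ x, φ x * f x := fun f => by
      congr 1
    rw [h4, h4]
    have h5 : ∫ x, φ x * u x = -4 * ∫ x, φ x * ∫ z, k z * h (x - z) := by
      rw [← integral_const_mul]
      congr 1; ext x
      rw [hudef]; ring
    rw [h5, ← h1]
    ring
  refine ⟨u, huc, fun x hx => ?_⟩
  have := Measure.eqOn_open_of_ae_eq (μ := (volume : Measure Plane)) (U := {0}ᶜ)
    (ae_restrict_of_ae hae) isOpen_compl_singleton hc huc.continuousOn
  exact this hx

end Sigma2D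

end

noncomputable section

namespace Sigma2D

open FourierTransform TemperedDistribution

/-! ### Expansion of the fundamental solution in the spectral parameter -/

lemma FactorialDecay.shift_two {c : ℕ → ℝ} (hc : FactorialDecay c) :
    FactorialDecay fun n => c (n + 2) := by
  obtain ⟨C, hC⟩ := hc
  have hC0 : 0 ≤ C := by
    have := (abs_nonneg _).trans (hC 0)
    simpa using this
  refine ⟨C, fun n => (hC (n + 2)).trans ?_⟩
  gcongr
  omega

lemma FactorialDecay.powerSum_eq {c : ℕ → ℝ} (hc : FactorialDecay c) (t : ℝ) :
    powerSum c t = c 0 + c 1 * t + t ^ 2 * powerSum (fun n => c (n + 2)) t := by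
  have h1 := (hasSum_nat_add_iff' 2).2 (hc.hasSum t)
  have h2 := (hc.shift_two.hasSum t).mul_left (t ^ 2)
  have h3 := h1.unique (h2.congr_fun fun n => by ring)
  simp only [Finset.sum_range_succ, Finset.sum_range_zero, pow_zero, pow_one, mul_one, zero_add] at h3
  linarith

/-- The remainder of `besselJ` after its linear Taylor polynomial, divided by `t ^ 2`. -/
def besselTail : ℝ → ℝ := powerSum fun n => besselCoeff (n + 2)

/-- The remainder of `neumannY` after its linear Taylor polynomial, divided by `t ^ 2`. -/
def neumannTail : ℝ → ℝ := powerSum fun n => neumannCoeff (n + 2)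

lemma continuous_besselTail : Continuous besselTail := besselCoeff_decay.shift_two.continuous

lemma continuous_neumannTail : Continuous neumannTail := neumannCoeff_decay.shift_two.continuous

lemma besselJ_eq_tail (t : ℝ) : besselJ t = 1 - t / 4 + t ^ 2 * besselTail t := by
  rw [besselJ, besselCoeff_decay.powerSum_eq]
  simp [besselCoeff, besselTail]
  ring

lemma neumannY_eq_tail (t : ℝ) : neumannY t = -t / 4 + t ^ 2 * neumannTail t := by
  rw [neumannY, neumannCoeff_decay.powerSum_eq]
  simp [neumannCoeff, besselCoeff, neumannTail, harmonic]
  ring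

/-- `t * log (t * M ^ 2)`, as a continuous function. -/
def mulLog (M t : ℝ) : ℝ := t * log t + t * log (M ^ 2)

lemma continuous_mulLog (M : ℝ) : Continuous (mulLog M) := continuous_mul_log_add M

lemma mulLog_eq {M t : ℝ} (hM : 0 < M) (ht : 0 < t) : mulLog M t = t * log (t * M ^ 2) :=
  (mul_log_mul hM ht).symm

/-- The remainder of the expansion of `fundSol` to first order in `l`, divided by `l ^ 2`. -/
def fundSolTail (M l t : ℝ) : ℝ :=
  -(1 / (4 * π)) * (t * mulLog M t * besselTail (l * t) - 2 * t ^ 2 * neumannTail (l * t))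

lemma continuous_fundSolTail (M : ℝ) : Continuous fun p : ℝ × ℝ => fundSolTail M p.1 p.2 := by
  have h1 := continuous_besselTail
  have h2 := continuous_neumannTail
  have h3 := continuous_mulLog M
  unfold fundSolTail
  fun_prop

lemma fundSol_eq {M t : ℝ} (hM : 0 < M) (l : ℝ) (ht : 0 < t) :
    fundSol M l t = -(1 / (4 * π)) * log (t * M ^ 2) + l * ((mulLog M t - 2 * t) / (16 * π)) +
      l ^ 2 * fundSolTail M l t := by
  rw [fundSol, besselJ_eq_tail, neumannY_eq_tail, fundSolTail, mulLog_eq hM ht]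
  field_simp
  ring

/-- The zeroth and first Taylor coefficients in `l` of the fundamental solution are exactly `R₀` and
`R₁`, and the remainder is jointly continuous, including at `x = 0`. -/
lemma fundSol_norm_sq {M : ℝ} (hM : 0 < M) (l : ℝ) {x : Plane} (hx : x ≠ 0) :
    fundSol M l (‖x‖ ^ 2) = R0 M x + l * R1 M x + l ^ 2 * fundSolTail M l (‖x‖ ^ 2) := by
  have hx' : 0 < ‖x‖ := norm_pos_iff.2 hx
  rw [fundSol_eq hM l (by positivity), R0, R1, mulLog_eq hM (by positivity)]
  ring

/-! ### The smoothed fundamental solution -/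

lemma greenCorrection_zero {a m : ℝ} (hm : 0 ≤ m) (hma : m ≤ a) :
    greenCorrection a 0 m = a ^ 2 / 4 - m ^ 2 / 4 - m ^ 2 / 2 * (log a - log m) := by
  have hl := continuous_mul_log_sub a
  have hc : Continuous fun r : ℝ => r / 2 * (r * (log a - log r)) + r ^ 2 / 4 := by fun_prop
  have h := intervalIntegral.integral_eq_sub_of_hasDerivAt_of_le hma hc.continuousOn
    (f' := fun r => r * (log a - log r) * sonineN (0 * (r ^ 2 - m ^ 2))) (fun r hr => by
      have hr0 : r ≠ 0 := (hm.trans_lt hr.1).ne'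
      refine ((((hasDerivAt_id r).div_const 2).mul ((hasDerivAt_id r).mul
        ((Real.hasDerivAt_log hr0).const_sub (log a)))).add
        ((hasDerivAt_pow 2 r).div_const 4)).congr_deriv ?_
      simp only [id, Pi.mul_apply, zero_mul, sonineN_zero]
      field_simp
      ring)
    (Continuous.intervalIntegrable (by simp only [zero_mul]; fun_prop) _ _)
  rw [greenCorrection, h]
  ring

/-- The first order coefficient in `l` of the smoothed fundamental solution. -/
def smoothedSlope (M a l : ℝ) (x : Plane) : ℝ :=
  (mulLog M (‖x‖ ^ 2) - 2 * ‖x‖ ^ 2) / (16 * π) + l * fundSolTail M l (‖x‖ ^ 2) -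
    1 / (4 * π) * greenCorrection a l (min ‖x‖ a)

lemma continuous_smoothedSlope (M a : ℝ) :
    Continuous fun p : ℝ × Plane => smoothedSlope M a p.1 p.2 := by
  have h1 : Continuous fun p : ℝ × Plane => fundSolTail M p.1 (‖p.2‖ ^ 2) :=
    (continuous_fundSolTail M).comp (g := fun p : ℝ × ℝ => fundSolTail M p.1 p.2)
      (f := fun p : ℝ × Plane => (p.1, ‖p.2‖ ^ 2)) (by fun_prop)
  have h2 : Continuous fun p : ℝ × Plane => greenCorrection a p.1 (min ‖p.2‖ a) :=
    (continuous_greenCorrection a).comp (g := fun p : ℝ × ℝ => greenCorrection a p.1 p.2)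
      (f := fun p : ℝ × Plane => (p.1, min ‖p.2‖ a)) (by fun_prop)
  have h3 := continuous_mulLog M
  unfold smoothedSlope
  fun_prop

/-- This is how the kernel, which involves `log (min r a)`, trades the singular `log r` for `log
(max r a)`. -/
lemma log_add_log_eq {r a : ℝ} : log r + log a = log (max r a) + log (min r a) := by
  rcases le_total r a with h | h
  · rw [max_eq_right h, min_eq_left h, add_comm]
  · rw [max_eq_left h, min_eq_right h]

lemma R0_eq {M : ℝ} (hM : 0 < M) {x : Plane} (hx : x ≠ 0) :
    R0 M x = -(1 / (2 * π)) * (log ‖x‖ + log M) := by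
  have hx' : 0 < ‖x‖ := norm_pos_iff.2 hx
  rw [R0, Real.log_mul (by positivity) (by positivity), Real.log_pow, Real.log_pow]
  push_cast
  field_simp
  ring

lemma R0tilde_eq {M a : ℝ} (hM : 0 < M) (ha : 0 < a) (x : Plane) :
    R0tilde M a⁻¹ x = -(1 / (2 * π)) * (log (max ‖x‖ a) + log M) := by
  rw [R0tilde, one_div a⁻¹, inv_inv]
  split_ifs with h
  · have hx' : 0 < ‖x‖ := ha.trans h
    rw [max_eq_left h.le, Real.log_mul (by positivity) (by positivity), Real.log_pow, Real.log_pow]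
    push_cast
    field_simp
    ring
  · rw [max_eq_right (not_lt.1 h), Real.log_div (by positivity) hM.ne', Real.log_inv]
    field_simp
    ring

lemma continuous_R0tilde {M a : ℝ} (hM : 0 < M) (ha : 0 < a) : Continuous (R0tilde M a⁻¹) := by
  have h : R0tilde M a⁻¹ = fun x => -(1 / (2 * π)) * (log (max ‖x‖ a) + log M) :=
    funext (R0tilde_eq hM ha)
  rw [h]
  have h1 : Continuous fun x : Plane => log (max ‖x‖ a) :=
    Continuous.log (by fun_prop) fun x => (lt_max_of_lt_right ha).ne'
  fun_prop

/-- The smoothed fundamental solution is the continuous function below. -/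
lemma fundSol_add_greenKernel {M a : ℝ} (hM : 0 < M) (ha : 0 < a) (l : ℝ) {x : Plane} (hx : x ≠ 0) :
    fundSol M l (‖x‖ ^ 2) + greenKernel a l ‖x‖ =
      R0tilde M a⁻¹ x + l * smoothedSlope M a l x := by
  have hx' : 0 < ‖x‖ := norm_pos_iff.2 hx
  have h := log_add_log_eq (r := ‖x‖) (a := a)
  rw [fundSol_norm_sq hM l hx, R0tilde_eq hM ha, R0_eq hM hx, R1, smoothedSlope, greenKernel,
    mulLog_eq hM (by positivity)]
  have h2 : log ‖x‖ = log (max ‖x‖ a) + log (min ‖x‖ a) - log a := by linarith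
  rw [h2]
  field_simp
  ring

lemma smoothedSlope_zero {M a : ℝ} (hM : 0 < M) (ha : 0 < a) (x : Plane) :
    smoothedSlope M a 0 x = R1tilde M a⁻¹ x + R0hat M a⁻¹ x := by
  have hp := pi_pos
  rw [smoothedSlope, R1tilde, R0hat, one_div a⁻¹, inv_inv, inv_pow, one_div (a ^ 2)⁻¹, inv_inv,
    greenCorrection_zero (le_min (norm_nonneg x) ha.le) (min_le_right _ _)]
  by_cases h : a < ‖x‖
  · have hx' : 0 < ‖x‖ := ha.trans h
    rw [if_pos h, if_pos h, min_eq_right h.le, mulLog_eq hM (by positivity)]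
    field_simp
    ring
  · rw [if_neg h, if_neg h, min_eq_left (not_lt.1 h), Real.log_div (by positivity) hM.ne',
      Real.log_inv]
    rcases (norm_nonneg x).eq_or_lt with h0 | h0
    · rw [← h0, mulLog]
      simp
      field_simp
      ring
    · rw [mulLog, Real.log_pow, Real.log_pow]
      push_cast
      field_simp
      ring

/-- The three terms on the left correspond to `J = 1 - w a²/4 + w²·(kernel symbol)` applied to `R₁`,
using `-Δ R₁ = R₀` and `-Δ R₀ = δ`. -/
lemma R1_add_biharmonicKernel {M a : ℝ} (hM : 0 < M) (ha : 0 < a) {x : Plane} (hx : x ≠ 0) :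
    R1 M x - a ^ 2 / 4 * R0 M x + biharmonicKernel a ‖x‖ = R1tilde M a⁻¹ x := by
  have hp := pi_pos
  have hx' : 0 < ‖x‖ := norm_pos_iff.2 hx
  rw [R1, R0, R1tilde, biharmonicKernel, one_div a⁻¹, inv_inv, inv_pow, one_div (a ^ 2)⁻¹, inv_inv]
  by_cases h : a < ‖x‖
  · rw [if_pos h, min_eq_right h.le]
    field_simp
    ring
  · rw [if_neg h, min_eq_left (not_lt.1 h), Real.log_div (by positivity) hM.ne', Real.log_inv,
      Real.log_mul (by positivity) (by positivity), Real.log_pow, Real.log_pow]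
    push_cast
    field_simp
    ring

/-! ### The smoothed function `R₀` with a spectral shift -/

/-- Where the maximum vanishes so does the second coordinate, and there the function is dominated by
`|m log m|` with `m` the maximum. -/
lemma continuous_mul_log_max : Continuous fun p : ℝ × ℝ => p.2 * log (max p.1 |p.2|) := by
  refine continuous_iff_continuousAt.2 fun p => ?_
  have hm : Continuous fun p : ℝ × ℝ => max p.1 |p.2| := by fun_prop
  by_cases h : max p.1 |p.2| = 0
  · have h2 : p.2 = 0 := by
      have := le_max_right p.1 |p.2|
      rw [h] at this
      exact abs_nonpos_iff.1 this
    rw [ContinuousAt, h2, zero_mul]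
    have h3 : Tendsto (fun p : ℝ × ℝ => |max p.1 |p.2| * log (max p.1 |p.2|)|) (𝓝 p) (𝓝 0) := by
      have := ((Real.continuous_mul_log.comp hm).abs).tendsto p
      simpa [h] using this
    refine squeeze_zero_norm (fun q => ?_) h3
    rw [norm_mul, abs_mul, Real.norm_eq_abs, Real.norm_eq_abs]
    exact mul_le_mul_of_nonneg_right ((le_max_right _ _).trans (le_abs_self _)) (abs_nonneg _)
  · exact continuousAt_snd.mul (hm.continuousAt.log h)

/-- The coefficient of `l` in the smoothed function `R₀` with spectral shift `l`. -/
def shiftSlope (M a l : ℝ) (x : Plane) : ℝ :=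
  -(1 / (4 * π)) * ∫ r in (0 : ℝ)..a, (r * log (max ‖x‖ |r|) + r * log M) *
    sonineN (l * (a ^ 2 - r ^ 2))

lemma continuous_shiftSlope (M a : ℝ) :
    Continuous fun p : ℝ × Plane => shiftSlope M a p.1 p.2 := by
  have hN := continuous_sonineN
  refine continuous_const.mul (intervalIntegral.continuous_parametric_intervalIntegral_of_continuous'
    (f := fun (p : ℝ × Plane) (r : ℝ) => (r * log (max ‖p.2‖ |r|) + r * log M) *
      sonineN (p.1 * (a ^ 2 - r ^ 2))) ?_ 0 a)
  have h1 : Continuous fun q : (ℝ × Plane) × ℝ => q.2 * log (max ‖q.1.2‖ |q.2|) :=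
    continuous_mul_log_max.comp (g := fun p : ℝ × ℝ => p.2 * log (max p.1 |p.2|))
      (f := fun q : (ℝ × Plane) × ℝ => (‖q.1.2‖, q.2)) (by fun_prop)
  simp only [Function.uncurry_def]
  fun_prop

/-- By Sonine's integral the shifted Bessel operator of radius `a` is the unshifted one plus a
weighted average of those of radius `r ≤ a`. The operator of radius `r` turns `R₀` into `-(log (max
‖x‖ r) + log M) / (2π)`, whence the integrand of `shiftSlope`. -/
lemma R0_add_shiftKernel {M a : ℝ} (hM : 0 < M) (ha : 0 < a) (l : ℝ) {x : Plane} (hx : x ≠ 0) :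
    besselJ (-l * a ^ 2) * R0 M x + shiftKernel a l ‖x‖ =
      R0tilde M a⁻¹ x + l * shiftSlope M a l x := by
  have hN := continuous_sonineN
  have hw := continuous_shiftWeight a l
  have hx' : 0 < ‖x‖ := norm_pos_iff.2 hx
  have hm0 : 0 < min ‖x‖ a := lt_min hx' ha
  have hS := sonine 0 l ha.le
  simp only [zero_mul, besselJ_zero, one_mul, zero_sub] at hS
  have hlm : Continuous fun r : ℝ => r * log (max ‖x‖ |r|) :=
    continuous_mul_log_max.comp (g := fun p : ℝ × ℝ => p.2 * log (max p.1 |p.2|))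
      (f := fun r : ℝ => (‖x‖, r)) (by fun_prop)
  have hl := Real.continuous_mul_log
  set w : ℝ → ℝ := fun r => r * sonineN (l * (a ^ 2 - r ^ 2)) with hwdef
  -- The interval is split at `min ‖x‖ a`: below it the maximum is `‖x‖`, above it the maximum is
  -- `r`.
  have e1 : ∫ r in (0 : ℝ)..a, (r * log (max ‖x‖ |r|) + r * log M) * sonineN (l * (a ^ 2 - r ^ 2)) =
      log M * (∫ r in (0 : ℝ)..a, w r) + log ‖x‖ * (∫ r in (0 : ℝ)..(min ‖x‖ a), w r) +
        ∫ r in (min ‖x‖ a)..a, r * log r * sonineN (l * (a ^ 2 - r ^ 2)) := by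
    have e2 : ∫ r in (0 : ℝ)..a, (r * log (max ‖x‖ |r|) + r * log M) *
        sonineN (l * (a ^ 2 - r ^ 2)) = (∫ r in (0 : ℝ)..a, log M * w r) +
        ∫ r in (0 : ℝ)..a, r * log (max ‖x‖ |r|) * sonineN (l * (a ^ 2 - r ^ 2)) := by
      rw [← intervalIntegral.integral_add (Continuous.intervalIntegrable (by fun_prop) _ _)
        (Continuous.intervalIntegrable (by fun_prop) _ _)]
      refine intervalIntegral.integral_congr fun r _ => ?_
      simp only [hwdef]
      ring
    have hi : Continuous fun r => r * log (max ‖x‖ |r|) * sonineN (l * (a ^ 2 - r ^ 2)) := by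
      fun_prop
    rw [e2, intervalIntegral.integral_const_mul, ← intervalIntegral.integral_add_adjacent_intervals
      (hi.intervalIntegrable 0 (min ‖x‖ a)) (hi.intervalIntegrable (min ‖x‖ a) a), ← add_assoc]
    refine congrArg₂ (· + ·) (congrArg₂ (· + ·) rfl ?_) ?_
    · rw [← intervalIntegral.integral_const_mul]
      refine intervalIntegral.integral_congr fun r hr => ?_
      rw [Set.uIcc_of_le hm0.le] at hr
      simp only [hwdef]
      rw [abs_of_nonneg hr.1, max_eq_left (hr.2.trans (min_le_left _ _))]
      ring
    · rcases le_or_gt ‖x‖ a with h | h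
      · refine intervalIntegral.integral_congr fun r hr => ?_
        rw [min_eq_left h, Set.uIcc_of_le h] at hr
        rw [abs_of_nonneg (hx'.le.trans hr.1), max_eq_right hr.1]
      · rw [min_eq_right h.le, intervalIntegral.integral_same, intervalIntegral.integral_same]
  have e3 : ∫ ρ in (0 : ℝ)..a, ρ * sonineN (l * (a ^ 2 - ρ ^ 2)) = (∫ r in (0 : ℝ)..(min ‖x‖ a), w r) +
      ∫ r in (min ‖x‖ a)..a, w r :=
    (intervalIntegral.integral_add_adjacent_intervals (hw.intervalIntegrable _ _)
      (hw.intervalIntegrable _ _)).symm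
  -- Outside the disk the interval of integration is degenerate, so the logarithms need to agree
  -- only inside.
  have e4 : log ‖x‖ * (∫ r in (min ‖x‖ a)..a, w r) = log (min ‖x‖ a) * ∫ r in (min ‖x‖ a)..a, w r := by
    rcases le_or_gt ‖x‖ a with h | h
    · rw [min_eq_left h]
    · rw [min_eq_right h.le, intervalIntegral.integral_same, mul_zero, mul_zero]
  have h := log_add_log_eq (r := ‖x‖) (a := a)
  rw [hS, shiftSlope, e1, R0_eq hM hx, R0tilde_eq hM ha, shiftKernel, shiftCorrection_eq, e3]
  have h2 : log (max ‖x‖ a) = log ‖x‖ + log a - log (min ‖x‖ a) := by linarith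
  rw [h2]
  change _ + -(1 / (2 * π)) * (_ + l / 2 * (_ - log (min ‖x‖ a) * ∫ r in (min ‖x‖ a)..a, w r)) = _
  rw [← e4]
  field_simp
  ring

lemma shiftSlope_zero {M a : ℝ} (hM : 0 < M) (ha : 0 < a) (x : Plane) :
    shiftSlope M a 0 x = R0hat M a⁻¹ x := by
  have hp := pi_pos
  have hm0 : 0 ≤ min ‖x‖ a := le_min (norm_nonneg x) ha.le
  have hlm : Continuous fun r : ℝ => r * log (max ‖x‖ |r|) :=
    continuous_mul_log_max.comp (g := fun p : ℝ × ℝ => p.2 * log (max p.1 |p.2|))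
      (f := fun r : ℝ => (‖x‖, r)) (by fun_prop)
  have hi : Continuous fun r => r * log (max ‖x‖ |r|) + r * log M := by fun_prop
  have hl := Real.continuous_mul_log
  have e1 : ∫ r in (0 : ℝ)..(min ‖x‖ a), (r * log (max ‖x‖ |r|) + r * log M) =
      (log ‖x‖ + log M) * (min ‖x‖ a ^ 2 / 2) := by
    have : ∫ r in (0 : ℝ)..(min ‖x‖ a), (r * log (max ‖x‖ |r|) + r * log M) =
        ∫ r in (0 : ℝ)..(min ‖x‖ a), (log ‖x‖ + log M) * r := by
      refine intervalIntegral.integral_congr fun r hr => ?_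
      rw [Set.uIcc_of_le hm0] at hr
      rw [abs_of_nonneg hr.1, max_eq_left (hr.2.trans (min_le_left _ _))]
      ring
    rw [this, intervalIntegral.integral_const_mul, integral_id]
    ring
  have hc : Continuous fun r : ℝ => r / 2 * (r * log r) - r ^ 2 / 4 + log M * (r ^ 2 / 2) := by
    fun_prop
  have e2 : ‖x‖ ≤ a → ∫ r in (min ‖x‖ a)..a, (r * log (max ‖x‖ |r|) + r * log M) =
      (a ^ 2 / 2 * log a - a ^ 2 / 4 + log M * (a ^ 2 / 2)) -
        (‖x‖ ^ 2 / 2 * log ‖x‖ - ‖x‖ ^ 2 / 4 + log M * (‖x‖ ^ 2 / 2)) := by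
    intro h
    have h1 := intervalIntegral.integral_eq_sub_of_hasDerivAt_of_le h hc.continuousOn
      (f' := fun r => r * log r + r * log M) (fun r hr => by
        have hr0 : r ≠ 0 := ((norm_nonneg x).trans_lt hr.1).ne'
        refine (((((hasDerivAt_id r).div_const 2).mul ((hasDerivAt_id r).mul
          (Real.hasDerivAt_log hr0))).sub ((hasDerivAt_pow 2 r).div_const 4)).add
          (((hasDerivAt_pow 2 r).div_const 2).const_mul (log M))).congr_deriv ?_
        simp only [id, Pi.mul_apply]
        field_simp
        ring) (Continuous.intervalIntegrable (by fun_prop) _ _)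
    rw [min_eq_left h]
    have h2 : ∫ r in ‖x‖..a, (r * log (max ‖x‖ |r|) + r * log M) =
        ∫ r in ‖x‖..a, (r * log r + r * log M) := by
      refine intervalIntegral.integral_congr fun r hr => ?_
      rw [Set.uIcc_of_le h] at hr
      rw [abs_of_nonneg ((norm_nonneg x).trans hr.1), max_eq_right hr.1]
    rw [h2, h1]
    ring
  rw [shiftSlope]
  simp only [zero_mul, sonineN_zero, mul_one]
  rw [← intervalIntegral.integral_add_adjacent_intervals (hi.intervalIntegrable 0 (min ‖x‖ a))
    (hi.intervalIntegrable (min ‖x‖ a) a), e1, R0hat, one_div a⁻¹, inv_inv, inv_pow,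
    one_div (a ^ 2)⁻¹, inv_inv]
  by_cases h : a < ‖x‖
  · have hx' : 0 < ‖x‖ := ha.trans h
    rw [if_pos h, min_eq_right h.le, intervalIntegral.integral_same,
      Real.log_mul (by positivity) (by positivity), Real.log_pow, Real.log_pow]
    push_cast
    field_simp
    ring
  · rw [if_neg h, e2 (not_lt.1 h), min_eq_left (not_lt.1 h), Real.log_div (by positivity) hM.ne',
      Real.log_inv]
    field_simp
    ring

end Sigma2D

end

noncomputable section

namespace Sigma2D

open FourierTransform TemperedDistribution

/-! ### Bessel multipliers -/

/-- The symbol `J₀(a √(w - l))`, where `w = |2πξ|²`. -/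
def besselSymbol (a l : ℝ) (ξ : Plane) : ℂ := (besselJ ((laplaceSymbol ξ - l) * a ^ 2) : ℂ)

lemma hasTemperateGrowth_shiftSymbol (a l : ℝ) : (shiftSymbol a l).HasTemperateGrowth := by
  obtain ⟨C, hC⟩ := exists_bound_shiftKernel a l
  exact hasTemperateGrowth_fourier (integrable_pow_mul_radial (measurable_shiftKernel a l)
    (fun _ h => shiftKernel_eq_zero h) hC) (integrable_radial (measurable_shiftKernel a l)
      (fun _ h => shiftKernel_eq_zero h) hC).aestronglyMeasurable

lemma hasTemperateGrowth_biharmonicSymbol (a : ℝ) : (biharmonicSymbol a).HasTemperateGrowth := by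
  obtain ⟨C, hC⟩ := exists_bound_biharmonicKernel a
  exact hasTemperateGrowth_fourier (integrable_pow_mul_radial (measurable_biharmonicKernel a)
    (fun _ h => biharmonicKernel_eq_zero h) hC) (integrable_radial (measurable_biharmonicKernel a)
      (fun _ h => biharmonicKernel_eq_zero h) hC).aestronglyMeasurable

lemma multiplier_greenSymbol_delta (a l : ℝ) (y : Plane) :
    Represents (fourierMultiplierCLM ℂ (greenSymbol a l) (delta y))
      fun x => (greenKernel a l ‖x - y‖ : ℂ) :=
  multiplier_fourier_delta (integrable_greenKernel a l) (hasTemperateGrowth_greenSymbol a l) y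

lemma multiplier_shiftSymbol_delta (a l : ℝ) (y : Plane) :
    Represents (fourierMultiplierCLM ℂ (shiftSymbol a l) (delta y))
      fun x => (shiftKernel a l ‖x - y‖ : ℂ) := by
  obtain ⟨C, hC⟩ := exists_bound_shiftKernel a l
  exact multiplier_fourier_delta (integrable_radial (measurable_shiftKernel a l)
      (fun _ h => shiftKernel_eq_zero h) hC) (hasTemperateGrowth_shiftSymbol a l) y

lemma multiplier_biharmonicSymbol_delta (a : ℝ) (y : Plane) :
    Represents (fourierMultiplierCLM ℂ (biharmonicSymbol a) (delta y))
      fun x => (biharmonicKernel a ‖x - y‖ : ℂ) := by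
  obtain ⟨C, hC⟩ := exists_bound_biharmonicKernel a
  exact multiplier_fourier_delta (integrable_radial (measurable_biharmonicKernel a)
      (fun _ h => biharmonicKernel_eq_zero h) hC) (hasTemperateGrowth_biharmonicSymbol a) y

/-- This factorisation lets the Bessel multiplier see a Green's function only through its source:
the part beyond the identity acts on `(-Δ - l) T`. It also yields temperate growth of the Bessel
symbol. -/
lemma besselSymbol_eq {a : ℝ} (ha : 0 ≤ a) (l : ℝ) :
    besselSymbol a l = (fun _ => (1 : ℂ)) + fun ξ => helmholtzSymbol l ξ * greenSymbol a l ξ := by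
  ext ξ
  simp only [Pi.add_apply]
  rw [helmholtzSymbol, greenSymbol_apply ha, besselSymbol]
  push_cast
  ring

lemma hasTemperateGrowth_besselSymbol {a : ℝ} (ha : 0 ≤ a) (l : ℝ) :
    (besselSymbol a l).HasTemperateGrowth := by
  rw [besselSymbol_eq ha]
  exact (Function.HasTemperateGrowth.const _).add
    ((hasTemperateGrowth_helmholtzSymbol l).mul (hasTemperateGrowth_greenSymbol a l))

lemma multiplier_besselSymbol {a : ℝ} (ha : 0 ≤ a) (l : ℝ) (T : 𝓢'(Plane, ℂ)) :
    fourierMultiplierCLM ℂ (besselSymbol a l) T =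
      T + fourierMultiplierCLM ℂ (greenSymbol a l) (fourierMultiplierCLM ℂ (helmholtzSymbol l) T) := by
  have h1 := hasTemperateGrowth_helmholtzSymbol l
  have h2 := hasTemperateGrowth_greenSymbol a l
  have h12 : (fun ξ => helmholtzSymbol l ξ * greenSymbol a l ξ).HasTemperateGrowth := h1.mul h2
  rw [besselSymbol_eq ha, multiplier_add (.const 1) h12, multiplier_const]
  refine congrArg₂ (· + ·) ?_ (multiplier_mul h1 h2 T)
  ext φ
  exact one_mul (T φ)

/-- The action of the Bessel multiplier on a solution of the Helmholtz equation with a point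
source. -/
lemma Represents.besselSymbol {a : ℝ} (ha : 0 ≤ a) {l : ℝ} {T : 𝓢'(Plane, ℂ)} {γ : Plane → ℂ}
    {q : ℂ} {y : Plane} (hT : Represents T γ)
    (h : fourierMultiplierCLM ℂ (helmholtzSymbol l) T = q • delta y) :
    Represents (fourierMultiplierCLM ℂ (besselSymbol a l) T)
      fun x => γ x + q * (greenKernel a l ‖x - y‖ : ℂ) := by
  rw [multiplier_besselSymbol ha, h, map_smul]
  exact hT.add ((multiplier_greenSymbol_delta a l y).smul q)

/-- Here the difference quotient is taken in `w` and not in `w - l`, because `R₀` is a Green's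
function of `-Δ` and not of `-Δ - l`. -/
lemma multiplier_besselSymbol_shift {a : ℝ} (ha : 0 ≤ a) (l : ℝ) (T : 𝓢'(Plane, ℂ)) :
    fourierMultiplierCLM ℂ (besselSymbol a l) T = ((besselJ (-l * a ^ 2) : ℝ) : ℂ) • T +
      fourierMultiplierCLM ℂ (shiftSymbol a l) (fourierMultiplierCLM ℂ (helmholtzSymbol 0) T) := by
  have h1 := hasTemperateGrowth_helmholtzSymbol 0
  have h2 := hasTemperateGrowth_shiftSymbol a l
  have e : Sigma2D.besselSymbol a l = (fun _ => ((besselJ (-l * a ^ 2) : ℝ) : ℂ)) +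
      fun ξ => helmholtzSymbol 0 ξ * shiftSymbol a l ξ := by
    ext ξ
    simp only [Pi.add_apply]
    rw [helmholtzSymbol, sub_zero, shiftSymbol_apply ha, Sigma2D.besselSymbol]
    push_cast
    ring
  have h12 : (fun ξ => helmholtzSymbol 0 ξ * shiftSymbol a l ξ).HasTemperateGrowth := h1.mul h2
  rw [e, multiplier_add (.const _) h12, multiplier_const]
  exact congrArg _ (multiplier_mul h1 h2 T)

lemma multiplier_besselSymbol_zero {a : ℝ} (ha : 0 ≤ a) (T : 𝓢'(Plane, ℂ)) :
    fourierMultiplierCLM ℂ (besselSymbol a 0) T =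
      T + ((-(a ^ 2 / 4) : ℝ) : ℂ) • fourierMultiplierCLM ℂ (helmholtzSymbol 0) T +
        fourierMultiplierCLM ℂ (biharmonicSymbol a)
          (fourierMultiplierCLM ℂ (helmholtzSymbol 0)
            (fourierMultiplierCLM ℂ (helmholtzSymbol 0) T)) := by
  have h1 := hasTemperateGrowth_helmholtzSymbol 0
  have h2 := hasTemperateGrowth_biharmonicSymbol a
  have e : Sigma2D.besselSymbol a 0 = (fun _ => (1 : ℂ)) +
      ((fun ξ => ((-(a ^ 2 / 4) : ℝ) : ℂ) * helmholtzSymbol 0 ξ) +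
      fun ξ => helmholtzSymbol 0 ξ * (helmholtzSymbol 0 ξ * biharmonicSymbol a ξ)) := by
    ext ξ
    simp only [Pi.add_apply]
    have h := biharmonicSymbol_apply ha ξ
    rw [← mul_assoc, ← sq, helmholtzSymbol, sub_zero, h, Sigma2D.besselSymbol, sub_zero]
    push_cast
    ring
  have h3 : (fun ξ => ((-(a ^ 2 / 4) : ℝ) : ℂ) * helmholtzSymbol 0 ξ).HasTemperateGrowth :=
    .mul (.const _) h1
  have h4 : (fun ξ => helmholtzSymbol 0 ξ *
    (helmholtzSymbol 0 ξ * biharmonicSymbol a ξ)).HasTemperateGrowth := h1.mul (h1.mul h2)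
  rw [e, multiplier_add (.const _) (h3.add h4), multiplier_add h3 h4, multiplier_const,
    ← add_assoc]
  refine congrArg₂ (· + ·) (congrArg₂ (· + ·) ?_ (multiplier_const_mul h1 _ T)) ?_
  · ext φ
    exact one_mul (T φ)
  · refine (multiplier_mul h1 (h1.mul h2) T).trans ?_
    exact multiplier_mul h1 h2 _

lemma exists_R0 {M : ℝ} (hM : 0 < M) : ∃ T : 𝓢'(Plane, ℂ), Represents T (fun x => (R0 M x : ℂ)) ∧
    fourierMultiplierCLM ℂ (helmholtzSymbol 0) T = delta 0 := by
  obtain ⟨_, S, _, hS, _, hS'⟩ := exists_R1 hM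
  exact ⟨S, hS, hS'⟩

/-- The Bessel multiplier with a spectral shift, applied to `R₀`. -/
lemma represents_besselSymbol_R0 {M a : ℝ} (hM : 0 < M) (ha : 0 < a) {T : 𝓢'(Plane, ℂ)}
    (hT : Represents T fun x => (R0 M x : ℂ))
    (h : fourierMultiplierCLM ℂ (helmholtzSymbol 0) T = delta 0) (l : ℝ) :
    Represents (fourierMultiplierCLM ℂ (besselSymbol a l) T)
      fun x => ((R0tilde M a⁻¹ x + l * shiftSlope M a l x : ℝ) : ℂ) := by
  rw [multiplier_besselSymbol_shift ha.le, h]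
  refine ((hT.smul _).add (multiplier_shiftSymbol_delta a l 0)).congr_off 0 fun x hx => ?_
  rw [sub_zero, ← R0_add_shiftKernel hM ha l hx]
  push_cast
  ring

lemma represents_besselSymbol_R1 {M a : ℝ} (hM : 0 < M) (ha : 0 < a) {T S : 𝓢'(Plane, ℂ)}
    (hT : Represents T fun x => (R1 M x : ℂ)) (hS : Represents S fun x => (R0 M x : ℂ))
    (h : fourierMultiplierCLM ℂ (helmholtzSymbol 0) T = S)
    (h' : fourierMultiplierCLM ℂ (helmholtzSymbol 0) S = delta 0) :
    Represents (fourierMultiplierCLM ℂ (besselSymbol a 0) T) fun x => (R1tilde M a⁻¹ x : ℂ) := by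
  rw [multiplier_besselSymbol_zero ha.le, h, h']
  refine ((hT.add (hS.smul _)).add (multiplier_biharmonicSymbol_delta a 0)).congr_off 0
    fun x hx => ?_
  rw [sub_zero, ← R1_add_biharmonicKernel hM ha hx]
  push_cast
  ring

/-! ### Scalar Green's functions -/

/-- Green's functions of `-Δ - l`, up to the factor `q`. -/
structure IsScalarGreen (M l : ℝ) (q : ℂ) (γ : Plane → ℂ) : Prop where
  continuous_off : ContinuousOn γ {0}ᶜ
  singularity : ∃ C : ℝ, ∀ z : Plane, 0 < ‖z‖ → ‖z‖ ≤ 1 → ‖γ z - q * R0 M z‖ ≤ C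
  eqn : ∀ y : Plane, ∃ T, Represents T (fun x => γ (x - y)) ∧
    fourierMultiplierCLM ℂ (helmholtzSymbol l) T = q • delta y

/-- The difference of the fundamental solutions of `-Δ - l` and `-Δ`. -/
def fundSolDiff (M l : ℝ) (x : Plane) : ℝ :=
  l * ((mulLog M (‖x‖ ^ 2) - 2 * ‖x‖ ^ 2) / (16 * π)) + l ^ 2 * fundSolTail M l (‖x‖ ^ 2)

lemma continuous_fundSolDiff (M l : ℝ) : Continuous (fundSolDiff M l) := by
  have h1 : Continuous fun x : Plane => fundSolTail M l (‖x‖ ^ 2) :=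
    (continuous_fundSolTail M).comp (g := fun p : ℝ × ℝ => fundSolTail M p.1 p.2)
      (f := fun x : Plane => (l, ‖x‖ ^ 2)) (by fun_prop)
  have h3 := continuous_mulLog M
  unfold fundSolDiff
  fun_prop

lemma fundSol_eq_add {M : ℝ} (hM : 0 < M) (l : ℝ) {x : Plane} (hx : x ≠ 0) :
    fundSol M l (‖x‖ ^ 2) = R0 M x + fundSolDiff M l x := by
  have hx' : 0 < ‖x‖ := norm_pos_iff.2 hx
  rw [fundSol_norm_sq hM l hx, fundSolDiff, R1, mulLog_eq hM (by positivity)]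
  ring

lemma continuousOn_R0 {M : ℝ} (hM : 0 < M) : ContinuousOn (R0 M) {0}ᶜ := by
  refine continuousOn_const.mul (ContinuousOn.log (by fun_prop) fun x hx => ?_)
  have hx' : 0 < ‖x‖ := norm_pos_iff.2 hx
  positivity

lemma isScalarGreen_fundSol {M l : ℝ} (hM : 0 < M) (hl : 0 ≤ l) (q : ℂ) :
    IsScalarGreen M l q fun x => q * fundSol M l (‖x‖ ^ 2) := by
  refine ⟨?_, ?_, fun y => ?_⟩
  · have h : ContinuousOn (fun x => q * ((R0 M x + fundSolDiff M l x : ℝ) : ℂ)) {0}ᶜ :=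
      continuousOn_const.mul (Complex.continuous_ofReal.comp_continuousOn
        ((continuousOn_R0 hM).add (continuous_fundSolDiff M l).continuousOn))
    exact h.congr fun x hx => by rw [fundSol_eq_add hM l hx]
  · obtain ⟨C, hC⟩ := (isCompact_closedBall (0 : Plane) 1).exists_bound_of_continuousOn
      (continuous_fundSolDiff M l).continuousOn
    refine ⟨‖q‖ * C, fun z hz hz1 => ?_⟩
    rw [fundSol_eq_add hM l (norm_pos_iff.1 hz), ← mul_sub, norm_mul, ← Complex.ofReal_sub,
      add_sub_cancel_left, Complex.norm_real]
    gcongr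
    exact hC z (mem_closedBall_zero_iff.2 hz1)
  · obtain ⟨T, hT, hT'⟩ := exists_fundSol hM hl y
    exact ⟨q • T, hT.smul q, by rw [map_smul, hT']⟩

/-- The unit ball is covered by the assumed bound, the rest of the ball by compactness, and the
value at the origin separately. -/
lemma IsScalarGreen.exists_bound {h : Plane → ℂ} (hc : ContinuousOn h {0}ᶜ) {C : ℝ}
    (hb : ∀ z, 0 < ‖z‖ → ‖z‖ ≤ 1 → ‖h z‖ ≤ C) (R : ℝ) : ∃ C, ∀ x, ‖x‖ ≤ R → ‖h x‖ ≤ C := by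
  have hK : IsCompact (Metric.closedBall (0 : Plane) R \ Metric.ball 0 1) :=
    (isCompact_closedBall _ _).diff Metric.isOpen_ball
  obtain ⟨D, hD⟩ := hK.exists_bound_of_continuousOn (hc.mono fun x hx h0 => hx.2 (by
    rw [Set.mem_singleton_iff.1 h0]; simp))
  refine ⟨max (max C D) ‖h 0‖, fun x hx => ?_⟩
  by_cases h0 : x = 0
  · rw [h0]; exact le_max_right _ _
  rcases le_or_gt ‖x‖ 1 with h1 | h1
  · exact (hb x (norm_pos_iff.2 h0) h1).trans ((le_max_left _ _).trans (le_max_left _ _))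
  · refine (hD x ⟨mem_closedBall_zero_iff.2 hx, ?_⟩).trans ((le_max_right _ _).trans (le_max_left _ _))
    rw [mem_ball_zero_iff, not_lt]
    exact h1.le

/-- The Bessel multiplier turns a Green's function into a continuous function. -/
lemma IsScalarGreen.exists_continuous {M l a : ℝ} (hM : 0 < M) (hl : 0 ≤ l) (ha : 0 < a) {q : ℂ}
    {γ : Plane → ℂ} (hγ : IsScalarGreen M l q γ) : ∃ κ : Plane → ℂ, Continuous κ ∧
      ∀ x, x ≠ 0 → κ x = γ x + q * greenKernel a l ‖x‖ := by
  have hF := isScalarGreen_fundSol hM hl q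
  -- Both functions have singular part `q R₀` and source `q δ`, so the difference is a locally
  -- bounded solution of the homogeneous equation.
  set h : Plane → ℂ := fun x => γ x + (-1) * (q * fundSol M l (‖x‖ ^ 2)) with hh
  have hc : ContinuousOn h {0}ᶜ :=
    hγ.continuous_off.add (continuousOn_const.mul hF.continuous_off)
  obtain ⟨C₁, hC₁⟩ := hγ.singularity
  obtain ⟨C₂, hC₂⟩ := hF.singularity
  obtain ⟨T₁, hT₁, e₁⟩ := hγ.eqn 0
  obtain ⟨T₂, hT₂, e₂⟩ := hF.eqn 0
  have hb : ∀ z, 0 < ‖z‖ → ‖z‖ ≤ 1 → ‖h z‖ ≤ C₁ + C₂ := fun z h0 h1 => by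
    have e : h z = (γ z - q * R0 M z) - (q * fundSol M l (‖z‖ ^ 2) - q * R0 M z) := by
      rw [hh]; ring
    rw [e]
    exact (norm_sub_le _ _).trans (add_le_add (hC₁ z h0 h1) (hC₂ z h0 h1))
  have hT : Represents (T₁ + (-1 : ℂ) • T₂) h := by
    have := hT₁.add (hT₂.smul (-1))
    simpa only [sub_zero] using this
  obtain ⟨u, hu, hhu⟩ := exists_continuous_of_solution (l := l) hT (IsScalarGreen.exists_bound hc hb)
    hc (by
      rw [map_add, map_smul, e₁, e₂]
      ext φ
      change q * φ 0 + (-1 : ℂ) * (q * φ 0) = 0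
      ring)
  have hs : Continuous fun x => smoothedSlope M a l x :=
    (continuous_smoothedSlope M a).comp (g := fun p : ℝ × Plane => smoothedSlope M a p.1 p.2)
      (f := fun x : Plane => (l, x)) (by fun_prop)
  have ht := continuous_R0tilde hM ha
  refine ⟨fun x => u x + q * ((R0tilde M a⁻¹ x + l * smoothedSlope M a l x : ℝ) : ℂ),
    hu.add (continuous_const.mul (Complex.continuous_ofReal.comp (by fun_prop))), fun x hx => ?_⟩
  simp only [← fundSol_add_greenKernel hM ha l hx, ← hhu x hx, hh]
  push_cast
  ring

/-! ### Expansions to second order in `s` -/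

/-- `F s x = o(s²)` as `s → +0`, uniformly for `x` in bounded subsets of `S`. -/
def ScalarLittleO (S : Set Plane) (F : ℝ → Plane → ℂ) : Prop :=
  ∀ r > 0, ∀ ε > 0, ∀ᶠ s in 𝓝[>] (0 : ℝ), ∀ x ∈ S, ‖x‖ ≤ r → ‖F s x‖ ≤ ε * s ^ 2

lemma ScalarLittleO.add {S : Set Plane} {F G : ℝ → Plane → ℂ} (hF : ScalarLittleO S F)
    (hG : ScalarLittleO S G) : ScalarLittleO S fun s x => F s x + G s x := by
  intro r hr ε hε
  filter_upwards [hF r hr (ε / 2) (by positivity), hG r hr (ε / 2) (by positivity)] with s h1 h2 x hx hxr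
  calc ‖F s x + G s x‖ ≤ ‖F s x‖ + ‖G s x‖ := norm_add_le _ _
    _ ≤ ε / 2 * s ^ 2 + ε / 2 * s ^ 2 := add_le_add (h1 x hx hxr) (h2 x hx hxr)
    _ = _ := by ring

lemma ScalarLittleO.const_mul {S : Set Plane} {F : ℝ → Plane → ℂ} (hF : ScalarLittleO S F) (c : ℂ) :
    ScalarLittleO S fun s x => c * F s x := by
  intro r hr ε hε
  filter_upwards [hF r hr (ε / (1 + ‖c‖)) (by positivity)] with s h1 x hx hxr
  rw [norm_mul]
  calc ‖c‖ * ‖F s x‖ ≤ (1 + ‖c‖) * (ε / (1 + ‖c‖) * s ^ 2) := by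
        gcongr
        · linarith
        · exact h1 x hx hxr
    _ = _ := by field_simp

lemma ScalarLittleO.sum {α : Type*} (t : Finset α) {S : Set Plane} {F : α → ℝ → Plane → ℂ}
    (hF : ∀ i ∈ t, ScalarLittleO S (F i)) : ScalarLittleO S fun s x => ∑ i ∈ t, F i s x := by
  classical
  induction t using Finset.induction_on with
  | empty =>
    intro r _ ε hε
    filter_upwards with s x _ _
    simp only [Finset.sum_empty, norm_zero]
    positivity
  | insert i t hi ih =>
    simp only [Finset.sum_insert hi]
    exact (hF i (Finset.mem_insert_self i t)).add
      (ih fun j hj => hF j (Finset.mem_insert_of_mem hj))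

lemma ScalarLittleO.congr {S : Set Plane} {F G : ℝ → Plane → ℂ} (hF : ScalarLittleO S F)
    (h : ∀ s > 0, ∀ x ∈ S, F s x = G s x) : ScalarLittleO S G := by
  intro r hr ε hε
  filter_upwards [hF r hr ε hε, self_mem_nhdsWithin] with s h1 hs x hx hxr
  rw [← h s hs x hx]
  exact h1 x hx hxr

/-- By compactness of the ball, a jointly continuous function vanishing at parameter `0` is
uniformly small on the ball for small parameters. -/
lemma ScalarLittleO.of_continuous {H : ℝ → Plane → ℝ} (hH : Continuous fun p : ℝ × Plane => H p.1 p.2)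
    (h0 : ∀ x, H 0 x = 0) (c : ℝ) (S : Set Plane) :
    ScalarLittleO S fun s x => ((s ^ 2 * H (c * s ^ 2) x : ℝ) : ℂ) := by
  intro r hr ε hε
  have h1 : ∀ᶠ l in 𝓝 (0 : ℝ), ∀ x ∈ Metric.closedBall (0 : Plane) r, |H l x| ≤ ε := by
    refine (isCompact_closedBall _ _).eventually_forall_of_forall_eventually
      (P := fun l x => |H l x| ≤ ε) fun x _ => ?_
    have h2 := (hH.abs.tendsto (0, x))
    simp only [h0, abs_zero] at h2
    filter_upwards [h2.eventually (gt_mem_nhds hε)] with p hp using le_of_lt hp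
  have h3 : Tendsto (fun s : ℝ => c * s ^ 2) (𝓝[>] 0) (𝓝 0) := by
    have h4 : Continuous fun s : ℝ => c * s ^ 2 := by fun_prop
    have := h4.tendsto 0
    simp only [ne_eq, OfNat.ofNat_ne_zero, not_false_eq_true, zero_pow, mul_zero] at this
    exact this.mono_left nhdsWithin_le_nhds
  filter_upwards [h3.eventually h1] with s hs x _ hxr
  have h5 := hs x (mem_closedBall_zero_iff.2 hxr)
  rw [Complex.norm_real, Real.norm_eq_abs, abs_mul, abs_of_nonneg (sq_nonneg s), mul_comm]
  gcongr

/-- The estimate passes to the limit at the origin with the same constant. -/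
lemma ScalarLittleO.univ_of_continuous {F : ℝ → Plane → ℂ} (hF : ScalarLittleO {0}ᶜ F)
    (hc : ∀ s > 0, Continuous (F s)) : ScalarLittleO Set.univ F := by
  intro r hr ε hε
  filter_upwards [hF r hr ε hε, self_mem_nhdsWithin] with s h1 hs x _ hxr
  by_cases hx : x = 0
  · rw [hx]
    have h2 : Tendsto (fun x => ‖F s x‖) (𝓝[≠] 0) (𝓝 ‖F s 0‖) :=
      ((hc s hs).norm.tendsto 0).mono_left nhdsWithin_le_nhds
    refine le_of_tendsto h2 ?_
    filter_upwards [self_mem_nhdsWithin, mem_nhdsWithin_of_mem_nhds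
      (Metric.closedBall_mem_nhds (0 : Plane) hr)] with z hz hzr
    exact h1 z hz (mem_closedBall_zero_iff.1 hzr)
  · exact h1 x hx hxr

lemma scalarLittleO_fundSol {M : ℝ} (hM : 0 < M) (c : ℝ) (q : ℂ) :
    ScalarLittleO {0}ᶜ fun s x => q * fundSol M (c * s ^ 2) (‖x‖ ^ 2) -
      q * ((R0 M x + s ^ 2 * (c * R1 M x) : ℝ) : ℂ) := by
  have hH : Continuous fun p : ℝ × Plane => c * (p.1 * fundSolTail M p.1 (‖p.2‖ ^ 2)) := by
    have := (continuous_fundSolTail M).comp (g := fun p : ℝ × ℝ => fundSolTail M p.1 p.2)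
      (f := fun p : ℝ × Plane => (p.1, ‖p.2‖ ^ 2)) (by fun_prop)
    exact continuous_const.mul (continuous_fst.mul this)
  refine ((ScalarLittleO.of_continuous (H := fun l x => c * (l * fundSolTail M l (‖x‖ ^ 2))) hH
    (fun x => by simp) c _).const_mul q).congr fun s hs x hx => ?_
  rw [fundSol_norm_sq hM _ hx]
  push_cast
  ring

/-- The expansion of the smoothed Green's functions. -/
lemma scalarLittleO_smoothed {M a c : ℝ} (hM : 0 < M) (ha : 0 < a) {q : ℂ} {γ κ : ℝ → Plane → ℂ}
    (hγ : ScalarLittleO {0}ᶜ fun s x => γ s x - q * ((R0 M x + s ^ 2 * (c * R1 M x) : ℝ) : ℂ))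
    (hκ : ∀ s > 0, Continuous (κ s))
    (h : ∀ s > 0, ∀ x, x ≠ 0 → κ s x = γ s x + q * greenKernel a (c * s ^ 2) ‖x‖) :
    ScalarLittleO Set.univ fun s x => κ s x -
      q * ((R0tilde M a⁻¹ x + s ^ 2 * (c * (R1tilde M a⁻¹ x + R0hat M a⁻¹ x)) : ℝ) : ℂ) := by
  have hS := continuous_smoothedSlope M a
  have hT : Continuous fun p : ℝ × Plane => fundSolTail M p.1 (‖p.2‖ ^ 2) :=
    (continuous_fundSolTail M).comp (g := fun p : ℝ × ℝ => fundSolTail M p.1 p.2)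
      (f := fun p : ℝ × Plane => (p.1, ‖p.2‖ ^ 2)) (by fun_prop)
  have hS0 : Continuous fun x : Plane => smoothedSlope M a 0 x :=
    hS.comp (g := fun p : ℝ × Plane => smoothedSlope M a p.1 p.2)
      (f := fun x : Plane => ((0 : ℝ), x)) (by fun_prop)
  have hH : Continuous fun p : ℝ × Plane => c * (smoothedSlope M a p.1 p.2 -
      smoothedSlope M a 0 p.2 - p.1 * fundSolTail M p.1 (‖p.2‖ ^ 2)) :=
    continuous_const.mul ((hS.sub (hS0.comp continuous_snd)).sub (continuous_fst.mul hT))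
  refine ScalarLittleO.univ_of_continuous ?_ fun s hs => ?_
  · refine (hγ.add ((ScalarLittleO.of_continuous (H := fun l x => c * (smoothedSlope M a l x -
      smoothedSlope M a 0 x - l * fundSolTail M l (‖x‖ ^ 2))) hH (fun x => by simp) c _).const_mul
      q)).congr fun s hs x hx => ?_
    have h1 := fundSol_add_greenKernel hM ha (c * s ^ 2) hx
    rw [fundSol_norm_sq hM _ hx] at h1
    -- The kernel does not depend on `γ`, so its expansion may be read off from the explicit
    -- fundamental solution.
    have h2 : greenKernel a (c * s ^ 2) ‖x‖ = R0tilde M a⁻¹ x + c * s ^ 2 *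
        smoothedSlope M a (c * s ^ 2) x - (R0 M x + c * s ^ 2 * R1 M x + (c * s ^ 2) ^ 2 *
          fundSolTail M (c * s ^ 2) (‖x‖ ^ 2)) := by linarith
    rw [h s hs x hx, h2, ← smoothedSlope_zero hM ha]
    push_cast
    ring
  · have h1 := continuous_R0tilde hM ha
    simp only [← smoothedSlope_zero hM ha]
    exact (hκ s hs).sub (continuous_const.mul (Complex.continuous_ofReal.comp (by fun_prop)))

end Sigma2D

end

noncomputable section

namespace Sigma2D

open Matrix

attribute [local instance] LieRing.ofAssociativeRing

set_option linter.unusedSectionVars false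

variable {ι : Type*} [Fintype ι] [DecidableEq ι]

/-! ### Diagonalisation of the connection -/

/-- Invariance of the Killing form, `κ([x, y], z) = κ(x, [y, z])`; as the form is a nonzero multiple
of the identity in the basis, pairing with `t b` reads off structure constants. -/
lemma structConst_antisymm {N : ℕ} (t : Module.Basis ι ℝ (su N))
    (ht : ∀ a b : ι, killingForm ℝ (su N) (t a) (t b) = if a = b then (-2 : ℝ) else 0) (a b d : ι) :
    structConst t a d b = -structConst t b d a := by
  have h : ∀ a b d : ι, killingForm ℝ (su N) ⁅t a, t d⁆ (t b) = -2 * structConst t a d b := by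
    intro a b d
    conv_lhs => rw [← t.sum_repr ⁅t a, t d⁆]
    simp only [map_sum, map_smul, LinearMap.sum_apply, LinearMap.smul_apply, ht, smul_eq_mul,
      mul_ite, mul_zero, Finset.sum_ite_eq', Finset.mem_univ, if_true]
    rw [structConst, mul_comm]
  have h1 := LieModule.traceForm_apply_lie_apply ℝ (su N) (su N) (t a) (t d) (t b)
  have h2 : killingForm ℝ (su N) (t a) ⁅t d, t b⁆ = -killingForm ℝ (su N) ⁅t b, t d⁆ (t a) := by
    rw [← lie_skew, map_neg, LieModule.traceForm_comm]
  have h3 := h a b d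
  rw [show killingForm ℝ (su N) ⁅t a, t d⁆ (t b) = killingForm ℝ (su N) (t a) ⁅t d, t b⁆ from h1,
    h2, h b a d] at h3
  linarith

lemma conjTranspose_connection {N : ℕ} (t : Module.Basis ι ℝ (su N))
    (ht : ∀ a b : ι, killingForm ℝ (su N) (t a) (t b) = if a = b then (-2 : ℝ) else 0)
    (β : Fin 2 → ι → ℝ) (μ : Fin 2) : (connection t β μ)ᴴ = -connection t β μ := by
  ext a b
  rw [conjTranspose_apply, neg_apply, connection, connection, Complex.star_def, Complex.conj_ofReal,
    ← Complex.ofReal_neg, ← Finset.sum_neg_distrib]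
  congr 1
  refine Finset.sum_congr rfl fun d _ => ?_
  rw [structConst_antisymm t ht b a d]
  ring

/-- A simultaneous diagonalisation of the matrices `B μ`, with eigenvalues `i b μ j`. -/
structure IsDiagonalised (B : Fin 2 → Matrix ι ι ℂ) (P Q : Matrix ι ι ℂ) (b : Fin 2 → ι → ℝ) :
    Prop where
  mul_eq : P * Q = 1
  mul_eq' : Q * P = 1
  eq_conj : ∀ μ, B μ = P * diagonal (fun j => Complex.I * (b μ j : ℂ)) * Q

/-- The matrices `i B μ` are Hermitian and commute, so the space is the direct sum of their joint
eigenspaces. Bases of these are chosen arbitrarily, which is why `Q` is the inverse of `P` and not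
its adjoint. -/
lemma exists_isDiagonalised {B : Fin 2 → Matrix ι ι ℂ} (hskew : ∀ μ, (B μ)ᴴ = -B μ)
    (hcomm : ∀ μ ν, B μ * B ν = B ν * B μ) : ∃ P Q b, IsDiagonalised B P Q b := by
  classical
  set A : Fin 2 → Matrix ι ι ℂ := fun μ => Complex.I • B μ with hA
  have hH : ∀ μ, (A μ).IsHermitian := fun μ => by
    rw [IsHermitian, hA]
    simp only [conjTranspose_smul, hskew, Complex.star_def, Complex.conj_I]
    rw [neg_smul, smul_neg, neg_neg]
  set T : Fin 2 → EuclideanSpace ℂ ι →ₗ[ℂ] EuclideanSpace ℂ ι := fun μ => (A μ).toEuclideanLin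
  have hT : ∀ μ, (T μ).IsSymmetric := fun μ => isSymmetric_toEuclideanLin_iff.2 (hH μ)
  have hC : Pairwise (Function.onFun Commute T) := fun μ ν _ => by
    show T μ * T ν = T ν * T μ
    ext v i
    simp only [T, Module.End.mul_apply, toLpLin_apply, mulVec_mulVec, hA, smul_mul_smul_comm,
      hcomm μ ν]
  have hint := LinearMap.IsSymmetric.directSum_isInternal_of_pairwise_commute hT hC
  set v₀ := hint.collectedBasis fun α => Module.Free.chooseBasis ℂ _
  set e := v₀.indexEquiv (EuclideanSpace.basisFun ι ℂ).toBasis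
  set v := v₀.reindex e
  have hv : ∀ j μ, T μ (v j) = (e.symm j).1 μ • v j := by
    intro j μ
    have h := hint.collectedBasis_mem (fun α => Module.Free.chooseBasis ℂ _) (e.symm j)
    rw [Submodule.mem_iInf] at h
    have h2 := Module.End.mem_eigenspace_iff.1 (h μ)
    simpa only [v, Module.Basis.reindex_apply] using h2
  have hreal : ∀ j μ, (((e.symm j).1 μ).re : ℂ) = (e.symm j).1 μ := by
    intro j μ
    have h := (hT μ).conj_eigenvalue_eq_self
      (Module.End.hasEigenvalue_of_hasEigenvector ⟨Module.End.mem_eigenspace_iff.2 (hv j μ), v.ne_zero j⟩)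
    exact Complex.conj_eq_iff_re.1 h
  set b₀ := (EuclideanSpace.basisFun ι ℂ).toBasis
  -- If `i B v = λ v`, then `B v = i (-λ) v`; hence the sign.
  refine ⟨b₀.toMatrix v, v.toMatrix b₀, fun μ j => -((e.symm j).1 μ).re,
    b₀.toMatrix_mul_toMatrix_flip v, v.toMatrix_mul_toMatrix_flip b₀, fun μ => ?_⟩
  have hP : B μ * b₀.toMatrix v = b₀.toMatrix v *
      diagonal (fun j => Complex.I * ((-((e.symm j).1 μ).re : ℝ) : ℂ)) := by
    ext a j
    rw [mul_diagonal]
    have h := congrArg (fun w : EuclideanSpace ℂ ι => w a) (hv j μ)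
    simp only [T, toLpLin_apply, PiLp.smul_apply, smul_eq_mul, hA, smul_mulVec, mulVec,
      dotProduct, Pi.smul_apply] at h
    have hb : ∀ c, b₀.toMatrix v c j = v j c := fun c => by
      simp [b₀, Module.Basis.toMatrix_apply]
    rw [mul_apply]
    simp only [hb]
    rw [Complex.ofReal_neg, hreal]
    linear_combination (-Complex.I) * h + (∑ x, B μ a x * (v j) x) * Complex.I_sq
  rw [← hP, Matrix.mul_assoc, b₀.toMatrix_mul_toMatrix_flip v, Matrix.mul_one]

namespace IsDiagonalised

variable {B : Fin 2 → Matrix ι ι ℂ} {P Q : Matrix ι ι ℂ} {b : Fin 2 → ι → ℝ}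

/-- The eigenvalues of the mass matrix. -/
def mass (b : Fin 2 → ι → ℝ) (j : ι) : ℝ := (b 0 j ^ 2 + b 1 j ^ 2) / 4

lemma mass_nonneg (b : Fin 2 → ι → ℝ) (j : ι) : 0 ≤ mass b j := by
  unfold mass; positivity

lemma conj_mul_conj (h : IsDiagonalised B P Q b) (u v : ι → ℂ) :
    (P * diagonal u * Q) * (P * diagonal v * Q) = P * diagonal (fun j => u j * v j) * Q := by
  calc (P * diagonal u * Q) * (P * diagonal v * Q) = P * diagonal u * (Q * P) * diagonal v * Q := by
        simp only [Matrix.mul_assoc]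
    _ = _ := by rw [h.mul_eq', Matrix.mul_one, Matrix.mul_assoc P, diagonal_mul_diagonal]

lemma conj_add_conj (P Q : Matrix ι ι ℂ) (u v : ι → ℂ) :
    P * diagonal u * Q + P * diagonal v * Q = P * diagonal (fun j => u j + v j) * Q := by
  rw [← Matrix.add_mul, ← Matrix.mul_add, diagonal_add]

lemma smul_conj (P Q : Matrix ι ι ℂ) (c : ℂ) (u : ι → ℂ) :
    c • (P * diagonal u * Q) = P * diagonal (fun j => c * u j) * Q := by
  rw [← Matrix.smul_mul, ← Matrix.mul_smul, ← diagonal_smul]; rfl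

lemma one_eq_conj (h : IsDiagonalised B P Q b) : 1 = P * diagonal (fun _ => (1 : ℂ)) * Q := by
  rw [diagonal_one, Matrix.mul_one, h.mul_eq]

/-- Since `(i b)² = -b²`, the eigenvalues are nonnegative. This puts all components in the range `l
≥ 0` of the scalar theory. -/
lemma massMatrix_eq (h : IsDiagonalised B P Q b) :
    massMatrix B = P * diagonal (fun j => (mass b j : ℂ)) * Q := by
  rw [massMatrix, Fin.sum_univ_two, h.eq_conj 0, h.eq_conj 1, h.conj_mul_conj, h.conj_mul_conj,
    conj_add_conj, smul_conj]
  congr 3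
  ext j
  rw [mass]
  push_cast
  linear_combination (-(1 / 4 : ℂ)) * ((b 0 j : ℂ) ^ 2 + (b 1 j : ℂ) ^ 2) * Complex.I_sq

/-- The matrix of eigenvectors as a unit. -/
def unit (h : IsDiagonalised B P Q b) : (Matrix ι ι ℂ)ˣ := ⟨P, Q, h.mul_eq, h.mul_eq'⟩

lemma gaugeFactor_eq (h : IsDiagonalised B P Q b) (s : ℝ) (z : Plane) :
    gaugeFactor B s z = P * diagonal (fun j =>
      Complex.exp (-(Complex.I * (s * (z 0 * b 0 j + z 1 * b 1 j) / 2 : ℝ)))) * Q := by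
  have h1 : ∑ μ, (-(s * z μ / 2 : ℝ) : ℂ) • B μ = P * diagonal (fun j =>
      -(Complex.I * (s * (z 0 * b 0 j + z 1 * b 1 j) / 2 : ℝ))) * Q := by
    rw [Fin.sum_univ_two, h.eq_conj 0, h.eq_conj 1, smul_conj, smul_conj, conj_add_conj]
    congr 3
    ext j
    push_cast
    ring
  have h2 := Matrix.exp_units_conj h.unit (diagonal (fun j =>
      -(Complex.I * ((s * (z 0 * b 0 j + z 1 * b 1 j) / 2 : ℝ) : ℂ))))
  rw [Matrix.exp_diagonal] at h2
  rw [gaugeFactor, h1]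
  refine h2.trans ?_
  congr 3
  ext j
  rw [Pi.coe_exp, Complex.exp_eq_exp_ℂ]

lemma besselSqrt_ofReal (r : ℝ) : besselSqrt (r : ℂ) = (besselJ r : ℂ) ∧
    HasSum (fun n : ℕ => ((-1 / 4 : ℂ) ^ n / ((Nat.factorial n : ℂ) ^ 2)) • (r : ℂ) ^ n)
      (besselJ r : ℂ) := by
  have h := Complex.hasSum_ofReal.2 (besselCoeff_decay.hasSum r)
  have h2 : HasSum (fun n : ℕ => ((-1 / 4 : ℂ) ^ n / ((Nat.factorial n : ℂ) ^ 2)) • (r : ℂ) ^ n)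
      (besselJ r : ℂ) := by
    refine h.congr_fun fun n => ?_
    rw [besselCoeff]
    push_cast
    rfl
  exact ⟨h2.tsum_eq, h2⟩

/-- Conjugation commutes with powers and, being continuous, with the sum of the series. -/
lemma besselSqrt_conj (h : IsDiagonalised B P Q b) (u : ι → ℝ) :
    besselSqrt (P * diagonal (fun j => (u j : ℂ)) * Q) =
      P * diagonal (fun j => (besselJ (u j) : ℂ)) * Q := by
  have hpow : ∀ n : ℕ, (P * diagonal (fun j => (u j : ℂ)) * Q) ^ n =
      P * diagonal (fun j => (u j : ℂ) ^ n) * Q := by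
    intro n
    induction n with
    | zero => simp only [pow_zero]; exact h.one_eq_conj
    | succ n ih => rw [pow_succ, ih, h.conj_mul_conj]; simp only [pow_succ]
  have h1 : HasSum (fun n : ℕ => fun j =>
      ((-1 / 4 : ℂ) ^ n / ((Nat.factorial n : ℂ) ^ 2)) * (u j : ℂ) ^ n) fun j => (besselJ (u j) : ℂ) :=
    Pi.hasSum.2 fun j => (besselSqrt_ofReal (u j)).2
  have h2 := (h1.matrix_diagonal.mul_left P).mul_right Q
  rw [besselSqrt]
  refine (HasSum.congr_fun h2 fun n => ?_).tsum_eq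
  rw [hpow, smul_conj]

end IsDiagonalised

end Sigma2D

end

noncomputable section

namespace Sigma2D

open Matrix FourierTransform TemperedDistribution

set_option linter.unusedSectionVars false

variable {ι : Type*} [Fintype ι] [DecidableEq ι]

/-! ### Operators on matrices of distributions -/

lemma constMul_apply (C : Matrix ι ι ℂ) (T : Matrix ι ι 𝓢'(Plane, ℂ)) (a b : ι) (φ : 𝓢(Plane, ℂ)) :
    constMul C T a b φ = ∑ c, C a c * T c b φ :=
  sum_apply (Finset.univ : Finset ι) (fun c => C a c • T c b) φ

lemma constMul_mul (C D : Matrix ι ι ℂ) (T : Matrix ι ι 𝓢'(Plane, ℂ)) :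
    constMul (C * D) T = constMul C (constMul D T) := by
  ext a b φ
  simp only [constMul_apply, mul_apply, Finset.sum_mul, Finset.mul_sum, mul_assoc]
  exact Finset.sum_comm

lemma constMul_one (T : Matrix ι ι 𝓢'(Plane, ℂ)) : constMul 1 T = T := by
  ext a b φ
  simp only [constMul_apply, one_apply, ite_mul, one_mul, zero_mul, Finset.sum_ite_eq,
    Finset.mem_univ, if_true]

lemma MatRepresents.constMul {T : Matrix ι ι 𝓢'(Plane, ℂ)} {u : Plane → Matrix ι ι ℂ}
    (h : MatRepresents T u) (C : Matrix ι ι ℂ) :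
    MatRepresents (constMul C T) fun x => C * u x := fun a b => by
  simp only [mul_apply]
  exact Represents.sum _ fun c _ => (h c b).smul _

lemma constMul_cancel {P Q : Matrix ι ι ℂ} (h : Q * P = 1) (T : Matrix ι ι 𝓢'(Plane, ℂ)) :
    constMul Q (constMul P T) = T := by
  rw [← constMul_mul, h, constMul_one]

/-- Multiplication of the Fourier transform by the matrix valued function `σ`. -/
def matMultiplier (σ : Plane → Matrix ι ι ℂ) (T : Matrix ι ι 𝓢'(Plane, ℂ)) :
    Matrix ι ι 𝓢'(Plane, ℂ) :=
  fun a b => ∑ c, fourierMultiplierCLM ℂ (fun ξ => σ ξ a c) (T c b)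

/-- All entries of the matrix valued function `σ` have temperate growth. -/
def IsTemperateMatrix (σ : Plane → Matrix ι ι ℂ) : Prop :=
  ∀ a b, (fun ξ => σ ξ a b).HasTemperateGrowth

lemma IsTemperateMatrix.const (C : Matrix ι ι ℂ) : IsTemperateMatrix fun _ => C :=
  fun a b => .const (C a b)

lemma IsTemperateMatrix.add {σ τ : Plane → Matrix ι ι ℂ} (hσ : IsTemperateMatrix σ)
    (hτ : IsTemperateMatrix τ) : IsTemperateMatrix fun ξ => σ ξ + τ ξ :=
  fun a b => (hσ a b).add (hτ a b)

lemma IsTemperateMatrix.mul {σ τ : Plane → Matrix ι ι ℂ} (hσ : IsTemperateMatrix σ)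
    (hτ : IsTemperateMatrix τ) : IsTemperateMatrix fun ξ => σ ξ * τ ξ := fun a b => by
  simp only [mul_apply]
  exact .sum fun c _ => (hσ a c).mul (hτ c b)

lemma isTemperateMatrix_symbolD (μ : Fin 2) :
    IsTemperateMatrix (symbolD μ : Plane → Matrix ι ι ℂ) := fun a b => by
  have h1 : (fun ξ : Plane => ξ μ).HasTemperateGrowth :=
    (EuclideanSpace.proj μ : Plane →L[ℝ] ℝ).hasTemperateGrowth
  have h2 : (fun ξ : Plane => (ξ μ : ℂ)).HasTemperateGrowth :=
    Function.Complex.hasTemperateGrowth_ofReal.comp h1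
  exact ((Function.HasTemperateGrowth.const (2 * π * Complex.I)).mul h2).mul
    (.const ((1 : Matrix ι ι ℂ) a b))

lemma matMultiplier_add {σ τ : Plane → Matrix ι ι ℂ} (hσ : IsTemperateMatrix σ)
    (hτ : IsTemperateMatrix τ) (T : Matrix ι ι 𝓢'(Plane, ℂ)) :
    matMultiplier (fun ξ => σ ξ + τ ξ) T = matMultiplier σ T + matMultiplier τ T := by
  ext a b : 1
  simp only [matMultiplier, Matrix.add_apply]
  rw [← Finset.sum_add_distrib]
  exact Finset.sum_congr rfl fun c _ => multiplier_add (hσ a c) (hτ a c) _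

lemma multiplier_sum {f : ι → Plane → ℂ} (hf : ∀ i, (f i).HasTemperateGrowth) (T : 𝓢'(Plane, ℂ)) :
    fourierMultiplierCLM ℂ (fun ξ => ∑ i, f i ξ) T = ∑ i, fourierMultiplierCLM ℂ (f i) T := by
  rw [TemperedDistribution.fourierMultiplierCLM_sum ℂ fun i _ => hf i]
  exact _root_.sum_apply _ _ _

lemma matMultiplier_mul {σ τ : Plane → Matrix ι ι ℂ} (hσ : IsTemperateMatrix σ)
    (hτ : IsTemperateMatrix τ) (T : Matrix ι ι 𝓢'(Plane, ℂ)) :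
    matMultiplier (fun ξ => σ ξ * τ ξ) T = matMultiplier σ (matMultiplier τ T) := by
  ext a b : 1
  simp only [matMultiplier, mul_apply, map_sum]
  rw [Finset.sum_comm]
  refine Finset.sum_congr rfl fun c _ => ?_
  have h : ∀ d, (fun ξ => σ ξ a d * τ ξ d c).HasTemperateGrowth := fun d => (hσ a d).mul (hτ d c)
  rw [multiplier_sum h]
  refine Finset.sum_congr rfl fun d _ => ?_
  rw [← multiplier_mul (hτ d c) (hσ a d)]
  simp only [mul_comm]

lemma matMultiplier_const (C : Matrix ι ι ℂ) (T : Matrix ι ι 𝓢'(Plane, ℂ)) :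
    matMultiplier (fun _ => C) T = constMul C T := by
  ext a b : 1
  simp only [matMultiplier, multiplier_const, constMul]

lemma matMultiplier_neg {σ : Plane → Matrix ι ι ℂ} (hσ : IsTemperateMatrix σ)
    (T : Matrix ι ι 𝓢'(Plane, ℂ)) :
    matMultiplier (fun ξ => -σ ξ) T = -matMultiplier σ T := by
  ext a b : 1
  simp only [matMultiplier, Matrix.neg_apply]
  rw [← Finset.sum_neg_distrib]
  refine Finset.sum_congr rfl fun c _ => ?_
  have h := multiplier_const_mul (hσ a c) (-1) (T c b)
  simp only [neg_one_mul] at h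
  rw [h]
  ext φ
  exact neg_one_mul _

lemma matMultiplier_symbolD (μ : Fin 2) (T : Matrix ι ι 𝓢'(Plane, ℂ)) :
    matMultiplier (symbolD μ) T = partialD μ T := by
  have h1 : (fun ξ : Plane => Complex.ofReal (inner ℝ ξ (EuclideanSpace.single μ 1))).HasTemperateGrowth :=
    Function.Complex.hasTemperateGrowth_ofReal.comp (Function.hasTemperateGrowth_inner_left _)
  ext a b : 1
  simp only [matMultiplier, partialD]
  rw [Finset.sum_eq_single a]
  · rw [lineDeriv_eq_fourierMultiplierCLM, ← multiplier_const_mul h1]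
    have e : (fun ξ : Plane => symbolD μ ξ a a) = fun ξ => 2 * π * Complex.I *
        Complex.ofReal (inner ℝ ξ (EuclideanSpace.single μ 1)) := by
      ext ξ; simp [symbolD, EuclideanSpace.inner_single_right]
    rw [e]
  · intro c _ hc
    have : (fun ξ : Plane => symbolD μ ξ a c) = fun _ => 0 := by
      ext ξ; simp [symbolD, one_apply_ne (Ne.symm hc)]
    rw [this, multiplier_const]
    ext φ
    exact zero_mul _
  · simp

lemma opM_eq_matMultiplier (B : Fin 2 → Matrix ι ι ℂ) (s : ℝ) (T : Matrix ι ι 𝓢'(Plane, ℂ)) :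
    opM B s T = matMultiplier (symbolM B s) T := by
  have h1 : ∀ μ, IsTemperateMatrix fun ξ => symbolD μ ξ + (s : ℂ) • B μ :=
    fun μ => (isTemperateMatrix_symbolD μ).add (.const _)
  have h2 := fun μ => (h1 μ).mul (isTemperateMatrix_symbolD μ)
  have e : ∀ μ, matMultiplier (fun ξ => (symbolD μ ξ + (s : ℂ) • B μ) * symbolD μ ξ) T =
      covD B s μ (partialD μ T) := fun μ => by
    rw [matMultiplier_mul (h1 μ) (isTemperateMatrix_symbolD μ),
      matMultiplier_add (isTemperateMatrix_symbolD μ) (.const _), matMultiplier_const,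
      matMultiplier_symbolD, matMultiplier_symbolD, covD]
  rw [opM, Fin.sum_univ_two, ← e, ← e, ← matMultiplier_add (h2 0) (h2 1),
    ← matMultiplier_neg ((h2 0).add (h2 1))]
  congr 1
  ext ξ : 1
  rw [symbolM, Fin.sum_univ_two]

lemma opMhat_eq_matMultiplier (B : Fin 2 → Matrix ι ι ℂ) (s : ℝ) (T : Matrix ι ι 𝓢'(Plane, ℂ)) :
    opMhat B s T = matMultiplier (symbolMhat B (s ^ 2)) T := by
  have h1 := fun μ => (isTemperateMatrix_symbolD (ι := ι) μ).mul (isTemperateMatrix_symbolD μ)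
  have e : ∀ μ, matMultiplier (fun ξ => symbolD μ ξ * symbolD μ ξ) T =
      partialD μ (partialD μ T) := fun μ => by
    rw [matMultiplier_mul (isTemperateMatrix_symbolD μ) (isTemperateMatrix_symbolD μ),
      matMultiplier_symbolD, matMultiplier_symbolD]
  have hc := IsTemperateMatrix.const (((s ^ 2 : ℝ) : ℂ) • massMatrix B)
  have h2 := ((h1 0).add (h1 1)).add hc
  rw [opMhat, Fin.sum_univ_two, ← e, ← e, ← matMultiplier_add (h1 0) (h1 1), ← matMultiplier_const,
    ← neg_add', ← matMultiplier_add ((h1 0).add (h1 1)) hc, ← matMultiplier_neg h2]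
  congr 1
  ext ξ : 1
  rw [symbolMhat, Fin.sum_univ_two, neg_add']

lemma rhoOp_eq_matMultiplier (Λ : ℝ) (σ : Plane → Matrix ι ι ℂ) :
    rhoOp Λ σ = matMultiplier fun ξ => besselSqrt (((1 / Λ ^ 2 : ℝ) : ℂ) • σ ξ) := rfl

/-! ### Operators which are diagonal in a fixed basis -/

/-- The operator which acts by `L j` on the component of index `j` in the basis given by the
matrix `P` with inverse `Q`. -/
def diagOp (P Q : Matrix ι ι ℂ) (L : ι → 𝓢'(Plane, ℂ) → 𝓢'(Plane, ℂ))
    (T : Matrix ι ι 𝓢'(Plane, ℂ)) : Matrix ι ι 𝓢'(Plane, ℂ) :=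
  constMul P fun j b => L j (constMul Q T j b)

/-- Composition becomes componentwise because the inner `Q P` cancels; identities between matrix
operators thereby reduce to scalar ones. -/
lemma diagOp_diagOp {P Q : Matrix ι ι ℂ} (h : Q * P = 1) (L L' : ι → 𝓢'(Plane, ℂ) → 𝓢'(Plane, ℂ))
    (T : Matrix ι ι 𝓢'(Plane, ℂ)) :
    diagOp P Q L (diagOp P Q L' T) = diagOp P Q (fun j S => L j (L' j S)) T := by
  exact congrArg (constMul P) (by ext j b : 1; exact congrArg (L j) (congrFun (congrFun (constMul_cancel h _) j) b))

lemma conj_apply (P Q : Matrix ι ι ℂ) (d : ι → ℂ) (a c : ι) :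
    (P * diagonal d * Q) a c = ∑ j, P a j * Q j c * d j := by
  rw [mul_apply]
  refine Finset.sum_congr rfl fun j _ => ?_
  rw [mul_diagonal]
  ring

lemma sum_apply_eq_diagOp (P Q : Matrix ι ι ℂ) (L : ι → 𝓢'(Plane, ℂ) →L[ℂ] 𝓢'(Plane, ℂ))
    (T : Matrix ι ι 𝓢'(Plane, ℂ)) (a b : ι) :
    ∑ c, ∑ j, (P a j * Q j c) • L j (T c b) = diagOp P Q (fun j => L j) T a b := by
  simp only [diagOp, constMul, map_sum, map_smul, Finset.smul_sum, mul_smul]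
  exact Finset.sum_comm

lemma funMul_eq_diagOp {P Q : Matrix ι ι ℂ} {Φ : Plane → Matrix ι ι ℂ} {e : ι → Plane → ℂ}
    (he : ∀ j, (e j).HasTemperateGrowth) (hΦ : ∀ x, Φ x = P * diagonal (fun j => e j x) * Q)
    (T : Matrix ι ι 𝓢'(Plane, ℂ)) : funMul Φ T = diagOp P Q (fun j => smulLeftCLM ℂ (e j)) T := by
  ext a b : 1
  rw [← sum_apply_eq_diagOp]
  refine Finset.sum_congr rfl fun c _ => ?_
  simp only [hΦ, conj_apply]
  have h : ∀ j, (fun x => P a j * Q j c * e j x).HasTemperateGrowth :=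
    fun j => (Function.HasTemperateGrowth.const _).mul (he j)
  rw [smulLeftCLM_sum fun j _ => h j]
  refine (_root_.sum_apply _ _ _).trans (Finset.sum_congr rfl fun j _ => ?_)
  exact congrArg (· (T c b)) (smulLeftCLM_smul (he j) (P a j * Q j c))

lemma matMultiplier_eq_diagOp {P Q : Matrix ι ι ℂ} {σ : Plane → Matrix ι ι ℂ} {g : ι → Plane → ℂ}
    (hg : ∀ j, (g j).HasTemperateGrowth) (hσ : ∀ x, σ x = P * diagonal (fun j => g j x) * Q)
    (T : Matrix ι ι 𝓢'(Plane, ℂ)) :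
    matMultiplier σ T = diagOp P Q (fun j => fourierMultiplierCLM ℂ (g j)) T := by
  ext a b : 1
  rw [← sum_apply_eq_diagOp]
  refine Finset.sum_congr rfl fun c _ => ?_
  simp only [hσ, conj_apply]
  have h : ∀ j, (fun ξ => P a j * Q j c * g j ξ).HasTemperateGrowth :=
    fun j => (Function.HasTemperateGrowth.const _).mul (hg j)
  rw [multiplier_sum h]
  exact Finset.sum_congr rfl fun j _ => multiplier_const_mul (hg j) _ _

end Sigma2D

end

noncomputable section

namespace Sigma2D

open Matrix FourierTransform TemperedDistribution

set_option linter.unusedSectionVars false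

variable {ι : Type*} [Fintype ι] [DecidableEq ι]

/-! ### Gauge factors as plane waves and the symbols of the operators in the eigenbasis. -/

lemma planeWave_one_sub (c x y : Plane) :
    planeWave 1 c (x - y) = planeWave (planeWave 1 c (-y)) c x := by
  simp only [planeWave, sub_eq_add_neg, inner_add_left, AddChar.map_add_eq_mul, Circle.coe_mul]
  ring

lemma planeWave_one_sub' (c x y : Plane) :
    planeWave 1 c (y - x) = planeWave (planeWave 1 c y) (-c) x := by
  simp only [planeWave, sub_eq_add_neg, inner_add_left, inner_neg_left, inner_neg_right,
    AddChar.map_add_eq_mul, Circle.coe_mul]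
  ring

lemma planeWave_one_zero (c : Plane) : planeWave 1 c 0 = 1 := by
  simp [planeWave]

lemma planeWave_one_mul_neg (c z : Plane) : planeWave 1 c (-z) * planeWave 1 c z = 1 := by
  simp only [planeWave, inner_neg_left, one_mul, ← Circle.coe_mul, ← AddChar.map_add_eq_mul,
    neg_add_cancel, AddChar.map_zero_eq_one, Circle.coe_one]

lemma norm_planeWave_one (c z : Plane) : ‖planeWave 1 c z‖ = 1 := by
  rw [planeWave, one_mul, Circle.norm_coe]

lemma continuous_planeWave (C : ℂ) (c : Plane) : Continuous (planeWave C c) :=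
  (hasTemperateGrowth_planeWave C c).1.continuous

lemma hasTemperateGrowth_comp_sub {g : Plane → ℂ} (hg : g.HasTemperateGrowth) (c : Plane) :
    (fun ξ => g (ξ - c)).HasTemperateGrowth :=
  hg.comp (Function.HasTemperateGrowth.id'.sub (.const c))

namespace IsDiagonalised

variable {B : Fin 2 → Matrix ι ι ℂ} {P Q : Matrix ι ι ℂ} {b : Fin 2 → ι → ℝ}

/-- The frequencies of the gauge factor. -/
def frequency (b : Fin 2 → ι → ℝ) (s : ℝ) (j : ι) : Plane :=
  !₂[-(s * b 0 j / (4 * π)), -(s * b 1 j / (4 * π))]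

lemma gaugeFactor_eq_planeWave (h : IsDiagonalised B P Q b) (s : ℝ) (z : Plane) :
    gaugeFactor B s z = P * diagonal (fun j => planeWave 1 (frequency b s j) z) * Q := by
  rw [h.gaugeFactor_eq]
  congr 3
  ext j
  rw [planeWave, one_mul, Real.fourierChar_apply]
  congr 1
  have : inner ℝ z (frequency b s j) = -(s * (z 0 * b 0 j + z 1 * b 1 j) / 2) / (2 * π) := by
    simp only [PiLp.inner_apply, Fin.sum_univ_two, frequency]
    simp
    field_simp
    ring
  rw [this, mul_div_cancel₀ _ (by positivity)]
  push_cast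
  ring

lemma symbolD_eq (h : IsDiagonalised B P Q b) (μ : Fin 2) (ξ : Plane) :
    symbolD μ ξ = P * diagonal (fun _ => 2 * π * Complex.I * (ξ μ : ℂ)) * Q := by
  rw [symbolD, h.one_eq_conj, smul_conj]
  simp only [mul_one]

lemma neg_conj (P Q : Matrix ι ι ℂ) (u : ι → ℂ) :
    -(P * diagonal u * Q) = P * diagonal (fun j => -u j) * Q := by
  rw [← neg_one_smul ℂ, smul_conj]
  simp only [neg_one_mul]

lemma laplaceSymbol_eq (ξ : Plane) : laplaceSymbol ξ = (2 * π) ^ 2 * (ξ 0 ^ 2 + ξ 1 ^ 2) := by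
  rw [laplaceSymbol, mul_pow, EuclideanSpace.real_norm_sq_eq, Fin.sum_univ_two]

lemma symbolMhat_eq (h : IsDiagonalised B P Q b) (τ : ℝ) (ξ : Plane) :
    symbolMhat B τ ξ = P * diagonal (fun j => helmholtzSymbol (mass b j * τ) ξ) * Q := by
  rw [symbolMhat, Fin.sum_univ_two, h.symbolD_eq, h.symbolD_eq, h.massMatrix_eq, sub_eq_add_neg]
  simp only [h.conj_mul_conj, smul_conj, conj_add_conj, neg_conj]
  congr 3
  ext j
  rw [helmholtzSymbol, laplaceSymbol_eq]
  push_cast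
  linear_combination (-(4 * (π : ℂ) ^ 2 * ((ξ 0 : ℂ) ^ 2 + (ξ 1 : ℂ) ^ 2))) * Complex.I_sq

/-- Completing the square: `|2πξ|² + 2π s b·ξ = |2π(ξ - c)|² - s² |b|²/4` with `c = -s b/(4π)`,
which is the frequency of the gauge factor. -/
lemma symbolM_eq (h : IsDiagonalised B P Q b) (s : ℝ) (ξ : Plane) :
    symbolM B s ξ = P * diagonal (fun j =>
      helmholtzSymbol (mass b j * s ^ 2) (ξ - frequency b s j)) * Q := by
  rw [symbolM, Fin.sum_univ_two, h.symbolD_eq, h.symbolD_eq, h.eq_conj 0, h.eq_conj 1]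
  simp only [h.conj_mul_conj, smul_conj, conj_add_conj, neg_conj]
  congr 3
  ext j
  have e : laplaceSymbol (ξ - frequency b s j) - mass b j * s ^ 2 =
      (2 * π) ^ 2 * (ξ 0 ^ 2 + ξ 1 ^ 2) + 2 * π * s * (b 0 j * ξ 0 + b 1 j * ξ 1) := by
    rw [laplaceSymbol_eq, mass]
    simp [frequency]
    field_simp
    ring
  rw [helmholtzSymbol, e]
  push_cast
  linear_combination (-(4 * (π : ℂ) ^ 2 * ((ξ 0 : ℂ) ^ 2 + (ξ 1 : ℂ) ^ 2) +
    2 * π * s * (b 0 j * ξ 0 + b 1 j * ξ 1))) * Complex.I_sq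

lemma besselSqrt_symbol (h : IsDiagonalised B P Q b) (Λ : ℝ) (l : ι → ℝ) (ξ : ι → Plane) :
    besselSqrt (((1 / Λ ^ 2 : ℝ) : ℂ) •
        (P * diagonal (fun j => helmholtzSymbol (l j) (ξ j)) * Q)) =
      P * diagonal (fun j => besselSymbol Λ⁻¹ (l j) (ξ j)) * Q := by
  rw [smul_conj]
  simp only [helmholtzSymbol, ← Complex.ofReal_mul]
  rw [h.besselSqrt_conj]
  simp only [besselSymbol]
  congr 4
  ext j
  congr 2
  rw [inv_pow]; ring

lemma opMhat_eq_diagOp (h : IsDiagonalised B P Q b) (s : ℝ) (T : Matrix ι ι 𝓢'(Plane, ℂ)) :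
    opMhat B s T =
      diagOp P Q (fun j => fourierMultiplierCLM ℂ (helmholtzSymbol (mass b j * s ^ 2))) T := by
  rw [opMhat_eq_matMultiplier]
  exact matMultiplier_eq_diagOp (fun j => hasTemperateGrowth_helmholtzSymbol _)
    (h.symbolMhat_eq (s ^ 2)) T

lemma opM_eq_diagOp (h : IsDiagonalised B P Q b) (s : ℝ) (T : Matrix ι ι 𝓢'(Plane, ℂ)) :
    opM B s T = diagOp P Q (fun j => fourierMultiplierCLM ℂ
      (fun ξ => helmholtzSymbol (mass b j * s ^ 2) (ξ - frequency b s j))) T := by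
  rw [opM_eq_matMultiplier]
  exact matMultiplier_eq_diagOp
    (fun j => hasTemperateGrowth_comp_sub (hasTemperateGrowth_helmholtzSymbol _) _)
    (h.symbolM_eq s) T

lemma rhoOp_symbolMhat (h : IsDiagonalised B P Q b) {Λ : ℝ} (hΛ : 0 < Λ) (τ : ℝ)
    (T : Matrix ι ι 𝓢'(Plane, ℂ)) : rhoOp Λ (symbolMhat B τ) T =
      diagOp P Q (fun j => fourierMultiplierCLM ℂ (besselSymbol Λ⁻¹ (mass b j * τ))) T := by
  rw [rhoOp_eq_matMultiplier]
  refine matMultiplier_eq_diagOp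
    (fun j => hasTemperateGrowth_besselSymbol (inv_nonneg.2 hΛ.le) _) (fun ξ => ?_) T
  rw [h.symbolMhat_eq, h.besselSqrt_symbol Λ _ fun _ => ξ]

lemma rhoOp_symbolM (h : IsDiagonalised B P Q b) {Λ : ℝ} (hΛ : 0 < Λ) (s : ℝ)
    (T : Matrix ι ι 𝓢'(Plane, ℂ)) : rhoOp Λ (symbolM B s) T =
      diagOp P Q (fun j => fourierMultiplierCLM ℂ
        (fun ξ => besselSymbol Λ⁻¹ (mass b j * s ^ 2) (ξ - frequency b s j))) T := by
  rw [rhoOp_eq_matMultiplier]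
  refine matMultiplier_eq_diagOp (fun j => hasTemperateGrowth_comp_sub
    (hasTemperateGrowth_besselSymbol (inv_nonneg.2 hΛ.le) _) _) (fun ξ => ?_) T
  rw [h.symbolM_eq, h.besselSqrt_symbol Λ _ fun j => ξ - frequency b s j]

lemma funMul_gaugeFactor (h : IsDiagonalised B P Q b) (s : ℝ) (y : Plane)
    (T : Matrix ι ι 𝓢'(Plane, ℂ)) : funMul (fun x => gaugeFactor B s (x - y)) T =
      diagOp P Q (fun j => smulLeftCLM ℂ
        (planeWave (planeWave 1 (frequency b s j) (-y)) (frequency b s j))) T :=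
  funMul_eq_diagOp (fun _ => hasTemperateGrowth_planeWave _ _)
    (fun x => by simp only [h.gaugeFactor_eq_planeWave, planeWave_one_sub _ x y]) T

lemma funMul_gaugeFactor_neg (h : IsDiagonalised B P Q b) (s : ℝ) (y : Plane)
    (T : Matrix ι ι 𝓢'(Plane, ℂ)) : funMul (fun x => gaugeFactor B s (y - x)) T =
      diagOp P Q (fun j => smulLeftCLM ℂ
        (planeWave (planeWave 1 (frequency b s j) y) (-frequency b s j))) T :=
  funMul_eq_diagOp (fun _ => hasTemperateGrowth_planeWave _ _)
    (fun x => by simp only [h.gaugeFactor_eq_planeWave, planeWave_one_sub' _ x y]) T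

end IsDiagonalised

lemma multiplier_comp_sub_planeWave {g : Plane → ℂ} (hg : g.HasTemperateGrowth) (C : ℂ) (c : Plane)
    (T : 𝓢'(Plane, ℂ)) :
    fourierMultiplierCLM ℂ (fun ξ => g (ξ - c)) (smulLeftCLM ℂ (planeWave C c) T) =
      smulLeftCLM ℂ (planeWave C c) (fourierMultiplierCLM ℂ g T) := by
  have h := multiplier_planeWave C (hasTemperateGrowth_comp_sub hg c) (c := c)
    (by simpa only [add_sub_cancel_right] using hg) T
  simpa only [add_sub_cancel_right] using h

/-- Conjugation with the gauge factor removes the first order term of `M`. -/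
theorem gaugeFactor_conj_opM {B : Fin 2 → Matrix ι ι ℂ} {P Q : Matrix ι ι ℂ} {b : Fin 2 → ι → ℝ}
    (h : IsDiagonalised B P Q b) (s : ℝ) (y : Plane) (T : Matrix ι ι 𝓢'(Plane, ℂ)) :
    funMul (fun x => gaugeFactor B s (y - x))
      (opM B s (funMul (fun x => gaugeFactor B s (x - y)) T)) = opMhat B s T := by
  rw [h.funMul_gaugeFactor, h.funMul_gaugeFactor_neg, h.opM_eq_diagOp, diagOp_diagOp h.mul_eq',
    diagOp_diagOp h.mul_eq', h.opMhat_eq_diagOp]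
  set c := IsDiagonalised.frequency b s
  congr 1
  ext j S : 2
  rw [multiplier_comp_sub_planeWave (hasTemperateGrowth_helmholtzSymbol _),
    smulLeftCLM_smulLeftCLM_apply (hasTemperateGrowth_planeWave _ _)
      (hasTemperateGrowth_planeWave _ _)]
  -- The waves `e^{2πi⟨c, x - y⟩}` and `e^{2πi⟨c, y - x⟩}` are inverse to each other.
  have e : planeWave (planeWave 1 (c j) (-y)) (c j) * planeWave (planeWave 1 (c j) y) (-c j) =
      fun _ => 1 := by
    ext x
    rw [Pi.mul_apply, ← planeWave_one_sub, ← planeWave_one_sub', ← neg_sub x y, mul_comm,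
      planeWave_one_mul_neg]
  rw [e, smulLeftCLM_const]
  ext φ
  exact one_mul _

end Sigma2D

end

noncomputable section

namespace Sigma2D

open Matrix TemperedDistribution

set_option linter.unusedSectionVars false

variable {ι : Type*} [Fintype ι] [DecidableEq ι]

/-! ### Green's functions of matrix operators -/

lemma constMul_deltaMat (C : Matrix ι ι ℂ) (y : Plane) :
    constMul C (deltaMat y) = fun j c => C j c • delta y := by
  ext j c φ
  rw [constMul_apply, Finset.sum_eq_single c]
  · simp only [deltaMat, if_true]; rfl
  · intro a _ ha
    rw [deltaMat, if_neg ha]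
    exact mul_zero _
  · simp

lemma norm_mul_apply_le (C D : Matrix ι ι ℂ) {r : ι → ℝ} {c : ι} (h : ∀ j, ‖D j c‖ ≤ r j) (a : ι) :
    ‖(C * D) a c‖ ≤ ∑ j, ‖C a j‖ * r j := by
  rw [mul_apply]
  refine (norm_sum_le _ _).trans (Finset.sum_le_sum fun j _ => ?_)
  rw [norm_mul]
  exact mul_le_mul_of_nonneg_left (h j) (norm_nonneg _)

lemma continuousOn_mul_apply (C : Matrix ι ι ℂ) {γ : Plane → Matrix ι ι ℂ} {S : Set Plane} {c : ι}
    (h : ∀ j, ContinuousOn (fun z => γ z j c) S) (a : ι) :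
    ContinuousOn (fun z => (C * γ z) a c) S := by
  simp only [mul_apply]
  exact continuousOn_finsetSum _ fun j _ => continuousOn_const.mul (h j)

/-- In the eigenbasis the source `1 · δ` becomes `Q δ`, so the entry `(j, c)` is a scalar Green's
function with source strength `Q j c`; multiplication by `P` restores the identity. -/
lemma isGreenFunction_of_rows {M : ℝ} {P Q : Matrix ι ι ℂ} (hPQ : P * Q = 1) (hQP : Q * P = 1)
    {op : Matrix ι ι 𝓢'(Plane, ℂ) → Matrix ι ι 𝓢'(Plane, ℂ)} {L : ι → 𝓢'(Plane, ℂ) → 𝓢'(Plane, ℂ)}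
    (hop : ∀ T, op T = diagOp P Q L T) {γ : Plane → Matrix ι ι ℂ}
    (hc : ∀ j c, ContinuousOn (fun z => γ z j c) {0}ᶜ)
    (hs : ∀ j c, ∃ C : ℝ, ∀ z : Plane, 0 < ‖z‖ → ‖z‖ ≤ 1 → ‖γ z j c - Q j c * R0 M z‖ ≤ C)
    (he : ∀ j c y, ∃ T, Represents T (fun x => γ (x - y) j c) ∧ L j T = Q j c • delta y) :
    IsGreenFunction M op fun z => P * γ z := by
  refine ⟨fun a b => continuousOn_mul_apply P (fun j => hc j b) a, ?_, fun y => ?_⟩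
  · choose C hC using hs
    -- One constant must serve all entries; the sum of absolute values dominates each summand.
    refine ⟨∑ a, ∑ b, |∑ j, ‖P a j‖ * C j b|, fun z h0 h1 a b => ?_⟩
    have e : P * γ z - (R0 M z : ℂ) • (1 : Matrix ι ι ℂ) = P * (γ z - (R0 M z : ℂ) • Q) := by
      rw [Matrix.mul_sub, Matrix.mul_smul, hPQ]
    rw [e]
    have h2 : ‖(P * (γ z - (R0 M z : ℂ) • Q)) a b‖ ≤ ∑ j, ‖P a j‖ * C j b :=
      norm_mul_apply_le _ _ (fun j => by
        have := hC j b z h0 h1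
        rwa [mul_comm] at this) a
    refine (h2.trans (le_abs_self _)).trans ?_
    refine le_trans ?_ (Finset.single_le_sum (f := fun a => ∑ b, |∑ j, ‖P a j‖ * C j b|)
      (fun a _ => Finset.sum_nonneg fun b _ => abs_nonneg _) (Finset.mem_univ a))
    exact Finset.single_le_sum (f := fun b => |∑ j, ‖P a j‖ * C j b|)
      (fun b _ => abs_nonneg _) (Finset.mem_univ b)
  · choose T hT hT' using he
    refine ⟨constMul P fun j c => T j c y,
      MatRepresents.constMul (u := fun x => γ (x - y)) (fun j c => hT j c y) P, ?_⟩
    have e : constMul Q (constMul P fun j c => T j c y) = fun j c => T j c y :=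
      constMul_cancel hQP _
    rw [hop, diagOp, e]
    simp only [hT']
    exact (congrArg (constMul P) (constMul_deltaMat Q y)).symm.trans (constMul_cancel hPQ _)

lemma mapsTo_diagOp {P Q : Matrix ι ι ℂ} (hQP : Q * P = 1)
    {op : Matrix ι ι 𝓢'(Plane, ℂ) → Matrix ι ι 𝓢'(Plane, ℂ)} {L : ι → 𝓢'(Plane, ℂ) → 𝓢'(Plane, ℂ)}
    (hop : ∀ T, op T = diagOp P Q L T) {u v : Plane → Matrix ι ι ℂ}
    (h : ∀ j c, ∃ T, Represents T (fun x => u x j c) ∧ Represents (L j T) (fun x => v x j c)) :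
    MapsTo op (fun x => P * u x) fun x => P * v x := by
  choose T hT hT' using h
  refine ⟨constMul P T, MatRepresents.constMul hT P, ?_⟩
  have e : constMul Q (constMul P T) = T := constMul_cancel hQP _
  rw [hop, diagOp, e]
  exact MatRepresents.constMul hT' P

/-- The factor `e^{2πi⟨c, z⟩} - 1` is `O(|z|)` and outweighs the logarithm, so multiplication by a
plane wave does not change the singular part. -/
lemma exists_bound_planeWave_sub_one_mul_R0 {M : ℝ} (hM : 0 < M) (c : Plane) :
    ∃ C : ℝ, ∀ z : Plane, 0 < ‖z‖ → ‖z‖ ≤ 1 → ‖(planeWave 1 c z - 1) * R0 M z‖ ≤ C := by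
  obtain ⟨C, hC0, hC⟩ := abs_log_mul_le hM
  refine ⟨2 * π * ‖c‖ * (1 / (4 * π) * (C * 2)), fun z h0 h1 => ?_⟩
  have h2 : ‖planeWave 1 c z - 1‖ ≤ 2 * π * ‖c‖ * ‖z‖ := by
    rw [planeWave, one_mul, Real.fourierChar_apply]
    have h3 := Real.norm_exp_I_mul_ofReal_sub_one_le (x := 2 * π * (inner ℝ z c : ℝ))
    rw [mul_comm] at h3
    refine h3.trans ?_
    rw [norm_mul, Real.norm_of_nonneg (by positivity : (0 : ℝ) ≤ 2 * π), mul_assoc (2 * π)]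
    refine mul_le_mul_of_nonneg_left ?_ (by positivity)
    rw [mul_comm]
    exact norm_inner_le_norm z c
  have h4 : ‖(R0 M z : ℂ)‖ ≤ 1 / (4 * π) * (C * 2) / ‖z‖ := by
    rw [Complex.norm_real, R0, norm_mul, norm_neg,
      Real.norm_of_nonneg (by positivity : (0 : ℝ) ≤ 1 / (4 * π)), mul_div_assoc]
    refine mul_le_mul_of_nonneg_left ((hC (‖z‖ ^ 2) (by positivity)).trans ?_) (by positivity)
    rw [Real.sqrt_sq h0.le]
    gcongr
    nlinarith
  rw [norm_mul]
  refine (mul_le_mul h2 h4 (norm_nonneg _) (by positivity)).trans (le_of_eq ?_)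
  field_simp

/-! ### Expansions in `s²` -/

lemma isLittleOSq_iff {S : Set Plane} {F : ℝ → Plane → Matrix ι ι ℂ} :
    IsLittleOSq S F ↔ ∀ a b, ScalarLittleO S fun s x => F s x a b := by
  constructor
  · intro h a b r hr ε hε
    filter_upwards [h r hr ε hε] with s hs x hx hxr using hs x hx hxr a b
  · intro h r hr ε hε
    filter_upwards [eventually_all.2 fun a => eventually_all.2 fun b => h a b r hr ε hε]
      with s hs x hx hxr a b using hs a b x hx hxr

lemma IsLittleOSq.mul_left {S : Set Plane} {F : ℝ → Plane → Matrix ι ι ℂ} (h : IsLittleOSq S F)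
    (C : Matrix ι ι ℂ) : IsLittleOSq S fun s x => C * F s x := by
  rw [isLittleOSq_iff] at h ⊢
  intro a b
  simp only [mul_apply]
  exact ScalarLittleO.sum _ fun j _ => (h j b).const_mul _

/-- The difference quotient at `0` is `g` itself, so continuity of the slope function is enough. -/
lemma hasDerivAt_mul_self_of_continuousAt {g : ℝ → ℝ} (hg : ContinuousAt g 0) :
    HasDerivAt (fun τ => τ * g τ) (g 0) 0 := by
  rw [hasDerivAt_iff_tendsto_slope_zero]
  refine (hg.tendsto.mono_left nhdsWithin_le_nhds).congr' ?_
  filter_upwards [self_mem_nhdsWithin] with t ht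
  have ht' : t ≠ 0 := ht
  simp [ht']

namespace IsDiagonalised

variable {B : Fin 2 → Matrix ι ι ℂ} {P Q : Matrix ι ι ℂ} {b : Fin 2 → ι → ℝ}

/-- The components of `r + s² m w` in the eigenbasis. -/
lemma expansion_eq (h : IsDiagonalised B P Q b) (r w s : ℝ) :
    (r : ℂ) • (1 : Matrix ι ι ℂ) + ((s ^ 2 * w : ℝ) : ℂ) • massMatrix B =
      P * Matrix.of fun j c => Q j c * ((r + s ^ 2 * (mass b j * w) : ℝ) : ℂ) := by
  rw [h.massMatrix_eq, h.one_eq_conj, smul_conj, smul_conj, conj_add_conj, Matrix.mul_assoc]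
  congr 1
  ext j c
  rw [diagonal_mul, of_apply]
  push_cast
  ring

/-- Multiplication by a constant matrix preserves `o(s²)`, and `P` and `Q` are inverse to each
other, so the matrix expansion is equivalent to scalar ones with `m` replaced by its eigenvalues. -/
lemma isLittleOSq_iff_rows (h : IsDiagonalised B P Q b) {S : Set Plane}
    {γ : ℝ → Plane → Matrix ι ι ℂ} {r w : Plane → ℝ} :
    IsLittleOSq S (fun s z => P * γ s z -
      ((r z : ℂ) • (1 : Matrix ι ι ℂ) + ((s ^ 2 * w z : ℝ) : ℂ) • massMatrix B)) ↔
    ∀ j c, ScalarLittleO S fun s z => γ s z j c -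
      Q j c * ((r z + s ^ 2 * (mass b j * w z) : ℝ) : ℂ) := by
  have h1 : (∀ j c, ScalarLittleO S fun s z => γ s z j c -
      Q j c * ((r z + s ^ 2 * (mass b j * w z) : ℝ) : ℂ)) ↔ IsLittleOSq S fun s z => γ s z -
        Matrix.of fun j c => Q j c * ((r z + s ^ 2 * (mass b j * w z) : ℝ) : ℂ) := by
    rw [isLittleOSq_iff]; rfl
  simp only [h.expansion_eq, ← Matrix.mul_sub, h1]
  refine ⟨fun h2 => ?_, fun h2 => h2.mul_left P⟩
  have h3 := h2.mul_left Q
  simpa only [← Matrix.mul_assoc, h.mul_eq', Matrix.one_mul] using h3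

/-- This is the passage from an arbitrary matrix Green's function to scalar ones: multiplication by
`Q` diagonalises the operator and turns the source `1` into `Q`. -/
lemma isScalarGreen_row (h : IsDiagonalised B P Q b) {M s : ℝ} {g : Plane → Matrix ι ι ℂ}
    (hg : IsGreenFunction M (opMhat B s) g) (j c : ι) :
    IsScalarGreen M (mass b j * s ^ 2) (Q j c) fun z => (Q * g z) j c := by
  refine ⟨continuousOn_mul_apply Q (fun a => hg.continuous_off a c) j, ?_, fun y => ?_⟩
  · obtain ⟨C, hC⟩ := hg.singularity
    refine ⟨∑ a, ‖Q j a‖ * C, fun z h0 h1 => ?_⟩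
    have e : (Q * g z) j c - Q j c * R0 M z =
        (Q * (g z - (R0 M z : ℂ) • (1 : Matrix ι ι ℂ))) j c := by
      rw [Matrix.mul_sub, Matrix.mul_smul, Matrix.mul_one, Matrix.sub_apply, Matrix.smul_apply,
        smul_eq_mul, mul_comm]
    rw [e]
    exact norm_mul_apply_le _ _ (fun a => hC z h0 h1 a c) j
  · obtain ⟨T, hT, hT'⟩ := hg.eqn y
    refine ⟨constMul Q T j c, hT.constMul Q j c, ?_⟩
    rw [h.opMhat_eq_diagOp, diagOp] at hT'
    have h1 := (constMul_cancel h.mul_eq' _).symm.trans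
      ((congrArg (constMul Q) hT').trans (constMul_deltaMat Q y))
    exact congrFun (congrFun h1 j) c

lemma mul_cancel_left (h : IsDiagonalised B P Q b) (X : Matrix ι ι ℂ) : P * (Q * X) = X := by
  rw [← Matrix.mul_assoc, h.mul_eq, Matrix.one_mul]

lemma exists_isNormalisedGreen (h : IsDiagonalised B P Q b) {M : ℝ} (hM : 0 < M) :
    ∃ Ghat, IsNormalisedGreen M B Ghat := by
  have hG := fun s j c => isScalarGreen_fundSol hM
    (mul_nonneg (mass_nonneg b j) (sq_nonneg s)) (Q j c)
  refine ⟨fun s z => P * Matrix.of fun j c => Q j c * fundSol M (mass b j * s ^ 2) (‖z‖ ^ 2),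
    fun s _ => ?_, ?_⟩
  · exact isGreenFunction_of_rows h.mul_eq h.mul_eq' (h.opMhat_eq_diagOp s)
      (fun j c => (hG s j c).continuous_off) (fun j c => (hG s j c).singularity)
      (fun j c => (hG s j c).eqn)
  · exact h.isLittleOSq_iff_rows.2 fun j c => scalarLittleO_fundSol hM (mass b j) (Q j c)

lemma gaugeFactor_mul (h : IsDiagonalised B P Q b) (s : ℝ) (z : Plane) (X : Matrix ι ι ℂ) :
    gaugeFactor B s z * (P * X) =
      P * Matrix.of fun j c => planeWave 1 (frequency b s j) z * X j c := by
  rw [h.gaugeFactor_eq_planeWave, Matrix.mul_assoc, ← Matrix.mul_assoc Q, h.mul_eq', Matrix.one_mul,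
    Matrix.mul_assoc]
  congr 1
  ext j c
  rw [diagonal_mul, of_apply]

/-- Multiplication by the gauge factor turns Green's functions of `M̂` into those of `M`. -/
lemma isGreenFunction_gaugeFactor_mul (h : IsDiagonalised B P Q b) {M s : ℝ} (hM : 0 < M)
    {g : Plane → Matrix ι ι ℂ} (hg : IsGreenFunction M (opMhat B s) g) :
    IsGreenFunction M (opM B s) fun z => gaugeFactor B s z * g z := by
  have hr := h.isScalarGreen_row hg
  set c := frequency b s with hc
  have e : (fun z => gaugeFactor B s z * g z) =
      fun z => P * Matrix.of fun j k => planeWave 1 (c j) z * (Q * g z) j k := by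
    ext z : 1
    rw [← h.gaugeFactor_mul, h.mul_cancel_left]
  rw [e]
  refine isGreenFunction_of_rows h.mul_eq h.mul_eq' (h.opM_eq_diagOp s)
    (fun j k => (continuous_planeWave 1 (c j)).continuousOn.mul (hr j k).continuous_off)
    (fun j k => ?_) (fun j k y => ?_)
  · obtain ⟨C, hC⟩ := (hr j k).singularity
    obtain ⟨D, hD⟩ := exists_bound_planeWave_sub_one_mul_R0 hM (c j)
    refine ⟨C + ‖Q j k‖ * D, fun z h0 h1 => ?_⟩
    -- The first term is bounded because the wave has modulus one, the second because the wave
    -- equals `1` at the origin.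
    have e2 : planeWave 1 (c j) z * (Q * g z) j k - Q j k * R0 M z =
        planeWave 1 (c j) z * ((Q * g z) j k - Q j k * R0 M z) +
          Q j k * ((planeWave 1 (c j) z - 1) * R0 M z) := by ring
    rw [of_apply, e2]
    refine (norm_add_le _ _).trans (add_le_add ?_ ?_)
    · rw [norm_mul, norm_planeWave_one, one_mul]
      exact hC z h0 h1
    · rw [norm_mul]
      exact mul_le_mul_of_nonneg_left (hD z h0 h1) (norm_nonneg _)
  · obtain ⟨T, hT, hT'⟩ := (hr j k).eqn y
    have hw := hasTemperateGrowth_planeWave (planeWave 1 (c j) (-y)) (c j)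
    refine ⟨smulLeftCLM ℂ (planeWave (planeWave 1 (c j) (-y)) (c j)) T, ?_, ?_⟩
    · have := hT.smulLeft hw
      simp only [← planeWave_one_sub] at this
      exact this
    · rw [multiplier_comp_sub_planeWave (hasTemperateGrowth_helmholtzSymbol _), hT', map_smul,
        smulLeft_delta hw, ← planeWave_one_sub, sub_self, planeWave_one_zero]
      ext φ
      change Q j k * (1 * _) = Q j k * _
      rw [one_mul]

/-- The smoothed Green's functions. -/
lemma exists_smoothed (h : IsDiagonalised B P Q b) {M Λ : ℝ} (hM : 0 < M) (hΛ : 0 < Λ)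
    {Ghat : ℝ → Plane → Matrix ι ι ℂ} (hG : IsNormalisedGreen M B Ghat) :
    ∃ K : ℝ → Plane → Matrix ι ι ℂ, (∀ s > 0, Continuous (K s)) ∧
      (∀ s > 0, ∀ y : Plane, MapsTo (rhoOp Λ (symbolMhat B (s ^ 2)))
        (fun x => Ghat s (x - y)) (fun x => K s (x - y))) ∧
      (IsLittleOSq Set.univ fun s z => K s z - ((R0tilde M Λ z : ℂ) • (1 : Matrix ι ι ℂ) +
        ((s ^ 2 * (R1tilde M Λ z + R0hat M Λ z) : ℝ) : ℂ) • massMatrix B)) ∧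
      (∀ s > 0, ∀ y : Plane, MapsTo (rhoOp Λ (symbolM B s))
        (fun x => gaugeFactor B s (x - y) * Ghat s (x - y))
        (fun x => gaugeFactor B s (x - y) * K s (x - y))) := by
  have ha : 0 < Λ⁻¹ := inv_pos.2 hΛ
  have hr := fun s hs => h.isScalarGreen_row (hG.green s hs)
  have hk : ∀ s j c, ∃ κ : Plane → ℂ, 0 < s → Continuous κ ∧ ∀ x, x ≠ 0 →
      κ x = (Q * Ghat s x) j c + Q j c * greenKernel Λ⁻¹ (mass b j * s ^ 2) ‖x‖ := by
    intro s j c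
    by_cases hs : 0 < s
    · obtain ⟨κ, hκ⟩ := (hr s hs j c).exists_continuous hM
        (mul_nonneg (mass_nonneg b j) (sq_nonneg s)) ha
      exact ⟨κ, fun _ => hκ⟩
    · exact ⟨0, fun hs' => absurd hs' hs⟩
  choose κ hκ using hk
  have hrow : ∀ s > 0, ∀ j c y, ∃ T, Represents T (fun x => (Q * Ghat s (x - y)) j c) ∧
      Represents (fourierMultiplierCLM ℂ (besselSymbol Λ⁻¹ (mass b j * s ^ 2)) T)
        fun x => κ s j c (x - y) := by
    intro s hs j c y
    obtain ⟨T, hT, hT'⟩ := (hr s hs j c).eqn y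
    exact ⟨T, hT, (hT.besselSymbol ha.le hT').congr_off y fun x hx =>
      ((hκ s j c hs).2 (x - y) (sub_ne_zero.2 hx)).symm⟩
  refine ⟨fun s z => P * Matrix.of fun j c => κ s j c z, fun s hs => ?_, fun s hs y => ?_, ?_,
    fun s hs y => ?_⟩
  · exact continuous_const.matrix_mul (continuous_matrix fun j c => (hκ s j c hs).1)
  · have := mapsTo_diagOp h.mul_eq' (h.rhoOp_symbolMhat hΛ (s ^ 2))
      (u := fun x => Q * Ghat s (x - y)) (v := fun x => Matrix.of fun j c => κ s j c (x - y))
      fun j c => hrow s hs j c y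
    simpa only [h.mul_cancel_left] using this
  · refine h.isLittleOSq_iff_rows.2 fun j c => ?_
    have h1 := hG.expansion
    have h2 : IsLittleOSq {0}ᶜ fun s z => P * (Q * Ghat s z) -
        ((R0 M z : ℂ) • (1 : Matrix ι ι ℂ) + ((s ^ 2 * R1 M z : ℝ) : ℂ) • massMatrix B) := by
      simpa only [h.mul_cancel_left] using h1
    have h3 := scalarLittleO_smoothed hM ha (h.isLittleOSq_iff_rows.1 h2 j c)
      (fun s hs => (hκ s j c hs).1) fun s hs => (hκ s j c hs).2
    rw [inv_inv] at h3
    exact h3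
  · have := mapsTo_diagOp h.mul_eq' (h.rhoOp_symbolM hΛ s)
      (u := fun x => Matrix.of fun j c =>
        planeWave 1 (frequency b s j) (x - y) * (Q * Ghat s (x - y)) j c)
      (v := fun x => Matrix.of fun j c =>
        planeWave 1 (frequency b s j) (x - y) * κ s j c (x - y)) fun j c => by
      obtain ⟨T, hT, hT'⟩ := hrow s hs j c y
      have hw := hasTemperateGrowth_planeWave (planeWave 1 (frequency b s j) (-y)) (frequency b s j)
      refine ⟨smulLeftCLM ℂ (planeWave (planeWave 1 (frequency b s j) (-y)) (frequency b s j)) T,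
        ?_, ?_⟩
      · have := hT.smulLeft hw
        simp only [← planeWave_one_sub] at this
        exact this
      · have := hT'.smulLeft hw
        simp only [← planeWave_one_sub] at this
        rw [multiplier_comp_sub_planeWave (hasTemperateGrowth_besselSymbol ha.le _)]
        exact this
    have e1 : ∀ x, gaugeFactor B s x * Ghat s x = P * Matrix.of fun j c =>
        planeWave 1 (frequency b s j) x * (Q * Ghat s x) j c := fun x => by
      rw [← h.gaugeFactor_mul, h.mul_cancel_left]
    have e2 : ∀ x, gaugeFactor B s x * (P * Matrix.of fun j c => κ s j c x) = P * Matrix.of fun j c =>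
        planeWave 1 (frequency b s j) x * κ s j c x := fun x => by
      rw [h.gaugeFactor_mul]; rfl
    simp only [e1, e2]
    exact this

/-- The derivative in `s²` of the smoothed `R₀`. -/
lemma exists_hasDerivAt_smoothed_R0 (h : IsDiagonalised B P Q b) {M Λ : ℝ} (hM : 0 < M)
    (hΛ : 0 < Λ) : ∃ F : ℝ → Plane → Matrix ι ι ℂ, (∀ τ, Continuous (F τ)) ∧
      (∀ τ, MapsTo (rhoOp Λ (symbolMhat B τ))
        (fun x => (R0 M x : ℂ) • (1 : Matrix ι ι ℂ)) (F τ)) ∧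
      ∀ x a c, HasDerivAt (fun τ : ℝ => F τ x a c)
        ((R0hat M Λ x : ℂ) * massMatrix B a c) 0 := by
  have ha : 0 < Λ⁻¹ := inv_pos.2 hΛ
  have hS := continuous_shiftSlope M Λ⁻¹
  refine ⟨fun τ x => P * Matrix.of fun j c => Q j c *
    ((R0tilde M Λ x + mass b j * τ * shiftSlope M Λ⁻¹ (mass b j * τ) x : ℝ) : ℂ),
    fun τ => ?_, fun τ => ?_, fun x a c => ?_⟩
  · refine continuous_const.matrix_mul (continuous_matrix fun j c => ?_)
    have h1 := continuous_R0tilde hM ha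
    rw [inv_inv] at h1
    have h2 : Continuous fun x => shiftSlope M Λ⁻¹ (mass b j * τ) x :=
      hS.comp (f := fun x => (mass b j * τ, x)) (by fun_prop)
    exact continuous_const.mul (Complex.continuous_ofReal.comp (h1.add (continuous_const.mul h2)))
  · obtain ⟨T, hT, hT'⟩ := exists_R0 hM
    have e : (fun x => (R0 M x : ℂ) • (1 : Matrix ι ι ℂ)) =
        fun x => P * Matrix.of fun j c => Q j c * (R0 M x : ℂ) := by
      ext x : 1
      have := h.expansion_eq (R0 M x) 0 0
      simpa using this
    rw [e]
    refine mapsTo_diagOp h.mul_eq' (h.rhoOp_symbolMhat hΛ τ)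
      (u := fun x => Matrix.of fun j c => Q j c * (R0 M x : ℂ))
      (v := fun x => Matrix.of fun j c => Q j c *
        ((R0tilde M Λ x + mass b j * τ * shiftSlope M Λ⁻¹ (mass b j * τ) x : ℝ) : ℂ)) fun j c =>
      ⟨Q j c • T, hT.smul _, ?_⟩
    have h1 := (represents_besselSymbol_R0 hM ha hT hT' (mass b j * τ)).smul (Q j c)
    rw [inv_inv] at h1
    rw [map_smul]
    exact h1
  · have h1 : ∀ j, HasDerivAt (fun τ => R0tilde M Λ x +
        mass b j * τ * shiftSlope M Λ⁻¹ (mass b j * τ) x) (mass b j * R0hat M Λ x) 0 := by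
      intro j
      have h2 : Continuous fun τ => mass b j * shiftSlope M Λ⁻¹ (mass b j * τ) x :=
        -- The correction to `R̃₀` is `τ` times this continuous function, so its derivative at `0`
        -- is the value there, which `shiftSlope_zero` identifies.
        continuous_const.mul (hS.comp (f := fun τ : ℝ => (mass b j * τ, x)) (by fun_prop))
      have h3 := (hasDerivAt_mul_self_of_continuousAt h2.continuousAt).const_add (R0tilde M Λ x)
      rw [mul_zero, shiftSlope_zero hM ha, inv_inv] at h3
      refine h3.congr_of_eventuallyEq (.of_forall fun τ => ?_)
      simp only
      ring
    simp only [mul_apply, of_apply]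
    have h4 := HasDerivAt.fun_sum (u := Finset.univ) fun j _ =>
      (((h1 j).ofReal_comp).const_mul (Q j c)).const_mul (P a j)
    convert! h4 using 1
    rw [h.massMatrix_eq, conj_apply, Finset.mul_sum]
    refine Finset.sum_congr rfl fun j _ => ?_
    push_cast
    ring

end IsDiagonalised

lemma rhoLaplace_eq (Λ : ℝ) (T : 𝓢'(Plane, ℂ)) :
    rhoLaplace Λ T = fourierMultiplierCLM ℂ (besselSymbol Λ⁻¹ 0) T := by
  have e : (fun ξ : Plane => besselSqrt (((2 * π * ‖ξ‖ / Λ) ^ 2 : ℝ) : ℂ)) = besselSymbol Λ⁻¹ 0 := by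
    ext ξ
    rw [(IsDiagonalised.besselSqrt_ofReal _).1, besselSymbol, laplaceSymbol]
    congr 2
    ring
  rw [rhoLaplace, e]

end Sigma2D

end

/-! ### The theorem. -/

theorem theorem1 {N : ℕ} {ι : Type*} [Fintype ι] [DecidableEq ι]
    (t : Module.Basis ι ℝ (Sigma2D.su N))
    (ht : ∀ a b : ι, killingForm ℝ (Sigma2D.su N) (t a) (t b) = if a = b then (-2 : ℝ) else 0)
    (β : Fin 2 → ι → ℝ) (B : Fin 2 → Matrix ι ι ℂ) (hB : B = Sigma2D.connection t β)
    (hcomm : ∀ μ ν, B μ * B ν = B ν * B μ)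
    (M₀ Λ : ℝ) (hM₀ : 0 < M₀) (hΛ : 0 < Λ) :
    -- conjugation of `M` by the gauge factor gives `M̂`
    (∀ (s : ℝ) (y : Sigma2D.Plane) (T : Matrix ι ι 𝓢'(Sigma2D.Plane, ℂ)),
      Sigma2D.funMul (fun x => Sigma2D.gaugeFactor B s (y - x))
        (Sigma2D.opM B s (Sigma2D.funMul (fun x => Sigma2D.gaugeFactor B s (x - y)) T)) =
      Sigma2D.opMhat B s T) ∧
    -- normalised Green's functions of `M̂` exist
    (∃ Ghat : ℝ → Sigma2D.Plane → Matrix ι ι ℂ, Sigma2D.IsNormalisedGreen M₀ B Ghat) ∧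
    -- the expansion of `ρ(√M̂ / Λ) Ĝ`, and the same for `M` and its Green's function `Φ₀ Ĝ`
    (∀ Ghat : ℝ → Sigma2D.Plane → Matrix ι ι ℂ, Sigma2D.IsNormalisedGreen M₀ B Ghat →
      (∀ s > 0, Sigma2D.IsGreenFunction M₀ (Sigma2D.opM B s)
        (fun z => Sigma2D.gaugeFactor B s z * Ghat s z)) ∧
      ∃ K : ℝ → Sigma2D.Plane → Matrix ι ι ℂ,
        (∀ s > 0, Continuous (K s)) ∧
        (∀ s > 0, ∀ y : Sigma2D.Plane,
          Sigma2D.MapsTo (Sigma2D.rhoOp Λ (Sigma2D.symbolMhat B (s ^ 2)))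
            (fun x => Ghat s (x - y)) (fun x => K s (x - y))) ∧
        (Sigma2D.IsLittleOSq Set.univ fun s z => K s z -
          ((Sigma2D.R0tilde M₀ Λ z : ℂ) • (1 : Matrix ι ι ℂ) +
            ((s ^ 2 * (Sigma2D.R1tilde M₀ Λ z + Sigma2D.R0hat M₀ Λ z) : ℝ) : ℂ) •
              Sigma2D.massMatrix B)) ∧
        (∀ s > 0, ∀ y : Sigma2D.Plane,
          Sigma2D.MapsTo (Sigma2D.rhoOp Λ (Sigma2D.symbolM B s))
            (fun x => Sigma2D.gaugeFactor B s (x - y) * Ghat s (x - y))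
            (fun x => Sigma2D.gaugeFactor B s (x - y) * K s (x - y)))) ∧
    -- `R̃₀ = ρ(√A / Λ) R₀` and `R̃₁ = ρ(√A / Λ) R₁`
    (∃ T, Sigma2D.Represents T (fun x => (Sigma2D.R0 M₀ x : ℂ)) ∧
      Sigma2D.Represents (Sigma2D.rhoLaplace Λ T) (fun x => (Sigma2D.R0tilde M₀ Λ x : ℂ))) ∧
    (∃ T, Sigma2D.Represents T (fun x => (Sigma2D.R1 M₀ x : ℂ)) ∧
      Sigma2D.Represents (Sigma2D.rhoLaplace Λ T) (fun x => (Sigma2D.R1tilde M₀ Λ x : ℂ))) ∧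
    -- `m R̂₀` is the derivative of `ρ(√M̂ / Λ) R₀` in `τ = s²` at `τ = 0`
    (∃ F : ℝ → Sigma2D.Plane → Matrix ι ι ℂ,
      (∀ τ, Continuous (F τ)) ∧
      (∀ τ, Sigma2D.MapsTo (Sigma2D.rhoOp Λ (Sigma2D.symbolMhat B τ))
        (fun x => (Sigma2D.R0 M₀ x : ℂ) • (1 : Matrix ι ι ℂ)) (F τ)) ∧
      ∀ x a b, HasDerivAt (fun τ : ℝ => F τ x a b)
        ((Sigma2D.R0hat M₀ Λ x : ℂ) * Sigma2D.massMatrix B a b) 0) := by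
  subst hB
  obtain ⟨P, Q, b, h⟩ := Sigma2D.exists_isDiagonalised (Sigma2D.conjTranspose_connection t ht β) hcomm
  have hΛ' : 0 < Λ⁻¹ := inv_pos.2 hΛ
  refine ⟨Sigma2D.gaugeFactor_conj_opM h, h.exists_isNormalisedGreen hM₀, fun Ghat hG =>
    ⟨fun s hs => h.isGreenFunction_gaugeFactor_mul hM₀ (hG.green s hs), h.exists_smoothed hM₀ hΛ hG⟩,
    ?_, ?_, h.exists_hasDerivAt_smoothed_R0 hM₀ hΛ⟩
  · obtain ⟨T, hT, hT'⟩ := Sigma2D.exists_R0 hM₀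
    refine ⟨T, hT, ?_⟩
    -- Spectral shift `0` with radius `a = Λ⁻¹` is the operator `ρ(√A / Λ)`.
    have := Sigma2D.represents_besselSymbol_R0 hM₀ hΛ' hT hT' 0
    simpa only [zero_mul, add_zero, inv_inv, Sigma2D.rhoLaplace_eq] using this
  · obtain ⟨T, S, hT, hS, hTS, hS'⟩ := Sigma2D.exists_R1 hM₀
    refine ⟨T, hT, ?_⟩
    have := Sigma2D.represents_besselSymbol_R1 hM₀ hΛ' hT hS hTS hS'
    simpa only [inv_inv, Sigma2D.rhoLaplace_eq] using this
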